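/- Let $n\in\mathbb N_0$ and let $\mathcal S'=\mathcal S'(\mathbb R^n)$ be the space of tempered distributions with its weak topology. Fix a nontrivial window $\phi\in\mathcal S(\mathbb R^n)$ and write $\langle\xi\rangle=(1+|\xi|^2)^{1/2}$. For $f\in\mathcal S'$ let $$V_\phi f(x,\xi)=(2\pi)^{-n/2}\,\big\langle f,\ \overline{\phi(\cdot-x)}\,e^{-i\,\cdot\,\xi}\big\rangle\qquad(x,\xi\in\mathbb R^n)$$ be its short-time Fourier transform. For $1\le p,q\le\infty$ and $s\in\mathbb R$ the modulation space $M^s_{p,q}$ is the set of all $f\in\mathcal S'$ with $$\|f\|_{M^s_{p,q}}=\Big(\int_{\mathbb R^n}\Big(\int_{\mathbb R^n}|V_\phi f(x,\xi)\,\langle\xi\rangle^s|^p\,dx\Big)^{q/p}d\xi\Big)^{1/q}<\infty$$ (with the usual modifications if $p=\infty$ or $q=\infty$). The Fourier transform is normalised by $\mathcal F\varphi(\xi)=(2\pi)^{-n/2}\int_{\mathbb R^n}e^{ix\cdot\xi}\varphi(x)\,dx$ on $\mathcal S$ and extended to $\mathcal S'$. A cutoff is a function $\psi\in C_0^\infty(\mathbb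 R^n)$ with $\psi=1$ in a neighbourhood of the origin; given $\psi$, put $S^jf=\mathcal F^{-1}[\psi(2^{-j}\cdot)\mathcal Ff]$ for $f\in\mathcal S'$ and $j=0,1,2,\dots$. Each $S^jf$ is a smooth function all of whose derivatives grow at most polynomially, so the pointwise product $S^jf\cdot S^jg$ is again a tempered distribution. The product of $f,g\in\mathcal S'$ is $f\cdot g=\lim_{j\to\infty}S^jf\cdot S^jg$ whenever this limit exists in $\mathcal S'$. **Theorem.** Let $1\le p,p_1,p_2\le\infty$ and $s_0,s_1,s_2\in\mathbb R$. Let $\frac1p\le\frac1{p_1}+\frac1{p_2}$, $1<q\le\infty$, $\frac1q+\frac1{q'}=1$, $0\le s_0\le\min(s_1,s_2)$ and $s_1+s_2-s_0>n/q'$. Then there exists a constant $c$, depending only on $n,p,p_1,p_2,q,s_0,s_1,s_2$ and the window $\phi$, such that for every cutoff $\psi$, all $f\in M^{s_1}_{p_1,q}$ and all $g\in M^{s_2}_{p_2,q}$ the product $f\cdot g$ exists, belongs to $M^{s_0}_{p,q}$, and satisfies $$\|f\cdot g\|_{M^{s_0}_{p,q}}\le c\,\|f\|_{M^{s_1}_{p_1,q}}\,\|g\|_{M^{s_2}_{p_2,q}}.$$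 -/

import Mathlib

open MeasureTheory Filter Topology
open scoped SchwartzMap ENNReal NNReal ContDiff

namespace ModulationSpaces

noncomputable section

/-- The real-linear map `z ↦ conj z` on `ℂ`. -/
def conjRCLM : ℂ →L[ℝ] ℂ := Complex.conjCLE.toContinuousLinearMap

/-- `t ↦ e^{-i t}` is of temperate growth on `ℝ`. -/
theorem hasTemperateGrowth_expNegI :
    (fun t : ℝ => Complex.exp (-(Complex.I * (t : ℂ)))).HasTemperateGrowth := by
  have hd : ∀ t : ℝ, HasDerivAt (fun t : ℝ => Complex.exp (-(Complex.I * (t : ℂ))))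
      (-Complex.I * Complex.exp (-(Complex.I * (t : ℂ)))) t := by
    intro t
    have h1 : HasDerivAt (fun t : ℝ => -(Complex.I * (t : ℂ))) (-Complex.I) t := by
      have h0 := ((Complex.ofRealCLM.hasDerivAt (x := t)).const_mul Complex.I).neg
      rw [Complex.ofRealCLM_apply, Complex.ofReal_one, mul_one] at h0
      exact h0
    simpa [mul_comm] using h1.cexp
  have hi : ∀ m : ℕ, iteratedDeriv m (fun t : ℝ => Complex.exp (-(Complex.I * (t : ℂ)))) =
      fun t : ℝ => (-Complex.I) ^ m * Complex.exp (-(Complex.I * (t : ℂ))) := by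
    intro m
    induction m with
    | zero => simp
    | succ m ih =>
      rw [iteratedDeriv_succ, ih]
      ext t
      rw [((hd t).const_mul _).deriv]
      ring
  refine ⟨?_, fun m => ⟨0, 1, fun t => ?_⟩⟩
  · exact Complex.contDiff_exp.comp
      ((contDiff_const.mul Complex.ofRealCLM.contDiff).neg)
  · rw [norm_iteratedFDeriv_eq_norm_iteratedDeriv, hi]
    have h2 : ‖Complex.exp (-(Complex.I * (t : ℂ)))‖ = 1 := by
      rw [Complex.norm_exp]
      simp
    simp [h2]

/-- The character `t ↦ e^{-i t·ξ}` is of temperate growth on `ℝⁿ`. -/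
theorem hasTemperateGrowth_character {n : ℕ} (ξ : EuclideanSpace ℝ (Fin n)) :
    (fun t : EuclideanSpace ℝ (Fin n) =>
      Complex.exp (-(Complex.I * ((inner ℝ t ξ : ℝ) : ℂ)))).HasTemperateGrowth :=
  hasTemperateGrowth_expNegI.comp (Function.hasTemperateGrowth_inner_left ξ)

/-- The time-frequency shifted window `t ↦ e^{-i t·ξ} · conj (φ (t - x))`,
as a Schwartz function. -/
def shiftedWindow {n : ℕ} (φ : 𝓢(EuclideanSpace ℝ (Fin n), ℂ))
    (x ξ : EuclideanSpace ℝ (Fin n)) : 𝓢(EuclideanSpace ℝ (Fin n), ℂ) :=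
  SchwartzMap.smulLeftCLM ℂ
    (fun t : EuclideanSpace ℝ (Fin n) => Complex.exp (-(Complex.I * ((inner ℝ t ξ : ℝ) : ℂ))))
    (SchwartzMap.postcompCLM conjRCLM (SchwartzMap.compSubConstCLM ℂ x φ))

theorem shiftedWindow_apply {n : ℕ} (φ : 𝓢(EuclideanSpace ℝ (Fin n), ℂ))
    (x ξ t : EuclideanSpace ℝ (Fin n)) :
    shiftedWindow φ x ξ t =
      Complex.exp (-(Complex.I * ((inner ℝ t ξ : ℝ) : ℂ))) *
        (starRingEnd ℂ) (φ (t - x)) := by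
  rw [shiftedWindow, SchwartzMap.smulLeftCLM_apply_apply (hasTemperateGrowth_character ξ)]
  rfl

/-- The short-time Fourier transform of a tempered distribution `f` with window `φ`,
`V_φ f (x, ξ) = (2π)^{-n/2} f(t ↦ e^{-i t·ξ} conj (φ (t - x)))`. -/
def stft {n : ℕ} (φ : 𝓢(EuclideanSpace ℝ (Fin n), ℂ)) (f : 𝓢'(EuclideanSpace ℝ (Fin n), ℂ))
    (x ξ : EuclideanSpace ℝ (Fin n)) : ℂ :=
  (((2 * Real.pi) ^ (-(n : ℝ) / 2) : ℝ) : ℂ) * f (shiftedWindow φ x ξ)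

/-- The weighted mixed norm `‖f‖_{M^s_{p,q}}`, with values in `[0, ∞]`: the `L^q`-norm in `ξ` of
the `L^p`-norm in `x` of `⟨ξ⟩^s V_φ f (x, ξ)`, where `⟨ξ⟩ = (1 + |ξ|²)^{1/2}`. -/
def modulationNorm {n : ℕ} (φ : 𝓢(EuclideanSpace ℝ (Fin n), ℂ)) (p q : ℝ≥0∞) (s : ℝ)
    (f : 𝓢'(EuclideanSpace ℝ (Fin n), ℂ)) : ℝ≥0∞ :=
  eLpNorm
    (fun ξ : EuclideanSpace ℝ (Fin n) =>
      eLpNorm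
        (fun x : EuclideanSpace ℝ (Fin n) => ((1 + ‖ξ‖ ^ 2) ^ (s / 2) : ℝ) • stft φ f x ξ)
        p volume)
    q volume

/-- The modulation space `M^s_{p,q}` as a set of tempered distributions. -/
def modulationSpace {n : ℕ} (φ : 𝓢(EuclideanSpace ℝ (Fin n), ℂ)) (p q : ℝ≥0∞) (s : ℝ) :
    Set 𝓢'(EuclideanSpace ℝ (Fin n), ℂ) :=
  {f | modulationNorm φ p q s f < ⊤}

/-- `ψ ∈ C_0^∞` with `ψ = 1` in a neighbourhood of the origin. -/
structure IsCutoff {n : ℕ} (ψ : EuclideanSpace ℝ (Fin n) → ℂ) : Prop where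
  contDiff : ContDiff ℝ ∞ ψ
  hasCompactSupport : HasCompactSupport ψ
  eventually_eq_one : ∀ᶠ ξ in 𝓝 (0 : EuclideanSpace ℝ (Fin n)), ψ ξ = 1

/-- `S^j f = F⁻¹[ψ(2^{-j} ·) F f]`, where `F φ (ξ) = (2π)^{-n/2} ∫ e^{i x·ξ} φ(x) dx`. Mathlib's
Fourier transform has the kernel `e^{-2πi x·η}`; the substitution `ξ = -2πη` turns the symbol
`ψ(2^{-j} ξ)` into `ψ(-2π 2^{-j} η)`, and the normalising constants cancel. -/
def lowPass {n : ℕ} (ψ : EuclideanSpace ℝ (Fin n) → ℂ) (j : ℕ)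
    (f : 𝓢'(EuclideanSpace ℝ (Fin n), ℂ)) : 𝓢'(EuclideanSpace ℝ (Fin n), ℂ) :=
  TemperedDistribution.fourierMultiplierCLM ℂ
    (fun η : EuclideanSpace ℝ (Fin n) => ψ ((-(2 * Real.pi) / 2 ^ j : ℝ) • η)) f

/-- `h` is the product `f · g` of tempered distributions (computed with the cutoff `ψ`): `S^j f`
and `S^j g` are smooth functions `u j` and `v j` of temperate growth, and their pointwise products
`u j * v j`, as tempered distributions, converge to `h` in `𝓢'` as `j → ∞`. (The topology of
`𝓢'` in Mathlib is the weak topology of pointwise convergence on Schwartz functions.) -/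
def IsProduct {n : ℕ} (ψ : EuclideanSpace ℝ (Fin n) → ℂ)
    (f g h : 𝓢'(EuclideanSpace ℝ (Fin n), ℂ)) : Prop :=
  ∃ (u v : ℕ → EuclideanSpace ℝ (Fin n) → ℂ)
    (hu : ∀ j, (u j).HasTemperateGrowth) (hv : ∀ j, (v j).HasTemperateGrowth),
    (∀ j, (hu j).toTemperedDistribution volume = lowPass ψ j f) ∧
    (∀ j, (hv j).toTemperedDistribution volume = lowPass ψ j g) ∧
    Tendsto (fun j => ((hu j).mul (hv j)).toTemperedDistribution volume) atTop (𝓝 h)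

end

end ModulationSpaces

/-! In phase space, multiplication is convolution in the frequency variable. If `u`, `v` are
functions, then for fixed `x` the transform `gabor φ u x ·` is the Fourier transform of `u · conj
φ(· - x)`, so convolving the transforms of `u` and `v` gives, up to powers of `2π`, the transform of
`u v · conj φ(· - x) ^ 2`. Pairing this with the window `φ ^ 2` and integrating over `x` produces
the factor `∫ |φ| ^ 4 ≠ 0`, hence `∫ u v θ` equals `productConst φ`⁻¹ times the integral of
`productIntegrand` (`integral_productIntegrand_toTemperedDistribution`). The right-hand side makes
sense for distributions as soon as it converges absolutely, and the product `h` is defined by it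
(`exists_tempered_productIntegrand`).

Existence of the limit is dominated convergence. The inversion formula `gabor_inversion` bounds the
transforms of `f` and of all truncations `S^j f` by one envelope, `|V_φ f|` convolved with a
polynomially decaying kernel, with a constant independent of `j`
(`IsCutoff.exists_gabor_lowPass_le`). Together with pointwise convergence `S^j f → f` this gives
`isProduct_of_dominated`. The cutoff influences only the constant in the domination; the norm
estimate uses the formula for `h` directly, which is why the final constant does not depend on `ψ`.

The norm estimate reduces to inequalities for nonnegative functions. Smearing with an integrable
bounded kernel preserves the mixed norms and may raise the exponent in `x` (`mixedNorm_smear_le`),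
so `p₁`, `p₂` can be enlarged until Hölder's relation is an equality. Minkowski and Hölder in `x`
leave a convolution in frequency between weighted `L^q` spaces
(`eLpNorm_weight_mul_convolution_le`). There the smaller of the two frequencies receives the weight
`-(s₁ + s₂ - s₀)`, which lies in `L^{q'}` because `s₁ + s₂ - s₀ > n / q'`.

Interchanging distributions with integrals rests on `apply_integral`, which factors a functional
through a Banach space in order to use Bochner integration. -/

open scoped FourierTransform

namespace ModulationSpaces

/-! ### Schwartz seminorms under translation and multiplication. -/

section SchwartzSeminorms

variable {E : Type*} [NormedAddCommGroup E] [NormedSpace ℝ E]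

omit [NormedSpace ℝ E] in
theorem one_add_norm_le_mul (x y : E) : 1 + ‖x‖ ≤ (1 + ‖y‖) * (1 + ‖x - y‖) := by
  have h : ‖x‖ ≤ ‖y‖ + ‖x - y‖ := by simpa using norm_add_le y (x - y)
  nlinarith [norm_nonneg y, norm_nonneg (x - y), mul_nonneg (norm_nonneg y) (norm_nonneg (x - y))]

omit [NormedSpace ℝ E] in
theorem one_add_norm_pow_le_mul (x y : E) (k : ℕ) :
    (1 + ‖x‖) ^ k ≤ (1 + ‖y‖) ^ k * (1 + ‖x - y‖) ^ k := by
  rw [← mul_pow]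
  exact pow_le_pow_left₀ (by positivity) (one_add_norm_le_mul x y) k

/-- Weighted derivatives of Schwartz functions are controlled by a continuous seminorm. -/
theorem exists_seminorm_ge (k l : ℕ) : ∃ q : Seminorm ℂ 𝓢(E, ℂ), Continuous q ∧
    ∀ (Φ : 𝓢(E, ℂ)), ∀ j ≤ l, ∀ t, (1 + ‖t‖) ^ k * ‖iteratedFDeriv ℝ j Φ t‖ ≤ q Φ := by
  refine ⟨((2 : ℝ≥0) ^ k) • (Finset.Iic (k, l)).sup (schwartzSeminormFamily ℂ E ℂ), ?_, ?_⟩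
  · refine (Seminorm.continuous_finsetSup ?_).const_smul _
    exact fun i _ => (schwartz_withSeminorms ℂ E ℂ).continuous_seminorm i
  · intro Φ j hj t
    simpa [NNReal.smul_def] using!
      SchwartzMap.one_add_le_sup_seminorm_apply (𝕜 := ℂ) (m := (k, l)) le_rfl hj Φ t

/-- Every continuous seminorm on Schwartz space is controlled by weighted derivatives. -/
theorem exists_seminorm_le {q : Seminorm ℂ 𝓢(E, ℂ)} (hq : Continuous q) :
    ∃ (C : ℝ≥0) (k l : ℕ), ∀ (Φ : 𝓢(E, ℂ)) (M : ℝ), 0 ≤ M →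
      (∀ j ≤ l, ∀ t, (1 + ‖t‖) ^ k * ‖iteratedFDeriv ℝ j Φ t‖ ≤ M) → q Φ ≤ C * M := by
  obtain ⟨s, C, -, hC⟩ := Seminorm.bound_of_continuous (schwartz_withSeminorms ℂ E ℂ) q hq
  -- The finitely many seminorms that dominate `q` are absorbed into the largest weight and the
  -- largest order occurring among them.
  refine ⟨C, s.sup Prod.fst, s.sup Prod.snd, fun Φ M hM h => ?_⟩
  refine (hC Φ).trans ?_
  rw [smul_apply, NNReal.smul_def, smul_eq_mul]
  gcongr
  refine Seminorm.finset_sup_apply_le hM fun i hi => ?_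
  refine SchwartzMap.seminorm_le_bound ℂ i.1 i.2 Φ hM fun t => ?_
  refine le_trans ?_ (h i.2 (Finset.le_sup (f := Prod.snd) hi) t)
  gcongr
  calc ‖t‖ ^ i.1 ≤ (1 + ‖t‖) ^ i.1 := by gcongr; linarith
    _ ≤ _ := pow_le_pow_right₀ (by linarith [norm_nonneg t]) (Finset.le_sup (f := Prod.fst) hi)

theorem iteratedFDeriv_compSubConst (Φ : 𝓢(E, ℂ)) (y t : E) (j : ℕ) :
    iteratedFDeriv ℝ j (SchwartzMap.compSubConstCLM ℂ y Φ) t = iteratedFDeriv ℝ j Φ (t - y) :=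
  iteratedFDeriv_comp_sub (f := Φ) j y t

/-- Translations act on Schwartz space with polynomial growth. -/
theorem exists_seminorm_compSubConst_le {q : Seminorm ℂ 𝓢(E, ℂ)} (hq : Continuous q) :
    ∃ (M : ℕ) (q' : Seminorm ℂ 𝓢(E, ℂ)), Continuous q' ∧ ∀ (y : E) (Φ : 𝓢(E, ℂ)),
      q (SchwartzMap.compSubConstCLM ℂ y Φ) ≤ (1 + ‖y‖) ^ M * q' Φ := by
  obtain ⟨C, k, l, h⟩ := exists_seminorm_le hq
  obtain ⟨r, hr, hr'⟩ := exists_seminorm_ge (E := E) k l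
  refine ⟨k, C • r, hr.const_smul _, fun y Φ => ?_⟩
  refine (h _ ((1 + ‖y‖) ^ k * r Φ) (by positivity) fun j hj t => ?_).trans_eq ?_
  · rw [iteratedFDeriv_compSubConst]
    calc (1 + ‖t‖) ^ k * ‖iteratedFDeriv ℝ j Φ (t - y)‖
        ≤ ((1 + ‖y‖) ^ k * (1 + ‖t - y‖) ^ k) * ‖iteratedFDeriv ℝ j Φ (t - y)‖ := by
          gcongr; exact one_add_norm_pow_le_mul t y k
      _ ≤ _ := by rw [mul_assoc]; gcongr; exact hr' Φ j hj _
  · rw [smul_apply, NNReal.smul_def, smul_eq_mul]; ring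

/-- The mean value inequality for each derivative, on the segment from `t - y₀` to `t - y`, costs
one further order, hence `l + 1`. Every point `x` of the segment satisfies `‖t - x‖ ≤ ‖y₀‖ + ‖y‖`,
so the weight at `t` can be moved to `x`. -/
theorem exists_seminorm_compSubConst_sub_le {q : Seminorm ℂ 𝓢(E, ℂ)} (hq : Continuous q) :
    ∃ (M : ℕ) (q' : Seminorm ℂ 𝓢(E, ℂ)), Continuous q' ∧ ∀ (y y₀ : E) (Φ : 𝓢(E, ℂ)),
      q (SchwartzMap.compSubConstCLM ℂ y Φ - SchwartzMap.compSubConstCLM ℂ y₀ Φ) ≤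
        ‖y - y₀‖ * ((1 + ‖y₀‖ + ‖y‖) ^ M * q' Φ) := by
  obtain ⟨C, k, l, h⟩ := exists_seminorm_le hq
  obtain ⟨r, hr, hr'⟩ := exists_seminorm_ge (E := E) k (l + 1)
  refine ⟨k, C • r, hr.const_smul _, fun y y₀ Φ => ?_⟩
  refine (h _ (‖y - y₀‖ * ((1 + ‖y₀‖ + ‖y‖) ^ k * r Φ)) (by positivity)
    fun j hj t => ?_).trans_eq ?_
  · have hsub : iteratedFDeriv ℝ j (SchwartzMap.compSubConstCLM ℂ y Φ -
        SchwartzMap.compSubConstCLM ℂ y₀ Φ : 𝓢(E, ℂ)) t =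
        iteratedFDeriv ℝ j Φ (t - y) - iteratedFDeriv ℝ j Φ (t - y₀) := by
      rw [← iteratedFDeriv_compSubConst, ← iteratedFDeriv_compSubConst]
      exact iteratedFDeriv_sub_apply ((SchwartzMap.smooth _ j).contDiffAt)
        ((SchwartzMap.smooth _ j).contDiffAt)
    have hd : Differentiable ℝ (iteratedFDeriv ℝ j Φ) :=
      (Φ.smooth ⊤).differentiable_iteratedFDeriv (by exact_mod_cast WithTop.coe_lt_top j)
    have hmv : ‖iteratedFDeriv ℝ j Φ (t - y) - iteratedFDeriv ℝ j Φ (t - y₀)‖ ≤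
        ((1 + ‖y₀‖ + ‖y‖) ^ k * r Φ / (1 + ‖t‖) ^ k) * ‖(t - y) - (t - y₀)‖ := by
      refine Convex.norm_image_sub_le_of_norm_fderiv_le (𝕜 := ℝ) (s := segment ℝ (t - y₀) (t - y))
        (fun x _ => hd x) (fun x hx => ?_) (convex_segment _ _) (left_mem_segment _ _ _)
        (right_mem_segment _ _ _)
      rw [norm_fderiv_iteratedFDeriv, le_div_iff₀ (by positivity), mul_comm]
      have hx' : ‖t - x‖ ≤ ‖y₀‖ + ‖y‖ := by
        obtain ⟨a, b, ha, hb, hab, rfl⟩ := hx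
        have : t - (a • (t - y₀) + b • (t - y)) = a • y₀ + b • y := by
          have : t = (a + b) • t := by rw [hab, one_smul]
          nth_rewrite 1 [this]
          module
        rw [this]
        refine (norm_add_le _ _).trans ?_
        rw [norm_smul, norm_smul, Real.norm_of_nonneg ha, Real.norm_of_nonneg hb]
        gcongr
        · exact mul_le_of_le_one_left (norm_nonneg _) (by linarith)
        · exact mul_le_of_le_one_left (norm_nonneg _) (by linarith)
      calc (1 + ‖t‖) ^ k * ‖iteratedFDeriv ℝ (j + 1) Φ x‖
          ≤ ((1 + ‖y₀‖ + ‖y‖) ^ k * (1 + ‖x‖) ^ k) * ‖iteratedFDeriv ℝ (j + 1) Φ x‖ := by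
            gcongr
            have := one_add_norm_pow_le_mul t (t - x) k
            rw [sub_sub_cancel] at this
            refine this.trans ?_
            gcongr ?_ ^ k * _
            linarith
        _ ≤ _ := by rw [mul_assoc]; gcongr; exact hr' Φ (j + 1) (by omega) x
    rw [hsub]
    calc _ ≤ (1 + ‖t‖) ^ k *
          (((1 + ‖y₀‖ + ‖y‖) ^ k * r Φ / (1 + ‖t‖) ^ k) * ‖(t - y) - (t - y₀)‖) := by gcongr
      _ = _ := by
        rw [sub_sub_sub_cancel_left, norm_sub_rev]
        field_simp
  · rw [smul_apply, NNReal.smul_def, smul_eq_mul]; ring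

theorem tendsto_of_forall_seminorm {ι : Type*} {u : ι → 𝓢(E, ℂ)} {l : Filter ι} {Φ : 𝓢(E, ℂ)}
    (h : ∀ q : Seminorm ℂ 𝓢(E, ℂ), Continuous q → Tendsto (fun i => q (u i - Φ)) l (𝓝 0)) :
    Tendsto u l (𝓝 Φ) := by
  rw [(schwartz_withSeminorms ℂ E ℂ).tendsto_nhds]
  intro i ε hε
  exact (h _ ((schwartz_withSeminorms ℂ E ℂ).continuous_seminorm i)).eventually_lt_const hε

/-- Translation is jointly continuous on Schwartz space. -/
theorem continuous_compSubConst :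
    Continuous fun z : E × 𝓢(E, ℂ) => SchwartzMap.compSubConstCLM ℂ z.1 z.2 := by
  rw [continuous_iff_continuousAt]
  rintro ⟨y₀, Φ₀⟩
  refine tendsto_of_forall_seminorm fun q hq => ?_
  obtain ⟨M, r, hr, hr'⟩ := exists_seminorm_compSubConst_le hq
  obtain ⟨M', r', -, hr''⟩ := exists_seminorm_compSubConst_sub_le hq
  have hc : Continuous fun z : E × 𝓢(E, ℂ) => (1 + ‖z.1‖) ^ M * r (z.2 - Φ₀) +
      ‖z.1 - y₀‖ * ((1 + ‖y₀‖ + ‖z.1‖) ^ M' * r' Φ₀) := by fun_prop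
  refine squeeze_zero (fun z => apply_nonneg q _) (fun z => ?_) (by simpa using hc.tendsto (y₀, Φ₀))
  have : SchwartzMap.compSubConstCLM ℂ z.1 z.2 - SchwartzMap.compSubConstCLM ℂ y₀ Φ₀ =
      SchwartzMap.compSubConstCLM ℂ z.1 (z.2 - Φ₀) +
      (SchwartzMap.compSubConstCLM ℂ z.1 Φ₀ - SchwartzMap.compSubConstCLM ℂ y₀ Φ₀) := by
    rw [map_sub]; abel
  change q (SchwartzMap.compSubConstCLM ℂ z.1 z.2 - SchwartzMap.compSubConstCLM ℂ y₀ Φ₀) ≤ _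
  rw [this]
  exact (map_add_le_add q _ _).trans (add_le_add (hr' _ _) (hr'' _ _ _))

/-- Products of a Schwartz function with a translated Schwartz function decay with the shift. -/
theorem exists_seminorm_mul_compSubConst_le {q : Seminorm ℂ 𝓢(E, ℂ)} (hq : Continuous q)
    (χ : 𝓢(E, ℂ)) (N : ℕ) :
    ∃ q' : Seminorm ℂ 𝓢(E, ℂ), Continuous q' ∧ ∀ (x : E) (θ : 𝓢(E, ℂ)),
      q (SchwartzMap.smulLeftCLM ℂ (SchwartzMap.compSubConstCLM ℂ x χ) θ) ≤
        ((1 + ‖x‖) ^ N)⁻¹ * q' θ := by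
  obtain ⟨C, k, l, h⟩ := exists_seminorm_le hq
  -- Of the weight `k + N` on `θ`, the part `k` is demanded by `q`; the part `N` on `θ` and the part
  -- `N` on `χ` together pay for `(1 + ‖x‖) ^ N ≤ (1 + ‖t‖) ^ N * (1 + ‖x - t‖) ^ N`. The factor `2
  -- ^ l` below bounds the binomial sum in Leibniz' rule.
  obtain ⟨r, hr, hr'⟩ := exists_seminorm_ge (E := E) (k + N) l
  obtain ⟨s, hs, hs'⟩ := exists_seminorm_ge (E := E) N l
  refine ⟨(C * 2 ^ l * (s χ).toNNReal : ℝ≥0) • r, hr.const_smul _, fun x θ => ?_⟩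
  refine (h _ (((1 + ‖x‖) ^ N)⁻¹ * (2 ^ l * s χ * r θ)) (by positivity)
    fun j hj t => ?_).trans_eq ?_
  · have hfun : (SchwartzMap.smulLeftCLM ℂ (SchwartzMap.compSubConstCLM ℂ x χ) θ : E → ℂ) =
        fun t => SchwartzMap.compSubConstCLM ℂ x χ t * θ t := by
      rw [SchwartzMap.smulLeftCLM_apply (SchwartzMap.hasTemperateGrowth _)]
      rfl
    rw [hfun, le_inv_mul_iff₀ (by positivity)]
    have hx := one_add_norm_pow_le_mul x t N
    calc (1 + ‖x‖) ^ N * ((1 + ‖t‖) ^ k * _)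
        ≤ ((1 + ‖t‖) ^ N * (1 + ‖t - x‖) ^ N) * ((1 + ‖t‖) ^ k *
          ∑ i ∈ Finset.range (j + 1), (j.choose i : ℝ) *
            ‖iteratedFDeriv ℝ i (SchwartzMap.compSubConstCLM ℂ x χ) t‖ *
            ‖iteratedFDeriv ℝ (j - i) θ t‖) := by
          rw [norm_sub_rev t x]
          gcongr
          exact norm_iteratedFDeriv_mul_le (N := j) (SchwartzMap.smooth _ j) (SchwartzMap.smooth _ j)
            t le_rfl
      _ = ∑ i ∈ Finset.range (j + 1), (j.choose i : ℝ) *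
            ((1 + ‖t - x‖) ^ N * ‖iteratedFDeriv ℝ i χ (t - x)‖) *
            ((1 + ‖t‖) ^ (k + N) * ‖iteratedFDeriv ℝ (j - i) θ t‖) := by
          rw [Finset.mul_sum, Finset.mul_sum]
          refine Finset.sum_congr rfl fun i _ => ?_
          rw [iteratedFDeriv_compSubConst, pow_add]
          ring
      _ ≤ ∑ i ∈ Finset.range (j + 1), (j.choose i : ℝ) * s χ * r θ := by
          refine Finset.sum_le_sum fun i hi => ?_
          have hi' : i ≤ j := Nat.lt_succ_iff.1 (Finset.mem_range.1 hi)
          gcongr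
          · exact hs' χ i (by omega) _
          · exact hr' θ (j - i) (by omega) _
      _ = 2 ^ j * s χ * r θ := by
          rw [← Finset.sum_mul, ← Finset.sum_mul]
          congr 2
          exact_mod_cast Nat.sum_range_choose j
      _ ≤ _ := by gcongr; norm_num
  · rw [smul_apply, NNReal.smul_def, smul_eq_mul]
    push_cast
    rw [Real.coe_toNNReal _ (apply_nonneg _ _)]
    ring

end SchwartzSeminorms

/-! ### Fourier transform and time-frequency shifts of Schwartz functions. -/

noncomputable section

variable {n : ℕ}

/-- The Fourier transform with kernel `e^{-i t·ξ}` as an operator on Schwartz functions. -/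
def angularFourier : 𝓢(EuclideanSpace ℝ (Fin n), ℂ) →L[ℂ] 𝓢(EuclideanSpace ℝ (Fin n), ℂ) :=
  (SchwartzMap.compCLMOfContinuousLinearEquiv ℂ
    (ContinuousLinearEquiv.smulLeft (R₁ := ℝ) (M₁ := EuclideanSpace ℝ (Fin n))
      (Units.mk0 ((2 * Real.pi)⁻¹ : ℝ) (by positivity)))) ∘L
  FourierTransform.fourierCLM ℂ 𝓢(EuclideanSpace ℝ (Fin n), ℂ)

theorem angularFourier_eq_fourier (Φ : 𝓢(EuclideanSpace ℝ (Fin n), ℂ))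
    (ξ : EuclideanSpace ℝ (Fin n)) :
    angularFourier Φ ξ = 𝓕 (Φ : EuclideanSpace ℝ (Fin n) → ℂ) ((2 * Real.pi)⁻¹ • ξ) := rfl

theorem angularFourier_apply (Φ : 𝓢(EuclideanSpace ℝ (Fin n), ℂ))
    (ξ : EuclideanSpace ℝ (Fin n)) :
    angularFourier Φ ξ = ∫ t, Complex.exp (-(Complex.I * ((inner ℝ t ξ : ℝ) : ℂ))) * Φ t := by
  rw [angularFourier_eq_fourier, Real.fourier_eq']
  refine integral_congr_ae (Eventually.of_forall fun t => ?_)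
  simp only [smul_eq_mul, inner_smul_right]
  congr 2
  have : (-2 * Real.pi * ((2 * Real.pi)⁻¹ * inner ℝ t ξ) : ℝ) = -inner ℝ t ξ := by
    field_simp
  rw [this]
  push_cast
  ring

theorem integral_exp_mul_angularFourier (Φ : 𝓢(EuclideanSpace ℝ (Fin n), ℂ))
    (t : EuclideanSpace ℝ (Fin n)) :
    ∫ ξ, Complex.exp (Complex.I * ((inner ℝ t ξ : ℝ) : ℂ)) * angularFourier Φ ξ =
      (2 * Real.pi) ^ n * Φ t := by
  have h := Measure.integral_comp_smul (volume : Measure (EuclideanSpace ℝ (Fin n)))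
    (fun w => Complex.exp (Complex.I * ((inner ℝ t ((2 * Real.pi) • w) : ℝ) : ℂ)) *
      𝓕 (Φ : EuclideanSpace ℝ (Fin n) → ℂ) w) ((2 * Real.pi)⁻¹)
  have h1 : ∀ ξ : EuclideanSpace ℝ (Fin n), (2 * Real.pi) • (2 * Real.pi)⁻¹ • ξ = ξ := fun ξ => by
    rw [smul_smul, mul_inv_cancel₀ (by positivity), one_smul]
  simp only [h1] at h
  simp only [angularFourier_eq_fourier]
  rw [h]
  have h2 : ∫ w, Complex.exp (Complex.I * ((inner ℝ t ((2 * Real.pi) • w) : ℝ) : ℂ)) *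
      𝓕 (Φ : EuclideanSpace ℝ (Fin n) → ℂ) w = Φ t := by
    have h3 : (𝓕⁻ (𝓕 Φ)) t = Φ t := by rw [FourierPair.fourierInv_fourier_eq]
    rw [SchwartzMap.fourierInv_coe, Real.fourierInv_eq'] at h3
    rw [← h3]
    refine integral_congr_ae (Eventually.of_forall fun w => ?_)
    simp only [smul_eq_mul, inner_smul_right, real_inner_comm w t]
    congr 2
    push_cast
    ring
  rw [h2, finrank_euclideanSpace_fin, ← inv_pow, inv_inv, abs_of_pos (by positivity)]
  simp

theorem norm_exp_I_mul (r : ℝ) : ‖Complex.exp (Complex.I * (r : ℂ))‖ = 1 := by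
  rw [Complex.norm_exp]; simp

theorem continuous_schwartz_eval {E : Type*} [NormedAddCommGroup E] [NormedSpace ℝ E] :
    Continuous fun z : 𝓢(E, ℂ) × E => z.1 z.2 := by
  have h : Continuous fun z : 𝓢(E, ℂ) × E =>
      (SchwartzMap.toBoundedContinuousFunctionCLM ℂ E ℂ z.1) z.2 := by
    have := (SchwartzMap.toBoundedContinuousFunctionCLM ℂ E ℂ).continuous
    fun_prop
  exact h

theorem fourierInv_compSubConst_apply (Ψ : 𝓢(EuclideanSpace ℝ (Fin n), ℂ))
    (a t : EuclideanSpace ℝ (Fin n)) :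
    (𝓕⁻ (SchwartzMap.compSubConstCLM ℂ a Ψ)) t =
      Complex.exp (((2 * Real.pi * inner ℝ a t : ℝ) : ℂ) * Complex.I) * (𝓕⁻ Ψ) t := by
  rw [SchwartzMap.fourierInv_coe, SchwartzMap.fourierInv_coe, Real.fourierInv_eq',
    Real.fourierInv_eq', ← integral_const_mul]
  rw [← integral_add_right_eq_self _ a]
  refine integral_congr_ae (Eventually.of_forall fun w => ?_)
  simp only [smul_eq_mul, SchwartzMap.compSubConstCLM_apply]
  rw [← mul_assoc, ← Complex.exp_add, add_sub_cancel_right]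
  congr 2
  rw [inner_add_left]
  push_cast
  ring

/-- The conjugated Schwartz function. -/
def conjS (φ : 𝓢(EuclideanSpace ℝ (Fin n), ℂ)) : 𝓢(EuclideanSpace ℝ (Fin n), ℂ) :=
  SchwartzMap.postcompCLM conjRCLM φ

theorem conjS_apply (φ : 𝓢(EuclideanSpace ℝ (Fin n), ℂ)) (t : EuclideanSpace ℝ (Fin n)) :
    conjS φ t = (starRingEnd ℂ) (φ t) := rfl

/-- A modulation is a translation conjugated by the Fourier transform. Continuity and polynomial
growth of time-frequency shifts therefore follow from the same facts for translations. -/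
theorem shiftedWindow_eq_fourierInv (φ : 𝓢(EuclideanSpace ℝ (Fin n), ℂ))
    (x ξ : EuclideanSpace ℝ (Fin n)) :
    shiftedWindow φ x ξ = FourierTransform.fourierInvCLM ℂ 𝓢(EuclideanSpace ℝ (Fin n), ℂ)
      (SchwartzMap.compSubConstCLM ℂ (-((2 * Real.pi)⁻¹ • ξ))
        (FourierTransform.fourierCLM ℂ 𝓢(EuclideanSpace ℝ (Fin n), ℂ)
          (SchwartzMap.compSubConstCLM ℂ x (conjS φ)))) := by
  ext t
  have := fourierInv_compSubConst_apply (𝓕 (SchwartzMap.compSubConstCLM ℂ x (conjS φ)))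
    (-((2 * Real.pi)⁻¹ • ξ)) t
  refine Eq.trans ?_ this.symm
  rw [FourierPair.fourierInv_fourier_eq, shiftedWindow_apply, SchwartzMap.compSubConstCLM_apply,
    conjS_apply]
  congr 2
  rw [inner_neg_left, real_inner_smul_left, real_inner_comm t ξ]
  have : (2 * Real.pi * -((2 * Real.pi)⁻¹ * inner ℝ t ξ) : ℝ) = -inner ℝ t ξ := by
    field_simp
  rw [this]
  push_cast
  ring

theorem continuous_shiftedWindow (φ : 𝓢(EuclideanSpace ℝ (Fin n), ℂ)) :
    Continuous fun z : EuclideanSpace ℝ (Fin n) × EuclideanSpace ℝ (Fin n) =>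
      shiftedWindow φ z.1 z.2 := by
  simp only [shiftedWindow_eq_fourierInv]
  refine (ContinuousLinearMap.continuous _).comp ?_
  refine continuous_compSubConst.comp (Continuous.prodMk (by fun_prop) ?_)
  refine (ContinuousLinearMap.continuous _).comp ?_
  exact continuous_compSubConst.comp (continuous_fst.prodMk continuous_const)

theorem exists_seminorm_shiftedWindow_le (φ : 𝓢(EuclideanSpace ℝ (Fin n), ℂ))
    {q : Seminorm ℂ 𝓢(EuclideanSpace ℝ (Fin n), ℂ)} (hq : Continuous q) :
    ∃ (C : ℝ) (M : ℕ), 0 ≤ C ∧ ∀ x ξ, q (shiftedWindow φ x ξ) ≤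
      C * ((1 + ‖x‖) ^ M * (1 + ‖ξ‖) ^ M) := by
  obtain ⟨M₁, q₁, hq₁, h₁⟩ := exists_seminorm_compSubConst_le
    (q := q.comp (FourierTransform.fourierInvCLM ℂ 𝓢(EuclideanSpace ℝ (Fin n), ℂ)).toLinearMap)
    (hq.comp (ContinuousLinearMap.continuous _))
  obtain ⟨M₂, q₂, hq₂, h₂⟩ := exists_seminorm_compSubConst_le
    (q := q₁.comp (FourierTransform.fourierCLM ℂ 𝓢(EuclideanSpace ℝ (Fin n), ℂ)).toLinearMap)
    (hq₁.comp (ContinuousLinearMap.continuous _))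
  refine ⟨q₂ (conjS φ), max M₁ M₂, apply_nonneg _ _, fun x ξ => ?_⟩
  rw [shiftedWindow_eq_fourierInv]
  have hξ : ‖-((2 * Real.pi)⁻¹ • ξ)‖ ≤ ‖ξ‖ := by
    rw [norm_neg, norm_smul]
    refine mul_le_of_le_one_left (norm_nonneg _) ?_
    rw [Real.norm_of_nonneg (by positivity)]
    exact inv_le_one_of_one_le₀ (by linarith [Real.pi_gt_three])
  have hle : ∀ y : EuclideanSpace ℝ (Fin n), 1 ≤ 1 + ‖y‖ := fun y => by simp
  calc _ ≤ (1 + ‖-((2 * Real.pi)⁻¹ • ξ)‖) ^ M₁ * _ := h₁ _ _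
    _ ≤ (1 + ‖ξ‖) ^ M₁ * ((1 + ‖x‖) ^ M₂ * q₂ (conjS φ)) := by
        gcongr
        exact h₂ _ _
    _ ≤ (1 + ‖ξ‖) ^ (max M₁ M₂) * ((1 + ‖x‖) ^ (max M₁ M₂) * q₂ (conjS φ)) := by
        gcongr
        · exact hle _
        · exact le_max_left _ _
        · exact hle _
        · exact le_max_right _ _
    _ = _ := by ring

/-- `∫ θ(t) χ(t - x) e^{i t·ξ} dt`, the pairing of `θ` with a time-frequency shift of `χ`. -/
def windowPairing (χ θ : 𝓢(EuclideanSpace ℝ (Fin n), ℂ)) (x ξ : EuclideanSpace ℝ (Fin n)) : ℂ :=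
  angularFourier (SchwartzMap.smulLeftCLM ℂ (SchwartzMap.compSubConstCLM ℂ x χ) θ) (-ξ)

theorem smulLeft_compSubConst_apply (χ θ : 𝓢(EuclideanSpace ℝ (Fin n), ℂ))
    (x t : EuclideanSpace ℝ (Fin n)) :
    SchwartzMap.smulLeftCLM ℂ (SchwartzMap.compSubConstCLM ℂ x χ) θ t = χ (t - x) * θ t := by
  rw [SchwartzMap.smulLeftCLM_apply_apply (SchwartzMap.hasTemperateGrowth _)]
  rfl

theorem windowPairing_eq_integral (χ θ : 𝓢(EuclideanSpace ℝ (Fin n), ℂ))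
    (x ξ : EuclideanSpace ℝ (Fin n)) :
    windowPairing χ θ x ξ =
      ∫ t, Complex.exp (Complex.I * ((inner ℝ t ξ : ℝ) : ℂ)) * (χ (t - x) * θ t) := by
  rw [windowPairing, angularFourier_apply]
  simp [smulLeft_compSubConst_apply, inner_neg_right]

theorem windowPairing_add (χ θ₁ θ₂ : 𝓢(EuclideanSpace ℝ (Fin n), ℂ))
    (x ξ : EuclideanSpace ℝ (Fin n)) :
    windowPairing χ (θ₁ + θ₂) x ξ = windowPairing χ θ₁ x ξ + windowPairing χ θ₂ x ξ := by
  simp [windowPairing]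

theorem windowPairing_smul (χ θ : 𝓢(EuclideanSpace ℝ (Fin n), ℂ)) (c : ℂ)
    (x ξ : EuclideanSpace ℝ (Fin n)) :
    windowPairing χ (c • θ) x ξ = c * windowPairing χ θ x ξ := by
  simp [windowPairing]

theorem continuous_windowPairing (χ θ : 𝓢(EuclideanSpace ℝ (Fin n), ℂ)) :
    Continuous fun z : EuclideanSpace ℝ (Fin n) × EuclideanSpace ℝ (Fin n) =>
      windowPairing χ θ z.1 z.2 := by
  -- With the fixed factor `θ` as the multiplier, the product is a continuous linear function of the
  -- translated factor, which depends continuously on `x`.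
  have h : ∀ x, SchwartzMap.smulLeftCLM ℂ (SchwartzMap.compSubConstCLM ℂ x χ) θ =
      SchwartzMap.smulLeftCLM ℂ θ (SchwartzMap.compSubConstCLM ℂ x χ) := fun x => by
    ext t
    rw [smulLeft_compSubConst_apply, SchwartzMap.smulLeftCLM_apply_apply θ.hasTemperateGrowth]
    exact mul_comm _ _
  simp only [windowPairing, h]
  refine continuous_schwartz_eval.comp (Continuous.prodMk ?_ (by fun_prop))
  refine (ContinuousLinearMap.continuous _).comp ((ContinuousLinearMap.continuous _).comp ?_)
  exact continuous_compSubConst.comp (continuous_fst.prodMk continuous_const)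

theorem integral_exp_mul_windowPairing (χ θ : 𝓢(EuclideanSpace ℝ (Fin n), ℂ))
    (x t : EuclideanSpace ℝ (Fin n)) :
    ∫ ξ, Complex.exp (-(Complex.I * ((inner ℝ t ξ : ℝ) : ℂ))) * windowPairing χ θ x ξ =
      (2 * Real.pi) ^ n * (χ (t - x) * θ t) := by
  rw [← smulLeft_compSubConst_apply, ← integral_exp_mul_angularFourier, ← integral_neg_eq_self]
  simp [windowPairing, inner_neg_right]

/-- The polynomially decaying weight `(1 + ‖x‖)^{-N}`. -/
def decay (N : ℕ) (x : EuclideanSpace ℝ (Fin n)) : ℝ := ((1 + ‖x‖) ^ N)⁻¹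

theorem decay_pos (N : ℕ) (x : EuclideanSpace ℝ (Fin n)) : 0 < decay N x := by
  unfold decay; positivity

theorem decay_neg (N : ℕ) (x : EuclideanSpace ℝ (Fin n)) : decay N (-x) = decay N x := by
  simp [decay]

theorem continuous_decay (N : ℕ) :
    Continuous (decay N : EuclideanSpace ℝ (Fin n) → ℝ) := by
  unfold decay
  exact Continuous.inv₀ (by fun_prop) fun x => by positivity

theorem decay_le_mul (N : ℕ) (x y : EuclideanSpace ℝ (Fin n)) :
    decay N x ≤ (1 + ‖y‖) ^ N * decay N (x + y) := by
  unfold decay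
  rw [← div_eq_mul_inv, le_div_iff₀ (by positivity), inv_mul_le_iff₀ (by positivity)]
  have := one_add_norm_pow_le_mul (x + y) x N
  simpa using this

theorem integrable_decay {N : ℕ} (hN : n < N) :
    Integrable (decay N : EuclideanSpace ℝ (Fin n) → ℝ) := by
  have := integrable_one_add_norm (E := EuclideanSpace ℝ (Fin n)) (μ := volume) (r := N)
    (by simpa using hN)
  refine this.congr (Eventually.of_forall fun x => ?_)
  simp only [decay]
  rw [Real.rpow_neg (by positivity), Real.rpow_natCast]

/-- Decay in `x` holds because two Schwartz functions far apart have a small product; decay in `ξ`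
is a Schwartz bound on the Fourier transform of that product. Control by a continuous seminorm of
`θ` is what later makes the product a tempered distribution. -/
theorem exists_seminorm_windowPairing_le (χ : 𝓢(EuclideanSpace ℝ (Fin n), ℂ)) (N : ℕ) :
    ∃ q : Seminorm ℂ 𝓢(EuclideanSpace ℝ (Fin n), ℂ), Continuous q ∧ ∀ θ x ξ,
      ‖windowPairing χ θ x ξ‖ ≤ decay N x * decay N ξ * q θ := by
  obtain ⟨r, hr, hr'⟩ := exists_seminorm_ge (E := EuclideanSpace ℝ (Fin n)) N 0
  obtain ⟨q, hq, hq'⟩ := exists_seminorm_mul_compSubConst_le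
    (q := r.comp (angularFourier (n := n)).toLinearMap)
    (hr.comp (ContinuousLinearMap.continuous _)) χ N
  refine ⟨q, hq, fun θ x ξ => ?_⟩
  have h1 := hr' (angularFourier (SchwartzMap.smulLeftCLM ℂ (SchwartzMap.compSubConstCLM ℂ x χ) θ))
    0 le_rfl (-ξ)
  rw [norm_iteratedFDeriv_zero, norm_neg] at h1
  have h2 := h1.trans (hq' x θ)
  rw [← le_inv_mul_iff₀ (by positivity)] at h2
  refine h2.trans_eq ?_
  unfold decay
  ring

/-- Covariance: after the substitution `t ↦ t + x` the time-frequency shift of the window becomes a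
shift of `(y, η)`, up to a unimodular factor. -/
theorem norm_windowPairing_shiftedWindow (χ φ : 𝓢(EuclideanSpace ℝ (Fin n), ℂ))
    (x ξ y η : EuclideanSpace ℝ (Fin n)) :
    ‖windowPairing χ (shiftedWindow φ x ξ) y η‖ =
      ‖windowPairing χ (conjS φ) (y - x) (η - ξ)‖ := by
  rw [windowPairing_eq_integral, windowPairing_eq_integral]
  rw [← integral_add_right_eq_self _ x]
  have : ∀ t, Complex.exp (Complex.I * ((inner ℝ (t + x) η : ℝ) : ℂ)) *
      (χ (t + x - y) * shiftedWindow φ x ξ (t + x)) =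
      Complex.exp (Complex.I * ((inner ℝ x (η - ξ) : ℝ) : ℂ)) *
        (Complex.exp (Complex.I * ((inner ℝ t (η - ξ) : ℝ) : ℂ)) *
        (χ (t - (y - x)) * conjS φ t)) := fun t => by
    rw [shiftedWindow_apply, conjS_apply, add_sub_cancel_right, sub_sub_eq_add_sub]
    have : Complex.exp (Complex.I * ((inner ℝ (t + x) η : ℝ) : ℂ)) *
        Complex.exp (-(Complex.I * ((inner ℝ (t + x) ξ : ℝ) : ℂ))) =
        Complex.exp (Complex.I * ((inner ℝ x (η - ξ) : ℝ) : ℂ)) *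
        Complex.exp (Complex.I * ((inner ℝ t (η - ξ) : ℝ) : ℂ)) := by
      rw [← Complex.exp_add, ← Complex.exp_add]
      congr 1
      simp only [inner_add_left, inner_sub_right]
      push_cast
      ring
    linear_combination (χ (t + x - y) * (starRingEnd ℂ) (φ t)) * this
  simp_rw [this]
  rw [integral_const_mul, norm_mul, norm_exp_I_mul, one_mul]

theorem exists_windowPairing_shiftedWindow_le (χ φ : 𝓢(EuclideanSpace ℝ (Fin n), ℂ)) (N : ℕ) :
    ∃ C : ℝ≥0, ∀ x ξ y η, ‖windowPairing χ (shiftedWindow φ x ξ) y η‖ ≤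
      C * (decay N (x - y) * decay N (ξ - η)) := by
  obtain ⟨q, -, hq⟩ := exists_seminorm_windowPairing_le χ N
  refine ⟨(q (conjS φ)).toNNReal, fun x ξ y η => ?_⟩
  rw [norm_windowPairing_shiftedWindow, Real.coe_toNNReal _ (apply_nonneg _ _)]
  refine (hq _ _ _).trans_eq ?_
  rw [← neg_sub x y, ← neg_sub ξ η, decay_neg, decay_neg]
  ring

end

/-! ### Interchange of functionals with Schwartz-valued integrals. -/

noncomputable section

section IntegralInterchange

open scoped LineDeriv
open LineDeriv

variable {E : Type*} [NormedAddCommGroup E] [NormedSpace ℝ E]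

theorem continuous_of_norm_le_seminorm {V : Type*} [NormedAddCommGroup V] [NormedSpace ℂ V]
    (L : 𝓢(E, ℂ) →ₗ[ℂ] V) {q : Seminorm ℂ 𝓢(E, ℂ)} (hq : Continuous q)
    (h : ∀ Φ, ‖L Φ‖ ≤ q Φ) : Continuous L := by
  refine continuous_of_continuousAt_zero L ?_
  rw [ContinuousAt, map_zero]
  refine squeeze_zero_norm h ?_
  simpa using hq.tendsto 0

/-- A point together with an order `j ≤ l` and `j` directions. -/
def DerivIndex (E : Type*) (l : ℕ) : Type _ := Σ j : Fin (l + 1), E × (Fin j → E)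

instance (l : ℕ) : TopologicalSpace (DerivIndex E l) := ⊥

instance (l : ℕ) : DiscreteTopology (DerivIndex E l) := ⟨rfl⟩

/-- The weight of an iterated directional derivative at a point. -/
def derivWeight (k l : ℕ) (i : DerivIndex E l) : ℝ :=
  (1 + ‖i.2.1‖) ^ k * (∏ m, ‖i.2.2 m‖)⁻¹

theorem exists_seminorm_derivWeight_le (k l : ℕ) :
    ∃ q : Seminorm ℂ 𝓢(E, ℂ), Continuous q ∧ ∀ (Φ : 𝓢(E, ℂ)) (i : DerivIndex E l),
      ‖((derivWeight k l i : ℝ) : ℂ) * (∂^{i.2.2} Φ : 𝓢(E, ℂ)) i.2.1‖ ≤ q Φ := by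
  obtain ⟨q, hq, h⟩ := exists_seminorm_ge (E := E) k l
  refine ⟨q, hq, fun Φ i => ?_⟩
  have hP : 0 ≤ ∏ m, ‖i.2.2 m‖ := Finset.prod_nonneg fun _ _ => norm_nonneg _
  rw [SchwartzMap.iteratedLineDerivOp_eq_iteratedFDeriv, norm_mul, Complex.norm_real, derivWeight,
    Real.norm_of_nonneg (by positivity)]
  refine le_trans ?_ (h Φ i.1 (by omega) i.2.1)
  rw [mul_assoc]
  gcongr
  -- If a direction vanishes, the convention `0⁻¹ = 0` makes the weight zero; otherwise the product
  -- of norms normalises the directions.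
  rcases hP.eq_or_lt with h0 | h0
  · rw [← h0, inv_zero, zero_mul]
    exact norm_nonneg _
  · rw [inv_mul_le_iff₀ h0, mul_comm]
    exact ContinuousMultilinearMap.le_opNorm _ _

/-- Weighted directional derivatives up to order `l` as a bounded function. -/
def weightedDeriv (k l : ℕ) :
    𝓢(E, ℂ) →ₗ[ℂ] BoundedContinuousFunction (DerivIndex E l) ℂ where
  toFun Φ := BoundedContinuousFunction.ofNormedAddCommGroupDiscrete
    (fun i => ((derivWeight k l i : ℝ) : ℂ) * (∂^{i.2.2} Φ : 𝓢(E, ℂ)) i.2.1)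
    ((exists_seminorm_derivWeight_le (E := E) k l).choose Φ)
    (fun i => (exists_seminorm_derivWeight_le (E := E) k l).choose_spec.2 Φ i)
  map_add' Φ Ψ := by
    ext1 i
    simp [iteratedLineDerivOp_add, mul_add]
  map_smul' c Φ := by
    ext1 i
    simp [iteratedLineDerivOp_smul]
    ring

theorem weightedDeriv_apply (k l : ℕ) (Φ : 𝓢(E, ℂ)) (i : DerivIndex E l) :
    weightedDeriv k l Φ i = ((derivWeight k l i : ℝ) : ℂ) * (∂^{i.2.2} Φ : 𝓢(E, ℂ)) i.2.1 := rfl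

theorem exists_seminorm_norm_weightedDeriv_le (k l : ℕ) :
    ∃ q : Seminorm ℂ 𝓢(E, ℂ), Continuous q ∧ ∀ Φ, ‖weightedDeriv k l Φ‖ ≤ q Φ :=
  ⟨_, (exists_seminorm_derivWeight_le (E := E) k l).choose_spec.1, fun Φ =>
    (BoundedContinuousFunction.norm_le (apply_nonneg _ _)).2 fun i =>
      (exists_seminorm_derivWeight_le (E := E) k l).choose_spec.2 Φ i⟩

theorem weightedDeriv_injective (k l : ℕ) : Function.Injective (weightedDeriv (E := E) k l) := by
  intro Φ Ψ h
  ext t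
  -- At order zero the product over directions is empty, so the weight is positive and this
  -- coordinate recovers the value at `t`.
  let i : DerivIndex E l := ⟨(0 : Fin (l + 1)), t, Fin.elim0⟩
  have h0 : ((derivWeight k l i : ℝ) : ℂ) * Φ t = ((derivWeight k l i : ℝ) : ℂ) * Ψ t :=
    congrArg (fun u : BoundedContinuousFunction (DerivIndex E l) ℂ => u i) h
  have hw : ((derivWeight k l i : ℝ) : ℂ) ≠ 0 := by
    have : (0 : ℝ) < (1 + ‖t‖) ^ k := by positivity
    have h1 : derivWeight k l i = (1 + ‖t‖) ^ k * (∏ m : Fin 0, ‖(Fin.elim0 m : E)‖)⁻¹ := rfl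
    rw [Complex.ofReal_ne_zero, h1]
    simpa using this.ne'
  exact mul_left_cancel₀ hw h0

/-- The operator norm of a multilinear map is recovered from its values on all directions,
normalised by the product of their norms. Thus the sup norm of `weightedDeriv` is strong enough to
bound functionals of order at most `(k, l)`. -/
theorem norm_iteratedFDeriv_le_norm_weightedDeriv (k l : ℕ) (Φ : 𝓢(E, ℂ)) {j : ℕ} (hj : j ≤ l)
    (t : E) : (1 + ‖t‖) ^ k * ‖iteratedFDeriv ℝ j Φ t‖ ≤ ‖weightedDeriv k l Φ‖ := by
  rw [← le_inv_mul_iff₀ (by positivity)]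
  refine ContinuousMultilinearMap.opNorm_le_bound (by positivity) fun v => ?_
  by_cases hv : ∏ m, ‖v m‖ = 0
  · obtain ⟨m, -, hm⟩ := Finset.prod_eq_zero_iff.1 hv
    rw [ContinuousMultilinearMap.map_coord_zero _ m (norm_eq_zero.1 hm), hv]
    simp
  · have h := BoundedContinuousFunction.norm_coe_le_norm (weightedDeriv k l Φ)
      ⟨(⟨j, by omega⟩ : Fin (l + 1)), t, v⟩
    have h1 : weightedDeriv k l Φ ⟨(⟨j, by omega⟩ : Fin (l + 1)), t, v⟩ =
        (((1 + ‖t‖) ^ k * (∏ m, ‖v m‖)⁻¹ : ℝ) : ℂ) * (∂^{v} Φ : 𝓢(E, ℂ)) t := rfl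
    have hP : 0 ≤ ∏ m, ‖v m‖ := Finset.prod_nonneg fun _ _ => norm_nonneg _
    have hP' : 0 < ∏ m, ‖v m‖ := lt_of_le_of_ne hP (Ne.symm hv)
    rw [h1, SchwartzMap.iteratedLineDerivOp_eq_iteratedFDeriv, norm_mul, Complex.norm_real,
      Real.norm_of_nonneg (by positivity)] at h
    rw [inv_mul_eq_div, div_mul_eq_mul_div, le_div_iff₀ (by positivity)]
    calc _ = (∏ m, ‖v m‖) * ((1 + ‖t‖) ^ k * (∏ m, ‖v m‖)⁻¹ * ‖iteratedFDeriv ℝ j Φ t v‖) := by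
          field_simp
      _ ≤ (∏ m, ‖v m‖) * ‖weightedDeriv k l Φ‖ := by gcongr
      _ = _ := mul_comm _ _

variable {X : Type*} [TopologicalSpace X] [SecondCountableTopology X] [MeasurableSpace X]
  [BorelSpace X] {μ : Measure X}

theorem continuous_schwartz_apply (t : E) : Continuous fun Φ : 𝓢(E, ℂ) => Φ t :=
  continuous_schwartz_eval.comp (continuous_id.prodMk continuous_const)

theorem exists_seminorm_norm_apply_le :
    ∃ q : Seminorm ℂ 𝓢(E, ℂ), Continuous q ∧ ∀ (Φ : 𝓢(E, ℂ)) t, ‖Φ t‖ ≤ q Φ := by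
  obtain ⟨q, hq, h⟩ := exists_seminorm_ge (E := E) 0 0
  exact ⟨q, hq, fun Φ t => by simpa using h Φ 0 le_rfl t⟩

-- Differentiation under the integral along the line `t + r • v`. The seminorm that bounds point
-- values, applied to the derivative, is a majorant valid for all `r` at once.
omit [SecondCountableTopology X] in
theorem lineDerivOp_integral {F : X → 𝓢(E, ℂ)} (hF : Continuous F)
    (hint : ∀ q : Seminorm ℂ 𝓢(E, ℂ), Continuous q → Integrable (fun x => q (F x)) μ)
    {G : 𝓢(E, ℂ)} (hG : ∀ t, G t = ∫ x, F x t ∂μ) (v t : E) :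
    (∂_{v} G : 𝓢(E, ℂ)) t = ∫ x, (∂_{v} (F x) : 𝓢(E, ℂ)) t ∂μ := by
  obtain ⟨q, hq, h⟩ := exists_seminorm_norm_apply_le (E := E)
  have hcd : Continuous (fun Φ : 𝓢(E, ℂ) => (∂_{v} Φ : 𝓢(E, ℂ))) :=
    (lineDerivOpCLM ℂ 𝓢(E, ℂ) v).continuous
  have hline : ∀ (Φ : 𝓢(E, ℂ)) (r : ℝ),
      HasDerivAt (fun r : ℝ => Φ (t + r • v)) ((∂_{v} Φ : 𝓢(E, ℂ)) (t + r • v)) r := fun Φ r => by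
    have h1 : HasDerivAt (fun r : ℝ => t + r • v) v r := by
      simpa using ((hasDerivAt_id r).smul_const v).const_add t
    exact (Φ.hasFDerivAt (t + r • v)).comp_hasDerivAt r h1
  have hI : ∀ s, AEStronglyMeasurable (fun x => F x s) μ := fun s =>
    ((continuous_schwartz_apply s).comp hF).aestronglyMeasurable
  have hD := (hasDerivAt_integral_of_dominated_loc_of_deriv_le (μ := μ) (𝕜 := ℝ) (x₀ := 0)
    (s := Set.univ)
    (F := fun r x => F x (t + r • v)) (F' := fun r x => (∂_{v} (F x) : 𝓢(E, ℂ)) (t + r • v))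
    (bound := fun x => q (∂_{v} (F x)))
    univ_mem (Eventually.of_forall fun r => hI _)
    ((hint q hq).mono' (hI _) (Eventually.of_forall fun x => h _ _))
    (((continuous_schwartz_apply _).comp (hcd.comp hF)).aestronglyMeasurable)
    (Eventually.of_forall fun x r _ => h _ _)
    (hint (q.comp (lineDerivOpCLM ℂ 𝓢(E, ℂ) v).toLinearMap) (hq.comp hcd))
    (Eventually.of_forall fun x r _ => hline (F x) r)).2
  have hD' := hline G 0
  simp only [hG] at hD'
  simpa using hD'.unique hD

omit [SecondCountableTopology X] in
theorem iteratedLineDerivOp_integral {F : X → 𝓢(E, ℂ)} (hF : Continuous F)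
    (hint : ∀ q : Seminorm ℂ 𝓢(E, ℂ), Continuous q → Integrable (fun x => q (F x)) μ)
    {G : 𝓢(E, ℂ)} (hG : ∀ t, G t = ∫ x, F x t ∂μ) {j : ℕ} (v : Fin j → E) (t : E) :
    (∂^{v} G : 𝓢(E, ℂ)) t = ∫ x, (∂^{v} (F x) : 𝓢(E, ℂ)) t ∂μ := by
  induction j generalizing t with
  | zero => simpa using hG t
  | succ j ih =>
    have hc : Continuous (fun Φ : 𝓢(E, ℂ) => (∂^{Fin.tail v} Φ : 𝓢(E, ℂ))) :=
      (iteratedLineDerivOpCLM ℂ 𝓢(E, ℂ) (Fin.tail v)).continuous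
    simp only [iteratedLineDerivOp_succ_left]
    exact lineDerivOp_integral (hc.comp hF) (fun q hq =>
      hint (q.comp (iteratedLineDerivOpCLM ℂ 𝓢(E, ℂ) (Fin.tail v)).toLinearMap) (hq.comp hc))
      (ih (Fin.tail v)) _ t

/-- A continuous functional on Schwartz space commutes with absolutely convergent integrals of
Schwartz functions. -/
theorem apply_integral {F : X → 𝓢(E, ℂ)} (hF : Continuous F)
    (hint : ∀ q : Seminorm ℂ 𝓢(E, ℂ), Continuous q → Integrable (fun x => q (F x)) μ)
    {G : 𝓢(E, ℂ)} (hG : ∀ t, G t = ∫ x, F x t ∂μ) (f : 𝓢(E, ℂ) →L[ℂ] ℂ) :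
    f G = ∫ x, f (F x) ∂μ := by
  -- Being continuous, `f` is bounded by finitely many weighted derivatives. It thus factors through
  -- the range of `weightedDeriv k l`, a subspace of a Banach space, as a bounded functional, which
  -- Hahn–Banach extends to the whole space.
  obtain ⟨C, k, l, hC⟩ := exists_seminorm_le (E := E)
    (q := (normSeminorm ℂ ℂ).comp f.toLinearMap) (by exact f.continuous.norm)
  obtain ⟨q, hq, hqb⟩ := exists_seminorm_norm_weightedDeriv_le (E := E) k l
  have hJc : Continuous (weightedDeriv (E := E) k l) := continuous_of_norm_le_seminorm _ hq hqb
  have hfJ : ∀ Φ, ‖f Φ‖ ≤ C * ‖weightedDeriv k l Φ‖ := fun Φ =>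
    hC Φ _ (norm_nonneg _) fun j hj t => norm_iteratedFDeriv_le_norm_weightedDeriv k l Φ hj t
  let e := LinearEquiv.ofInjective _ (weightedDeriv_injective (E := E) k l)
  have he : ∀ Φ, (e Φ : BoundedContinuousFunction (DerivIndex E l) ℂ) = weightedDeriv k l Φ :=
    fun Φ => rfl
  let f' : LinearMap.range (weightedDeriv (E := E) k l) →L[ℂ] ℂ := LinearMap.mkContinuous
    (f.toLinearMap ∘ₗ e.symm.toLinearMap) C fun y => by
      obtain ⟨Φ, rfl⟩ := e.surjective y
      have : (f.toLinearMap ∘ₗ e.symm.toLinearMap) (e Φ) = f Φ := by simp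
      rw [this]
      exact hfJ Φ
  obtain ⟨g, hg, -⟩ := exists_extension_norm_eq _ f'
  have hgJ : ∀ Φ, g (weightedDeriv k l Φ) = f Φ := fun Φ => by
    have h1 := hg (e Φ)
    have h2 : f' (e Φ) = f Φ := by simp [f']
    rw [h2] at h1
    exact h1
  -- The target space need not be separable; strong measurability comes from second countability of
  -- `X`.
  have hJint : Integrable (fun x => weightedDeriv k l (F x)) μ :=
    (hint q hq).mono' (hJc.comp hF).aestronglyMeasurable (Eventually.of_forall fun x => hqb _)
  -- Evaluations at indices commute with the Bochner integral and separate points, so the identity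
  -- reduces to differentiation of `G` under the integral.
  have hJG : weightedDeriv k l G = ∫ x, weightedDeriv k l (F x) ∂μ := by
    ext i
    have h1 := (BoundedContinuousFunction.evalCLM (β := ℂ) ℝ i).integral_comp_comm hJint
    refine Eq.trans ?_ h1
    simp only [BoundedContinuousFunction.evalCLM_apply, weightedDeriv_apply]
    rw [integral_const_mul, iteratedLineDerivOp_integral hF hint hG]
  rw [← hgJ, hJG, ← g.integral_comp_comm hJint]
  simp only [hgJ]

end IntegralInterchange

end

/-! ### Inversion of the short-time Fourier transform; multipliers as convolutions. -/

noncomputable section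

variable {n : ℕ}

/-- The short-time Fourier transform without normalising constant. -/
def gabor (φ : 𝓢(EuclideanSpace ℝ (Fin n), ℂ)) (f : 𝓢'(EuclideanSpace ℝ (Fin n), ℂ))
    (x ξ : EuclideanSpace ℝ (Fin n)) : ℂ := f (shiftedWindow φ x ξ)

theorem continuous_tempered (f : 𝓢'(EuclideanSpace ℝ (Fin n), ℂ)) : Continuous fun θ => f θ :=
  ContinuousLinearMap.continuous (f : 𝓢(EuclideanSpace ℝ (Fin n), ℂ) →L[ℂ] ℂ)

theorem continuous_gabor (φ : 𝓢(EuclideanSpace ℝ (Fin n), ℂ))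
    (f : 𝓢'(EuclideanSpace ℝ (Fin n), ℂ)) :
    Continuous fun z : EuclideanSpace ℝ (Fin n) × EuclideanSpace ℝ (Fin n) =>
      gabor φ f z.1 z.2 :=
  (continuous_tempered f).comp (continuous_shiftedWindow φ)

theorem exists_seminorm_tempered_le (f : 𝓢'(EuclideanSpace ℝ (Fin n), ℂ)) :
    ∃ q : Seminorm ℂ 𝓢(EuclideanSpace ℝ (Fin n), ℂ), Continuous q ∧ ∀ θ, ‖f θ‖ = q θ :=
  ⟨(normSeminorm ℂ ℂ).comp
    (f : 𝓢(EuclideanSpace ℝ (Fin n), ℂ) →L[ℂ] ℂ).toLinearMap, (continuous_tempered f).norm,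
    fun _ => rfl⟩

theorem tempered_apply_integral {X : Type*} [TopologicalSpace X] [SecondCountableTopology X]
    [MeasurableSpace X] [BorelSpace X] {μ : Measure X}
    {F : X → 𝓢(EuclideanSpace ℝ (Fin n), ℂ)} (hF : Continuous F)
    (hint : ∀ q : Seminorm ℂ 𝓢(EuclideanSpace ℝ (Fin n), ℂ), Continuous q →
      Integrable (fun x => q (F x)) μ)
    {G : 𝓢(EuclideanSpace ℝ (Fin n), ℂ)} (hG : ∀ t, G t = ∫ x, F x t ∂μ)
    (f : 𝓢'(EuclideanSpace ℝ (Fin n), ℂ)) : f G = ∫ x, f (F x) ∂μ :=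
  apply_integral hF hint hG (f : 𝓢(EuclideanSpace ℝ (Fin n), ℂ) →L[ℂ] ℂ)

theorem decay_add_mul_pow (M N : ℕ) (x : EuclideanSpace ℝ (Fin n)) :
    decay (M + N) x * (1 + ‖x‖) ^ M = decay N x := by
  unfold decay
  rw [pow_add, mul_inv]
  field_simp

theorem integrable_decay_mul_decay {N : ℕ} (hN : n < N) :
    Integrable fun z : EuclideanSpace ℝ (Fin n) × EuclideanSpace ℝ (Fin n) =>
      decay N z.1 * decay N z.2 :=
  (integrable_decay hN).mul_prod (integrable_decay hN)

/-- The inversion formula for the short-time Fourier transform, tested on Schwartz functions. -/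
theorem gabor_inversion (φ θ : 𝓢(EuclideanSpace ℝ (Fin n), ℂ))
    (f : 𝓢'(EuclideanSpace ℝ (Fin n), ℂ)) :
    ((2 * Real.pi) ^ n * ∫ t, φ t * (starRingEnd ℂ) (φ t)) * f θ =
      ∫ z : EuclideanSpace ℝ (Fin n) × EuclideanSpace ℝ (Fin n),
        windowPairing φ θ z.1 z.2 * gabor φ f z.1 z.2 := by
  let F : EuclideanSpace ℝ (Fin n) × EuclideanSpace ℝ (Fin n) → 𝓢(EuclideanSpace ℝ (Fin n), ℂ) :=
    fun z => windowPairing φ θ z.1 z.2 • shiftedWindow φ z.1 z.2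
  have hF : Continuous F := (continuous_windowPairing φ θ).smul (continuous_shiftedWindow φ)
  have hint : ∀ q : Seminorm ℂ 𝓢(EuclideanSpace ℝ (Fin n), ℂ), Continuous q →
      Integrable (fun z => q (F z)) := fun q hq => by
    obtain ⟨C, M, hC, h⟩ := exists_seminorm_shiftedWindow_le φ hq
    -- The exponent `M` cancels the polynomial growth of the shifted windows, and `n + 1` leaves an
    -- integrable weight in each variable.
    obtain ⟨r, -, hr⟩ := exists_seminorm_windowPairing_le φ (M + (n + 1))
    refine ((integrable_decay_mul_decay (Nat.lt_succ_self n)).const_mul (r θ * C)).mono'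
      (hq.comp hF).aestronglyMeasurable (Eventually.of_forall fun z => ?_)
    rw [Real.norm_of_nonneg (apply_nonneg _ _), map_smul_eq_mul]
    have := decay_pos (M + (n + 1)) z.1
    have := decay_pos (M + (n + 1)) z.2
    calc _ ≤ (decay (M + (n + 1)) z.1 * decay (M + (n + 1)) z.2 * r θ) *
          (C * ((1 + ‖z.1‖) ^ M * (1 + ‖z.2‖) ^ M)) := by
          gcongr
          · exact hr θ _ _
          · exact h _ _
      _ = r θ * C * ((decay (M + (n + 1)) z.1 * (1 + ‖z.1‖) ^ M) *
          (decay (M + (n + 1)) z.2 * (1 + ‖z.2‖) ^ M)) := by ring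
      _ = _ := by rw [decay_add_mul_pow, decay_add_mul_pow]
  have hG : ∀ t, (((2 * Real.pi) ^ n * ∫ t, φ t * (starRingEnd ℂ) (φ t) : ℂ) • θ) t =
      ∫ z, F z t := fun t => by
    obtain ⟨q, hq, hb⟩ := exists_seminorm_norm_apply_le (E := EuclideanSpace ℝ (Fin n))
    have hI : Integrable (fun z => F z t) := (hint q hq).mono'
      ((continuous_schwartz_apply t).comp hF).aestronglyMeasurable
      (Eventually.of_forall fun z => hb _ _)
    rw [Measure.volume_eq_prod, integral_prod _ hI]
    -- The `ξ`-integral is a Fourier inversion and yields `θ t * |φ (t - x)| ^ 2` times `(2π) ^ n`;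
    -- the remaining `x`-integral is translation invariant.
    have h1 : ∀ x, ∫ ξ, F (x, ξ) t =
        ((2 * Real.pi) ^ n * θ t) * (φ (t - x) * (starRingEnd ℂ) (φ (t - x))) := fun x => by
      have h2 := integral_exp_mul_windowPairing φ θ x t
      calc _ = ∫ ξ, (starRingEnd ℂ) (φ (t - x)) *
            (Complex.exp (-(Complex.I * ((inner ℝ t ξ : ℝ) : ℂ))) * windowPairing φ θ x ξ) := by
            refine integral_congr_ae (Eventually.of_forall fun ξ => ?_)
            simp only [F, smul_apply, shiftedWindow_apply, smul_eq_mul]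
            ring
        _ = _ := by rw [integral_const_mul, h2]; ring
    simp only [h1]
    rw [integral_const_mul, integral_sub_left_eq_self
      (fun y => φ y * (starRingEnd ℂ) (φ y)) volume t, smul_apply, smul_eq_mul]
    ring
  have h := tempered_apply_integral hF hint hG f
  simp only [F, map_smul, smul_eq_mul] at h
  exact h

/-- The integrand is `‖φ t‖ ^ (2 * (k + 1))`, continuous, nonnegative and positive on a nonempty
open set. The case `k = 0` normalises the inversion formula, `k = 1` the product formula. -/
theorem integral_mul_conj_ne_zero {φ : 𝓢(EuclideanSpace ℝ (Fin n), ℂ)} (hφ : φ ≠ 0) (k : ℕ) :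
    ∫ t, (φ t * (starRingEnd ℂ) (φ t)) ^ (k + 1) ≠ 0 := by
  have h1 : ∀ t, (φ t * (starRingEnd ℂ) (φ t)) ^ (k + 1) =
      ((‖φ t‖ ^ (2 * (k + 1)) : ℝ) : ℂ) := fun t => by
    rw [Complex.mul_conj, Complex.normSq_eq_norm_sq, pow_mul]
    push_cast
    rfl
  simp only [h1]
  rw [integral_complex_ofReal, Complex.ofReal_ne_zero]
  obtain ⟨t, ht⟩ : ∃ t, φ t ≠ 0 := by
    by_contra! h
    exact hφ (SchwartzMap.ext h)
  have hint : Integrable fun t => ‖φ t‖ ^ (2 * (k + 1)) := by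
    obtain ⟨q, -, hq⟩ := exists_seminorm_norm_apply_le (E := EuclideanSpace ℝ (Fin n))
    refine ((φ.integrable (μ := volume)).norm.const_mul (q φ ^ (2 * k + 1))).mono'
      (Continuous.aestronglyMeasurable (by fun_prop)) (Eventually.of_forall fun t => ?_)
    rw [norm_pow, norm_norm, show 2 * (k + 1) = (2 * k + 1) + 1 by ring, pow_succ]
    gcongr
    exact hq φ t
  refine ne_of_gt ((integral_pos_iff_support_of_nonneg (fun _ => by positivity) hint).2 ?_)
  have hs : IsOpen (Function.support fun t => ‖φ t‖ ^ (2 * (k + 1))) :=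
    (show Continuous fun t => ‖φ t‖ ^ (2 * (k + 1)) by fun_prop).isOpen_support
  exact hs.measure_pos volume ⟨t, by simpa using ht⟩

theorem exists_gabor_le (φ : 𝓢(EuclideanSpace ℝ (Fin n), ℂ))
    (f : 𝓢'(EuclideanSpace ℝ (Fin n), ℂ)) :
    ∃ (C : ℝ) (M : ℕ), 0 ≤ C ∧ ∀ x ξ, ‖gabor φ f x ξ‖ ≤
      C * ((1 + ‖x‖) ^ M * (1 + ‖ξ‖) ^ M) := by
  obtain ⟨q, hq, h⟩ := exists_seminorm_tempered_le f
  obtain ⟨C, M, hC, hb⟩ := exists_seminorm_shiftedWindow_le φ hq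
  exact ⟨C, M, hC, fun x ξ => (h _).trans_le (hb x ξ)⟩

/-- Fourier multipliers with a dilated Schwartz symbol are convolutions. -/
theorem fourierMultiplier_eq_integral (g θ : 𝓢(EuclideanSpace ℝ (Fin n), ℂ)) (ε : ℝ)
    (t : EuclideanSpace ℝ (Fin n)) :
    (𝓕 (SchwartzMap.smulLeftCLM ℂ (fun w : EuclideanSpace ℝ (Fin n) => g (ε • w)) (𝓕⁻ θ))) t =
      ∫ z, (𝓕 g) z * θ (t - ε • z) := by
  have hg : (fun w : EuclideanSpace ℝ (Fin n) => g (ε • w)).HasTemperateGrowth :=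
    g.hasTemperateGrowth.comp
      ((ε • ContinuousLinearMap.id ℝ (EuclideanSpace ℝ (Fin n))).hasTemperateGrowth)
  rw [SchwartzMap.fourier_coe, SchwartzMap.smulLeftCLM_apply hg, Real.fourier_eq']
  have h1 : ∀ w, g (ε • w) =
      ∫ z, Complex.exp (((2 * Real.pi * inner ℝ z (ε • w) : ℝ) : ℂ) * Complex.I) * (𝓕 g) z :=
    fun w => by
      have h3 : (𝓕⁻ (𝓕 g)) (ε • w) = g (ε • w) := by rw [FourierPair.fourierInv_fourier_eq]
      rw [← h3, SchwartzMap.fourierInv_coe, Real.fourierInv_eq']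
      rfl
  have h2 : ∀ z, θ (t - ε • z) = ∫ w, Complex.exp (((-2 * Real.pi * inner ℝ w (t - ε • z) : ℝ) : ℂ)
      * Complex.I) * (𝓕⁻ θ) w :=
    fun z => by
      have h3 : (𝓕 (𝓕⁻ θ)) (t - ε • z) = θ (t - ε • z) := by
        rw [FourierInvPair.fourier_fourierInv_eq]
      rw [← h3, SchwartzMap.fourier_coe, Real.fourier_eq']
      rfl
  -- With `g (ε • w)` and `θ (t - ε • z)` expanded as Fourier integrals, the two sides are the
  -- iterated integrals of `K` in the two orders.
  let K : EuclideanSpace ℝ (Fin n) → EuclideanSpace ℝ (Fin n) → ℂ := fun w z =>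
    Complex.exp (((2 * Real.pi * inner ℝ z (ε • w) + -2 * Real.pi * inner ℝ w t : ℝ) : ℂ) *
      Complex.I) * ((𝓕⁻ θ) w * (𝓕 g) z)
  have hK : Integrable (Function.uncurry K) (volume.prod volume) := by
    refine (((𝓕⁻ θ).integrable (μ := volume)).mul_prod ((𝓕 g).integrable (μ := volume))).norm.mono'
      (Continuous.aestronglyMeasurable ?_) (Eventually.of_forall fun z => ?_)
    · simp only [K, Function.uncurry_def]
      fun_prop
    · simp only [K, Function.uncurry_def]
      rw [norm_mul, Complex.norm_exp_ofReal_mul_I, one_mul]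
  calc _ = ∫ w, ∫ z, K w z := by
        refine integral_congr_ae (Eventually.of_forall fun w => ?_)
        simp only [smul_eq_mul]
        rw [h1, ← integral_mul_const, ← integral_const_mul]
        refine integral_congr_ae (Eventually.of_forall fun z => ?_)
        simp only [K]
        push_cast
        rw [add_mul, Complex.exp_add]
        ring
    _ = ∫ z, ∫ w, K w z := integral_integral_swap hK
    _ = _ := by
        refine integral_congr_ae (Eventually.of_forall fun z => ?_)
        simp only
        rw [h2, ← integral_const_mul]
        refine integral_congr_ae (Eventually.of_forall fun w => ?_)
        simp only [K, inner_sub_right, inner_smul_right, real_inner_comm w z]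
        have : (2 * Real.pi * (ε * inner ℝ w z) + -2 * Real.pi * inner ℝ w t : ℝ) =
          -2 * Real.pi * (inner ℝ w t - ε * inner ℝ w z) := by ring
        rw [this]
        ring

end

/-! ### Convolutions of distributions with Schwartz kernels have temperate growth. -/

noncomputable section

section TemperateConvolution

open scoped LineDeriv
open LineDeriv

variable {n : ℕ}

/-- `x ↦ f(K(· - x))`. -/
def translatePairing (f : 𝓢'(EuclideanSpace ℝ (Fin n), ℂ)) (K : 𝓢(EuclideanSpace ℝ (Fin n), ℂ))
    (x : EuclideanSpace ℝ (Fin n)) : ℂ := f (SchwartzMap.compSubConstCLM ℂ x K)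

theorem continuous_translatePairing (f : 𝓢'(EuclideanSpace ℝ (Fin n), ℂ))
    (K : 𝓢(EuclideanSpace ℝ (Fin n), ℂ)) : Continuous (translatePairing f K) :=
  (continuous_tempered f).comp
    (continuous_compSubConst.comp (continuous_id.prodMk continuous_const))

theorem exists_translatePairing_le (f : 𝓢'(EuclideanSpace ℝ (Fin n), ℂ))
    (K : 𝓢(EuclideanSpace ℝ (Fin n), ℂ)) :
    ∃ (k : ℕ) (C : ℝ), ∀ x, ‖translatePairing f K x‖ ≤ C * (1 + ‖x‖) ^ k := by
  obtain ⟨q, hq, h⟩ := exists_seminorm_tempered_le f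
  obtain ⟨M, q', -, h'⟩ := exists_seminorm_compSubConst_le hq
  exact ⟨M, q' K, fun x => ((h _).trans_le (h' x K)).trans_eq (mul_comm _ _)⟩

/-- Expanding `v` in the standard basis expresses the derivative of `translatePairing f K` through
finitely many functions of the same kind, so that induction on the order closes. -/
theorem lineDerivOp_eq_sum (K : 𝓢(EuclideanSpace ℝ (Fin n), ℂ)) (v : EuclideanSpace ℝ (Fin n)) :
    (∂_{v} K : 𝓢(EuclideanSpace ℝ (Fin n), ℂ)) =
      ∑ i, ((v i : ℝ) : ℂ) • (∂_{EuclideanSpace.single i (1 : ℝ)} K :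
        𝓢(EuclideanSpace ℝ (Fin n), ℂ)) := by
  ext t
  have hv : v = ∑ i, v i • EuclideanSpace.single i (1 : ℝ) := by
    ext j
    simp [Finset.sum_apply, Pi.single_apply]
  rw [SchwartzMap.lineDerivOp_apply_eq_fderiv]
  nth_rewrite 1 [hv]
  rw [map_sum, sum_apply]
  refine Finset.sum_congr rfl fun i _ => ?_
  rw [map_smul, smul_apply, SchwartzMap.lineDerivOp_apply_eq_fderiv, Complex.real_smul, smul_eq_mul]

/-- The fundamental theorem of calculus for `s ↦ K(· - x - s v)`, read as an integral of Schwartz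
functions to which `f` is applied. Continuity of the integrand then suffices for differentiability,
with no limit of difference quotients in Schwartz space. -/
theorem translatePairing_sub (f : 𝓢'(EuclideanSpace ℝ (Fin n), ℂ))
    (K : 𝓢(EuclideanSpace ℝ (Fin n), ℂ)) (x v : EuclideanSpace ℝ (Fin n)) :
    translatePairing f K (x + v) - translatePairing f K x =
      -∑ i, ((v i : ℝ) : ℂ) * ∫ s in Set.Ioc (0 : ℝ) 1,
        translatePairing f (∂_{EuclideanSpace.single i (1 : ℝ)} K) (x + s • v) := by
  let F : ℝ → 𝓢(EuclideanSpace ℝ (Fin n), ℂ) := fun s =>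
    SchwartzMap.compSubConstCLM ℂ (x + s • v) (∂_{v} K)
  have hF : Continuous F := continuous_compSubConst.comp
    (Continuous.prodMk (by fun_prop) continuous_const)
  have hint : ∀ {u : ℝ → ℂ}, Continuous u → IntegrableOn u (Set.Ioc (0 : ℝ) 1) := fun hu =>
    (hu.integrableOn_Icc).mono_set Set.Ioc_subset_Icc_self
  have hG : ∀ t, (SchwartzMap.compSubConstCLM ℂ x K - SchwartzMap.compSubConstCLM ℂ (x + v) K) t =
      ∫ s in Set.Ioc (0 : ℝ) 1, F s t := fun t => by
    rw [← intervalIntegral.integral_of_le zero_le_one]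
    have hd : ∀ s : ℝ, HasDerivAt (fun s : ℝ => -K (t - (x + s • v))) (F s t) s := fun s => by
      have h1 : HasDerivAt (fun s : ℝ => t - (x + s • v)) (-v) s := by
        simpa using (((hasDerivAt_id s).smul_const v).const_add x).const_sub t
      have h2 := ((K.hasFDerivAt (t - (x + s • v))).comp_hasDerivAt s h1).neg
      rw [map_neg, neg_neg] at h2
      exact h2
    have hc : Continuous fun s => F s t := (continuous_schwartz_apply t).comp hF
    rw [intervalIntegral.integral_eq_sub_of_hasDerivAt (fun s _ => hd s)
      (hc.intervalIntegrable _ _)]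
    simp
    ring
  have h := tempered_apply_integral (μ := volume.restrict (Set.Ioc (0 : ℝ) 1)) hF
    (fun q hq => ((hq.comp hF).integrableOn_Icc).mono_set Set.Ioc_subset_Icc_self) hG f
  rw [map_sub] at h
  have h2 : ∀ s, f (F s) = ∑ i, ((v i : ℝ) : ℂ) *
      translatePairing f (∂_{EuclideanSpace.single i (1 : ℝ)} K) (x + s • v) := fun s => by
    simp only [F, lineDerivOp_eq_sum K v, map_sum, map_smul, smul_eq_mul, translatePairing]
  simp only [h2] at h
  rw [integral_finsetSum] at h
  · simp only [integral_const_mul] at h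
    rw [← h]
    simp [translatePairing]
  · intro i _
    exact (hint ((continuous_translatePairing f _).comp (by fun_prop))).const_mul _

/-- The coordinate functional, complexified. -/
def coordCLM (i : Fin n) : EuclideanSpace ℝ (Fin n) →L[ℝ] ℂ :=
  Complex.ofRealCLM.comp (EuclideanSpace.proj i)

theorem hasFDerivAt_translatePairing (f : 𝓢'(EuclideanSpace ℝ (Fin n), ℂ))
    (K : 𝓢(EuclideanSpace ℝ (Fin n), ℂ)) (x : EuclideanSpace ℝ (Fin n)) :
    HasFDerivAt (translatePairing f K)
      (∑ i, (-translatePairing f (∂_{EuclideanSpace.single i (1 : ℝ)} K) x) • coordCLM i) x := by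
  rw [hasFDerivAt_iff_isLittleO_nhds_zero]
  have h1 : ∀ v, translatePairing f K (x + v) - translatePairing f K x -
      (∑ i, (-translatePairing f (∂_{EuclideanSpace.single i (1 : ℝ)} K) x) • coordCLM i) v =
      ∑ i, -(((v i : ℝ) : ℂ) * ∫ s in Set.Ioc (0 : ℝ) 1,
        (translatePairing f (∂_{EuclideanSpace.single i (1 : ℝ)} K) (x + s • v) -
          translatePairing f (∂_{EuclideanSpace.single i (1 : ℝ)} K) x)) := fun v => by
    rw [translatePairing_sub, ← Finset.sum_neg_distrib, sum_apply,
      ← Finset.sum_sub_distrib]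
    refine Finset.sum_congr rfl fun i _ => ?_
    rw [integral_sub]
    · simp [coordCLM]
      ring
    · exact (Continuous.integrableOn_Icc ((continuous_translatePairing f _).comp
        (by fun_prop))).mono_set Set.Ioc_subset_Icc_self
    · exact integrable_const _
  simp only [h1]
  suffices key : ∀ i : Fin n, (fun v : EuclideanSpace ℝ (Fin n) =>
      -(((v i : ℝ) : ℂ) * ∫ s in Set.Ioc (0 : ℝ) 1,
        (translatePairing f (∂_{EuclideanSpace.single i (1 : ℝ)} K) (x + s • v) -
          translatePairing f (∂_{EuclideanSpace.single i (1 : ℝ)} K) x))) =o[𝓝 0] fun v => v from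
    Asymptotics.IsLittleO.fun_sum fun i _ => key i
  intro i
  rw [Asymptotics.isLittleO_iff]
  intro c hc
  have hcont := (continuous_translatePairing f (∂_{EuclideanSpace.single i (1 : ℝ)} K)).tendsto x
  obtain ⟨δ, hδ, hb⟩ := Metric.tendsto_nhds_nhds.1 hcont c hc
  filter_upwards [Metric.ball_mem_nhds 0 hδ] with v hv
  rw [mem_ball_zero_iff] at hv
  rw [norm_neg, norm_mul, Complex.norm_real, mul_comm]
  have hvi : ‖v i‖ ≤ ‖v‖ := PiLp.norm_apply_le v i
  have hI : ‖∫ s in Set.Ioc (0 : ℝ) 1,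
        (translatePairing f (∂_{EuclideanSpace.single i (1 : ℝ)} K) (x + s • v) -
          translatePairing f (∂_{EuclideanSpace.single i (1 : ℝ)} K) x)‖ ≤ c := by
    have := norm_setIntegral_le_of_norm_le_const (μ := volume) (s := Set.Ioc (0 : ℝ) 1) (C := c)
      (f := fun s => translatePairing f (∂_{EuclideanSpace.single i (1 : ℝ)} K) (x + s • v) -
          translatePairing f (∂_{EuclideanSpace.single i (1 : ℝ)} K) x) (by simp)
      (fun s hs => by
        rw [← dist_eq_norm]
        refine (hb ?_).le
        rw [dist_eq_norm, add_sub_cancel_left, norm_smul, Real.norm_of_nonneg hs.1.le]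
        exact lt_of_le_of_lt (mul_le_of_le_one_left (norm_nonneg _) hs.2) hv)
    simpa using this
  gcongr

theorem contDiff_translatePairing (f : 𝓢'(EuclideanSpace ℝ (Fin n), ℂ)) (l : ℕ)
    (K : 𝓢(EuclideanSpace ℝ (Fin n), ℂ)) : ContDiff ℝ l (translatePairing f K) := by
  induction l generalizing K with
  | zero => exact contDiff_zero.2 (continuous_translatePairing f K)
  | succ l ih =>
    push_cast
    rw [contDiff_succ_iff_fderiv]
    refine ⟨fun x => (hasFDerivAt_translatePairing f K x).differentiableAt, by simp, ?_⟩
    have : fderiv ℝ (translatePairing f K) = fun x => ∑ i,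
        (-translatePairing f (∂_{EuclideanSpace.single i (1 : ℝ)} K) x) • coordCLM i :=
      funext fun x => (hasFDerivAt_translatePairing f K x).fderiv
    rw [this]
    exact ContDiff.sum fun i _ => (ih _).neg.smul contDiff_const

theorem exists_iteratedFDeriv_translatePairing_le (f : 𝓢'(EuclideanSpace ℝ (Fin n), ℂ)) (l : ℕ)
    (K : 𝓢(EuclideanSpace ℝ (Fin n), ℂ)) : ∃ (k : ℕ) (C : ℝ), ∀ x,
      ‖iteratedFDeriv ℝ l (translatePairing f K) x‖ ≤ C * (1 + ‖x‖) ^ k := by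
  induction l generalizing K with
  | zero => simpa using exists_translatePairing_le f K
  | succ l ih =>
    let A : Fin n → ℂ →L[ℝ] (EuclideanSpace ℝ (Fin n) →L[ℝ] ℂ) := fun i =>
      -(ContinuousLinearMap.toSpanSingleton ℂ (coordCLM i)).restrictScalars ℝ
    have hfd : fderiv ℝ (translatePairing f K) = fun x => ∑ i,
        (A i ∘ translatePairing f (∂_{EuclideanSpace.single i (1 : ℝ)} K)) x := by
      funext x
      rw [(hasFDerivAt_translatePairing f K x).fderiv]
      refine Finset.sum_congr rfl fun i _ => ?_
      ext v
      simp [A]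
    choose k C hC using fun i : Fin n => ih (∂_{EuclideanSpace.single i (1 : ℝ)} K)
    -- The summed exponent dominates each `k i`; absolute values are needed since the `C i` carry no
    -- sign.
    refine ⟨∑ i, k i, ∑ i, ‖A i‖ * |C i|, fun x => ?_⟩
    rw [← norm_iteratedFDeriv_fderiv, hfd, iteratedFDeriv_fun_sum_apply fun i _ =>
      ((A i).contDiff.comp (contDiff_translatePairing f l _)).contDiffAt, Finset.sum_mul]
    refine (norm_sum_le _ _).trans (Finset.sum_le_sum fun i _ => ?_)
    refine ((A i).norm_iteratedFDeriv_comp_left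
      (contDiff_translatePairing f l _).contDiffAt le_rfl).trans ?_
    rw [mul_assoc]
    gcongr
    calc _ ≤ C i * (1 + ‖x‖) ^ k i := hC i x
      _ ≤ |C i| * (1 + ‖x‖) ^ (∑ i, k i) := by
        gcongr
        · exact le_abs_self _
        · simp
        · exact Finset.single_le_sum (fun _ _ => Nat.zero_le _) (Finset.mem_univ i)

theorem hasTemperateGrowth_translatePairing (f : 𝓢'(EuclideanSpace ℝ (Fin n), ℂ))
    (K : 𝓢(EuclideanSpace ℝ (Fin n), ℂ)) : (translatePairing f K).HasTemperateGrowth :=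
  ⟨contDiff_infty.2 fun l => contDiff_translatePairing f l K,
    fun l => exists_iteratedFDeriv_translatePairing_le f l K⟩

end TemperateConvolution

end

/-! ### The low-pass filter and the phase space envelope. -/

noncomputable section

variable {n : ℕ}

/-- The dilated cutoff as a Schwartz function. -/
def IsCutoff.dilate {ψ : EuclideanSpace ℝ (Fin n) → ℂ} (hψ : IsCutoff ψ) (c : ℝ) (hc : c ≠ 0) :
    𝓢(EuclideanSpace ℝ (Fin n), ℂ) :=
  (hψ.hasCompactSupport.comp_smul hc).toSchwartzMap (hψ.contDiff.comp (by fun_prop))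

theorem IsCutoff.dilate_apply {ψ : EuclideanSpace ℝ (Fin n) → ℂ} (hψ : IsCutoff ψ) (c : ℝ)
    (hc : c ≠ 0) (w : EuclideanSpace ℝ (Fin n)) : hψ.dilate c hc w = ψ (c • w) := rfl

/-- The action of the low-pass multiplier on test functions. -/
def lowPassTest (ψ : EuclideanSpace ℝ (Fin n) → ℂ) (j : ℕ)
    (θ : 𝓢(EuclideanSpace ℝ (Fin n), ℂ)) : 𝓢(EuclideanSpace ℝ (Fin n), ℂ) :=
  𝓕 (SchwartzMap.smulLeftCLM ℂ
    (fun η : EuclideanSpace ℝ (Fin n) => ψ ((-(2 * Real.pi) / 2 ^ j : ℝ) • η)) (𝓕⁻ θ))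

theorem lowPass_apply (ψ : EuclideanSpace ℝ (Fin n) → ℂ) (j : ℕ)
    (f : 𝓢'(EuclideanSpace ℝ (Fin n), ℂ)) (θ : 𝓢(EuclideanSpace ℝ (Fin n), ℂ)) :
    lowPass ψ j f θ = f (lowPassTest ψ j θ) := rfl

theorem neg_two_pi_ne_zero : -(2 * Real.pi) ≠ 0 := by
  have := Real.pi_pos
  exact neg_ne_zero.2 (by positivity)

/-- The convolution kernel of the low-pass filter at scale one. -/
def IsCutoff.kernel {ψ : EuclideanSpace ℝ (Fin n) → ℂ} (hψ : IsCutoff ψ) :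
    𝓢(EuclideanSpace ℝ (Fin n), ℂ) := 𝓕 (hψ.dilate (-(2 * Real.pi)) neg_two_pi_ne_zero)

theorem IsCutoff.lowPassTest_apply {ψ : EuclideanSpace ℝ (Fin n) → ℂ} (hψ : IsCutoff ψ) (j : ℕ)
    (θ : 𝓢(EuclideanSpace ℝ (Fin n), ℂ)) (t : EuclideanSpace ℝ (Fin n)) :
    lowPassTest ψ j θ t = ∫ z, hψ.kernel z * θ (t - ((2 : ℝ) ^ j)⁻¹ • z) := by
  rw [IsCutoff.kernel, ← fourierMultiplier_eq_integral, lowPassTest]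
  congr 4
  funext η
  rw [hψ.dilate_apply, smul_smul, div_eq_mul_inv]

theorem IsCutoff.integral_kernel {ψ : EuclideanSpace ℝ (Fin n) → ℂ} (hψ : IsCutoff ψ) :
    ∫ z, hψ.kernel z = 1 := by
  have h : (𝓕⁻ hψ.kernel) 0 = 1 := by
    rw [IsCutoff.kernel, FourierPair.fourierInv_fourier_eq, hψ.dilate_apply, smul_zero]
    exact hψ.eventually_eq_one.self_of_nhds
  rw [SchwartzMap.fourierInv_coe, Real.fourierInv_eq'] at h
  simpa using h

/-- The truncation `S^j f` is the convolution of `f` with the Fourier transform `K` of the dilated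
cutoff. The filtered test function is the Schwartz-valued integral of `θ s • K(· - s)`, and `f` may
be moved inside it. -/
theorem IsCutoff.exists_hasTemperateGrowth_lowPass {ψ : EuclideanSpace ℝ (Fin n) → ℂ}
    (hψ : IsCutoff ψ) (j : ℕ) (f : 𝓢'(EuclideanSpace ℝ (Fin n), ℂ)) :
    ∃ (u : EuclideanSpace ℝ (Fin n) → ℂ) (hu : u.HasTemperateGrowth),
      hu.toTemperedDistribution volume = lowPass ψ j f := by
  have hc : (-(2 * Real.pi) / 2 ^ j : ℝ) ≠ 0 := div_ne_zero neg_two_pi_ne_zero (by positivity)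
  let K : 𝓢(EuclideanSpace ℝ (Fin n), ℂ) := 𝓕 (hψ.dilate _ hc)
  refine ⟨translatePairing f K, hasTemperateGrowth_translatePairing f K, ?_⟩
  refine DFunLike.ext _ _ fun θ => ?_
  change ∫ s, θ s • translatePairing f K s = f (lowPassTest ψ j θ)
  let F : EuclideanSpace ℝ (Fin n) → 𝓢(EuclideanSpace ℝ (Fin n), ℂ) := fun s =>
    θ s • SchwartzMap.compSubConstCLM ℂ s K
  have hF : Continuous F := θ.continuous.smul
    (continuous_compSubConst.comp (continuous_id.prodMk continuous_const))
  have hint : ∀ q : Seminorm ℂ 𝓢(EuclideanSpace ℝ (Fin n), ℂ), Continuous q →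
      Integrable (fun s => q (F s)) := fun q hq => by
    obtain ⟨M, q', -, h⟩ := exists_seminorm_compSubConst_le hq
    obtain ⟨r, -, hr⟩ := exists_seminorm_ge (E := EuclideanSpace ℝ (Fin n)) (M + (n + 1)) 0
    refine ((integrable_decay (Nat.lt_succ_self n)).const_mul (r θ * q' K)).mono'
      (hq.comp hF).aestronglyMeasurable (Eventually.of_forall fun s => ?_)
    rw [Real.norm_of_nonneg (apply_nonneg _ _), map_smul_eq_mul]
    have h1 := hr θ 0 le_rfl s
    rw [norm_iteratedFDeriv_zero, ← le_inv_mul_iff₀ (by positivity)] at h1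
    calc _ ≤ (decay (M + (n + 1)) s * r θ) * ((1 + ‖s‖) ^ M * q' K) := by
          gcongr
          · exact mul_nonneg (decay_pos _ _).le (apply_nonneg _ _)
          · exact h1
          · exact h s K
      _ = r θ * q' K * (decay (M + (n + 1)) s * (1 + ‖s‖) ^ M) := by ring
      _ = _ := by rw [decay_add_mul_pow]
  have hG : ∀ t, lowPassTest ψ j θ t = ∫ s, F s t := fun t => by
    have h1 := fourierMultiplier_eq_integral (hψ.dilate _ hc) θ 1 t
    simp only [one_smul] at h1
    refine Eq.trans h1 ?_
    rw [← integral_sub_left_eq_self _ volume t]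
    refine integral_congr_ae (Eventually.of_forall fun s => ?_)
    simp only [F, smul_apply, smul_eq_mul, SchwartzMap.compSubConstCLM_apply, sub_sub_cancel]
    exact mul_comm _ _
  rw [tempered_apply_integral hF hint hG f]
  refine integral_congr_ae (Eventually.of_forall fun s => ?_)
  simp only [F, map_smul, translatePairing]

/-- Filtering averages translates of `θ` by `2^{-j} z` against a kernel that does not depend on `j`.
In phase space each translate acts as a shift of `y` and a phase; both the uniform bound and the
limit in `j` are read off from this form. -/
theorem IsCutoff.windowPairing_lowPassTest {ψ : EuclideanSpace ℝ (Fin n) → ℂ} (hψ : IsCutoff ψ)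
    (j : ℕ) (χ θ : 𝓢(EuclideanSpace ℝ (Fin n), ℂ)) (y η : EuclideanSpace ℝ (Fin n)) :
    windowPairing χ (lowPassTest ψ j θ) y η =
      ∫ z, hψ.kernel z * (Complex.exp (Complex.I * ((inner ℝ (((2 : ℝ) ^ j)⁻¹ • z) η : ℝ) : ℂ)) *
        windowPairing χ θ (y - ((2 : ℝ) ^ j)⁻¹ • z) η) := by
  set ε : ℝ := ((2 : ℝ) ^ j)⁻¹
  let K : EuclideanSpace ℝ (Fin n) → EuclideanSpace ℝ (Fin n) → ℂ := fun t z =>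
    hψ.kernel z * (Complex.exp (Complex.I * ((inner ℝ t η : ℝ) : ℂ)) *
      (χ (t - y) * θ (t - ε • z)))
  have hK : Integrable (Function.uncurry K) (volume.prod volume) := by
    obtain ⟨q, -, hq⟩ := exists_seminorm_norm_apply_le (E := EuclideanSpace ℝ (Fin n))
    refine ((((χ.integrable (μ := volume)).comp_sub_right y).norm.mul_prod
      (hψ.kernel.integrable (μ := volume)).norm).const_mul (q θ)).mono'
      (Continuous.aestronglyMeasurable ?_) (Eventually.of_forall fun z => ?_)
    · simp only [K, Function.uncurry_def]
      fun_prop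
    · simp only [K, Function.uncurry_def]
      rw [norm_mul, norm_mul, norm_exp_I_mul, one_mul, norm_mul]
      have := hq θ (z.1 - ε • z.2)
      calc _ ≤ ‖hψ.kernel z.2‖ * (‖χ (z.1 - y)‖ * q θ) := by gcongr
        _ = _ := by ring
  rw [windowPairing_eq_integral]
  calc _ = ∫ t, ∫ z, K t z := by
        refine integral_congr_ae (Eventually.of_forall fun t => ?_)
        simp only [K]
        rw [hψ.lowPassTest_apply, ← integral_const_mul, ← integral_const_mul]
        refine integral_congr_ae (Eventually.of_forall fun z => ?_)
        simp only
        ring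
    _ = ∫ z, ∫ t, K t z := integral_integral_swap hK
    _ = _ := by
        refine integral_congr_ae (Eventually.of_forall fun z => ?_)
        simp only [K]
        rw [integral_const_mul, windowPairing_eq_integral]
        congr 1
        rw [← integral_const_mul, ← integral_add_right_eq_self _ (ε • z)]
        refine integral_congr_ae (Eventually.of_forall fun t => ?_)
        simp only [inner_add_left, add_sub_cancel_right]
        rw [show t + ε • z - y = t - (y - ε • z) by abel]
        push_cast
        rw [mul_add, Complex.exp_add]
        ring

theorem norm_scale_le (j : ℕ) (z : EuclideanSpace ℝ (Fin n)) :
    ‖((2 : ℝ) ^ j)⁻¹ • z‖ ≤ ‖z‖ := by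
  rw [norm_smul]
  refine mul_le_of_le_one_left (norm_nonneg _) ?_
  rw [Real.norm_of_nonneg (by positivity)]
  exact inv_le_one_of_one_le₀ (one_le_pow₀ (by norm_num))

/-- Shifting the decay weight by `2^{-j} z` costs at most `(1 + ‖z‖) ^ N`, because `2^{-j} ≤ 1`.
Hence `C = ∫ ‖kernel z‖ (1 + ‖z‖) ^ N` works for all `j`. -/
theorem IsCutoff.exists_windowPairing_lowPassTest_le {ψ : EuclideanSpace ℝ (Fin n) → ℂ}
    (hψ : IsCutoff ψ) (N : ℕ) : ∃ C : ℝ≥0, ∀ (χ θ : 𝓢(EuclideanSpace ℝ (Fin n), ℂ)) (B : ℝ≥0)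
      (x ξ : EuclideanSpace ℝ (Fin n)),
      (∀ y η, ‖windowPairing χ θ y η‖ ≤ B * (decay N (x - y) * decay N (ξ - η))) →
      ∀ j y η, ‖windowPairing χ (lowPassTest ψ j θ) y η‖ ≤
        C * B * (decay N (x - y) * decay N (ξ - η)) := by
  have hk : Integrable fun z => ‖hψ.kernel z‖ * (1 + ‖z‖) ^ N := by
    obtain ⟨r, -, hr⟩ := exists_seminorm_ge (E := EuclideanSpace ℝ (Fin n)) (N + (n + 1)) 0
    refine ((integrable_decay (Nat.lt_succ_self n)).const_mul (r hψ.kernel)).mono'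
      (Continuous.aestronglyMeasurable (by fun_prop)) (Eventually.of_forall fun z => ?_)
    have h1 := hr hψ.kernel 0 le_rfl z
    rw [norm_iteratedFDeriv_zero, ← le_inv_mul_iff₀ (by positivity)] at h1
    rw [Real.norm_of_nonneg (by positivity)]
    calc _ ≤ (decay (N + (n + 1)) z * r hψ.kernel) * (1 + ‖z‖) ^ N := by gcongr; exact h1
      _ = r hψ.kernel * (decay (N + (n + 1)) z * (1 + ‖z‖) ^ N) := by ring
      _ = _ := by rw [decay_add_mul_pow]
  refine ⟨(∫ z, ‖hψ.kernel z‖ * (1 + ‖z‖) ^ N).toNNReal, fun χ θ B x ξ h j y η => ?_⟩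
  rw [hψ.windowPairing_lowPassTest, Real.coe_toNNReal _ (integral_nonneg fun z => by positivity)]
  refine (norm_integral_le_of_norm_le (hk.mul_const (B * (decay N (x - y) * decay N (ξ - η))))
    (Eventually.of_forall fun z => ?_)).trans_eq ?_
  · rw [norm_mul, norm_mul, norm_exp_I_mul, one_mul, mul_assoc]
    gcongr
    refine (h _ _).trans ?_
    have h1 := decay_le_mul N (x - (y - ((2 : ℝ) ^ j)⁻¹ • z)) (-(((2 : ℝ) ^ j)⁻¹ • z))
    rw [norm_neg, show x - (y - ((2 : ℝ) ^ j)⁻¹ • z) + -(((2 : ℝ) ^ j)⁻¹ • z) = x - y by abel] at h1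
    have h2 := norm_scale_le j z
    have h3 := decay_pos N (ξ - η)
    have h4 := decay_pos N (x - y)
    calc _ ≤ B * (((1 + ‖z‖) ^ N * decay N (x - y)) * decay N (ξ - η)) := by
          gcongr
          refine h1.trans ?_
          gcongr
      _ = _ := by ring
  · rw [integral_mul_const]
    ring

theorem tendsto_inv_two_pow_smul (z : EuclideanSpace ℝ (Fin n)) :
    Tendsto (fun j : ℕ => ((2 : ℝ) ^ j)⁻¹ • z) atTop (𝓝 0) := by
  have h : Tendsto (fun j : ℕ => ((2 : ℝ) ^ j)⁻¹) atTop (𝓝 0) :=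
    tendsto_inv_atTop_zero.comp (tendsto_pow_atTop_atTop_of_one_lt (by norm_num))
  simpa using h.smul_const z

theorem IsCutoff.tendsto_windowPairing_lowPassTest {ψ : EuclideanSpace ℝ (Fin n) → ℂ}
    (hψ : IsCutoff ψ) (χ θ : 𝓢(EuclideanSpace ℝ (Fin n), ℂ)) (y η : EuclideanSpace ℝ (Fin n)) :
    Tendsto (fun j => windowPairing χ (lowPassTest ψ j θ) y η) atTop
      (𝓝 (windowPairing χ θ y η)) := by
  simp only [hψ.windowPairing_lowPassTest]
  obtain ⟨q, -, hq⟩ := exists_seminorm_windowPairing_le χ 0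
  have hlim : ∫ z, hψ.kernel z * windowPairing χ θ y η = windowPairing χ θ y η := by
    rw [integral_mul_const, hψ.integral_kernel, one_mul]
  rw [← hlim]
  have hW : Continuous fun z : EuclideanSpace ℝ (Fin n) =>
      Complex.exp (Complex.I * ((inner ℝ z η : ℝ) : ℂ)) * windowPairing χ θ (y - z) η := by
    have := (continuous_windowPairing χ θ).comp
      (g := fun p : EuclideanSpace ℝ (Fin n) × EuclideanSpace ℝ (Fin n) =>
        windowPairing χ θ p.1 p.2)
      (f := fun z : EuclideanSpace ℝ (Fin n) => (y - z, η)) (by fun_prop)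
    exact Continuous.mul (by fun_prop) this
  refine tendsto_integral_of_dominated_convergence (fun z => ‖hψ.kernel z‖ * q θ)
    (fun j => ?_) ((hψ.kernel.integrable (μ := volume)).norm.mul_const _)
    (fun j => Eventually.of_forall fun z => ?_) (Eventually.of_forall fun z => ?_)
  · exact (hψ.kernel.continuous.mul (hW.comp (by fun_prop))).aestronglyMeasurable
  · rw [norm_mul, norm_mul, norm_exp_I_mul, one_mul]
    gcongr
    simpa [decay] using hq θ (y - ((2 : ℝ) ^ j)⁻¹ • z) η
  · refine Tendsto.const_mul _ ?_
    have := (hW.tendsto 0).comp (tendsto_inv_two_pow_smul z)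
    simpa [Function.comp_def] using this

/-- The envelope of the short-time Fourier transform of `f`. -/
def envelope (φ : 𝓢(EuclideanSpace ℝ (Fin n), ℂ)) (N : ℕ) (f : 𝓢'(EuclideanSpace ℝ (Fin n), ℂ))
    (x ξ : EuclideanSpace ℝ (Fin n)) : ℝ≥0∞ :=
  ∫⁻ z : EuclideanSpace ℝ (Fin n) × EuclideanSpace ℝ (Fin n),
    ‖gabor φ f z.1 z.2‖ₑ * (ENNReal.ofReal (decay N (x - z.1)) * ENNReal.ofReal (decay N (ξ - z.2)))

/-- The inversion formula with absolute values inside. The constant `B` measures how well `θ` is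
concentrated near the phase space point `(x, ξ)`, so one bound serves shifted windows as well as
their filtered versions. -/
theorem enorm_le_envelope {φ : 𝓢(EuclideanSpace ℝ (Fin n), ℂ)} (hφ : φ ≠ 0) (N : ℕ) :
    ∃ C : ℝ≥0, ∀ (f : 𝓢'(EuclideanSpace ℝ (Fin n), ℂ)) (θ : 𝓢(EuclideanSpace ℝ (Fin n), ℂ))
      (B : ℝ≥0) (x ξ : EuclideanSpace ℝ (Fin n)),
      (∀ y η, ‖windowPairing φ θ y η‖ ≤ B * (decay N (x - y) * decay N (ξ - η))) →
      ‖f θ‖ₑ ≤ C * B * envelope φ N f x ξ := by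
  set c : ℂ := (2 * Real.pi) ^ n * ∫ t, φ t * (starRingEnd ℂ) (φ t) with hc_def
  have hc : c ≠ 0 := by
    refine mul_ne_zero (pow_ne_zero _ (by simp [Real.pi_ne_zero])) ?_
    simpa using integral_mul_conj_ne_zero hφ 0
  refine ⟨‖c‖₊⁻¹, fun f θ B x ξ h => ?_⟩
  have h1 : f θ = c⁻¹ * ∫ z : EuclideanSpace ℝ (Fin n) × EuclideanSpace ℝ (Fin n),
        windowPairing φ θ z.1 z.2 * gabor φ f z.1 z.2 := by
    rw [← gabor_inversion, ← hc_def, inv_mul_cancel_left₀ hc]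
  rw [h1, enorm_mul, mul_assoc]
  have h2 : ‖c⁻¹‖ₑ = ((‖c‖₊⁻¹ : ℝ≥0) : ℝ≥0∞) := by rw [← nnnorm_inv]; rfl
  rw [h2]
  gcongr
  rw [envelope, ← lintegral_const_mul' _ _ ENNReal.coe_ne_top]
  refine (enorm_integral_le_lintegral_enorm _).trans (lintegral_mono fun z => ?_)
  rw [enorm_mul, mul_comm, mul_left_comm]
  gcongr
  rw [← ENNReal.ofReal_mul (decay_pos _ _).le, ← ENNReal.ofReal_coe_nnreal,
    ← ENNReal.ofReal_mul (by positivity), ← ofReal_norm]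
  exact ENNReal.ofReal_le_ofReal (h _ _)

/-- In the inversion formula only the factor `windowPairing` depends on `j`; it converges pointwise
and is dominated uniformly, while `gabor φ f` grows polynomially. Convergence of the filtered test
functions in Schwartz space is not needed. -/
theorem IsCutoff.tendsto_lowPass_apply {ψ : EuclideanSpace ℝ (Fin n) → ℂ} (hψ : IsCutoff ψ)
    {φ : 𝓢(EuclideanSpace ℝ (Fin n), ℂ)} (hφ : φ ≠ 0)
    (f : 𝓢'(EuclideanSpace ℝ (Fin n), ℂ)) (θ : 𝓢(EuclideanSpace ℝ (Fin n), ℂ)) :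
    Tendsto (fun j => lowPass ψ j f θ) atTop (𝓝 (f θ)) := by
  set c : ℂ := (2 * Real.pi) ^ n * ∫ t, φ t * (starRingEnd ℂ) (φ t) with hc_def
  have hc : c ≠ 0 := by
    refine mul_ne_zero (pow_ne_zero _ (by simp [Real.pi_ne_zero])) ?_
    simpa using integral_mul_conj_ne_zero hφ 0
  have h1 : ∀ θ, f θ = c⁻¹ * ∫ z : EuclideanSpace ℝ (Fin n) × EuclideanSpace ℝ (Fin n),
        windowPairing φ θ z.1 z.2 * gabor φ f z.1 z.2 := fun θ => by
    rw [← gabor_inversion, ← hc_def, inv_mul_cancel_left₀ hc]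
  simp only [lowPass_apply]
  rw [h1 θ]
  simp only [h1 (lowPassTest ψ _ θ)]
  refine Tendsto.const_mul _ ?_
  obtain ⟨C, M, hC, hg⟩ := exists_gabor_le φ f
  obtain ⟨q, -, hq⟩ := exists_seminorm_windowPairing_le φ (M + (n + 1))
  obtain ⟨D, hD⟩ := hψ.exists_windowPairing_lowPassTest_le (M + (n + 1))
  have hD' := hD φ θ (q θ).toNNReal 0 0 (fun y η => by
    rw [Real.coe_toNNReal _ (apply_nonneg _ _), zero_sub, zero_sub, decay_neg, decay_neg, mul_comm]
    exact hq θ y η)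
  refine tendsto_integral_of_dominated_convergence
    (fun z => D * (q θ).toNNReal * C * (decay (n + 1) z.1 * decay (n + 1) z.2))
    (fun j => ?_) ((integrable_decay_mul_decay (Nat.lt_succ_self n)).const_mul _)
    (fun j => Eventually.of_forall fun z => ?_) (Eventually.of_forall fun z => ?_)
  · exact ((continuous_windowPairing _ _).mul (continuous_gabor φ f)).aestronglyMeasurable
  · rw [norm_mul]
    have := decay_pos (M + (n + 1)) z.1
    have := decay_pos (M + (n + 1)) z.2
    have h2 := hD' j z.1 z.2
    rw [zero_sub, zero_sub, decay_neg, decay_neg] at h2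
    calc _ ≤ (D * (q θ).toNNReal * (decay (M + (n + 1)) z.1 * decay (M + (n + 1)) z.2)) *
          (C * ((1 + ‖z.1‖) ^ M * (1 + ‖z.2‖) ^ M)) := by
          gcongr
          exact hg _ _
      _ = D * (q θ).toNNReal * C * ((decay (M + (n + 1)) z.1 * (1 + ‖z.1‖) ^ M) *
          (decay (M + (n + 1)) z.2 * (1 + ‖z.2‖) ^ M)) := by ring
      _ = _ := by rw [decay_add_mul_pow, decay_add_mul_pow]
  · exact (hψ.tendsto_windowPairing_lowPassTest φ θ z.1 z.2).mul_const _

/-- The envelope dominates the short-time Fourier transforms of all low-pass truncations. -/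
theorem IsCutoff.exists_gabor_lowPass_le {ψ : EuclideanSpace ℝ (Fin n) → ℂ} (hψ : IsCutoff ψ)
    {φ : 𝓢(EuclideanSpace ℝ (Fin n), ℂ)} (hφ : φ ≠ 0) (N : ℕ) :
    ∃ C : ℝ≥0, ∀ (f : 𝓢'(EuclideanSpace ℝ (Fin n), ℂ)) j x ξ,
      ‖gabor φ (lowPass ψ j f) x ξ‖ₑ ≤ C * envelope φ N f x ξ := by
  obtain ⟨C, hC⟩ := enorm_le_envelope hφ N
  obtain ⟨D, hD⟩ := hψ.exists_windowPairing_lowPassTest_le (n := n) N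
  obtain ⟨B, hB⟩ := exists_windowPairing_shiftedWindow_le φ φ N
  refine ⟨C * (D * B), fun f j x ξ => ?_⟩
  have := hC f (lowPassTest ψ j (shiftedWindow φ x ξ)) (D * B) x ξ (fun y η => by
    push_cast
    exact hD φ _ B x ξ (hB x ξ) j y η)
  push_cast at this ⊢
  exact this

/-- The unfiltered bound, whose constant involves no cutoff; it is the one that enters the norm
estimate. -/
theorem exists_gabor_le_envelope {φ : 𝓢(EuclideanSpace ℝ (Fin n), ℂ)} (hφ : φ ≠ 0) (N : ℕ) :
    ∃ C : ℝ≥0, ∀ (f : 𝓢'(EuclideanSpace ℝ (Fin n), ℂ)) x ξ,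
      ‖gabor φ f x ξ‖ₑ ≤ C * envelope φ N f x ξ := by
  obtain ⟨C, hC⟩ := enorm_le_envelope hφ N
  obtain ⟨B, hB⟩ := exists_windowPairing_shiftedWindow_le φ φ N
  refine ⟨C * B, fun f x ξ => ?_⟩
  push_cast
  exact hC f _ B x ξ (hB x ξ)

end

/-! ### Minkowski, Hölder and interpolation for functions with values in `[0, ∞]`. -/

section LebesgueNorms

variable {α β : Type*} [MeasurableSpace α] [MeasurableSpace β] {μ : Measure α} {ν : Measure β}

theorem eLpNorm_ennreal_eq {p : ℝ≥0∞} (hp : 1 ≤ p) (hp' : p ≠ ⊤) (f : α → ℝ≥0∞) :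
    eLpNorm f p μ = (∫⁻ x, f x ^ p.toReal ∂μ) ^ (1 / p.toReal) := by
  rw [eLpNorm_eq_lintegral_rpow_enorm_toReal (one_pos.trans_le hp).ne' hp']
  simp only [enorm_eq_self]

theorem eLpNorm_ennreal_top (f : α → ℝ≥0∞) : eLpNorm f ⊤ μ = essSup f μ := by
  rw [eLpNorm_exponent_top, eLpNormEssSup]
  simp only [enorm_eq_self]

theorem eLpNorm_ennreal_rpow {p : ℝ≥0∞} (hp : 1 ≤ p) (hp' : p ≠ ⊤) (f : α → ℝ≥0∞) :
    eLpNorm f p μ ^ p.toReal = ∫⁻ x, f x ^ p.toReal ∂μ := by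
  have h : 0 < p.toReal := ENNReal.toReal_pos (one_pos.trans_le hp).ne' hp'
  rw [eLpNorm_ennreal_eq hp hp', ← ENNReal.rpow_mul, one_div_mul_cancel h.ne', ENNReal.rpow_one]

theorem eLpNorm_ennreal_mono {p : ℝ≥0∞} {f g : α → ℝ≥0∞} (h : ∀ x, f x ≤ g x) :
    eLpNorm f p μ ≤ eLpNorm g p μ :=
  eLpNorm_mono_enorm (by simpa using h)

theorem eLpNorm_ennreal_mono_ae {p : ℝ≥0∞} {f g : α → ℝ≥0∞} (h : ∀ᵐ x ∂μ, f x ≤ g x) :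
    eLpNorm f p μ ≤ eLpNorm g p μ :=
  eLpNorm_mono_enorm_ae (by simpa using h)

theorem eLpNorm_ennreal_const_mul {p : ℝ≥0∞} (hp : 1 ≤ p) (c : ℝ≥0∞) {f : α → ℝ≥0∞}
    (hf : Measurable f) : eLpNorm (fun x => c * f x) p μ = c * eLpNorm f p μ := by
  by_cases hp' : p = ⊤
  · subst hp'
    rw [eLpNorm_ennreal_top, eLpNorm_ennreal_top, ENNReal.essSup_const_mul]
  · have h : 0 < p.toReal := ENNReal.toReal_pos (one_pos.trans_le hp).ne' hp'
    rw [eLpNorm_ennreal_eq hp hp', eLpNorm_ennreal_eq hp hp']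
    simp only [ENNReal.mul_rpow_of_nonneg _ _ h.le]
    rw [lintegral_const_mul _ (hf.pow_const _), ENNReal.mul_rpow_of_nonneg _ _ (by positivity),
      ← ENNReal.rpow_mul, mul_one_div_cancel h.ne', ENNReal.rpow_one]

theorem measurable_eLpNorm_prod [SFinite μ] {p : ℝ≥0∞} (hp : 1 ≤ p) {F : α × β → ℝ≥0∞}
    (hF : Measurable F) : Measurable fun y => eLpNorm (fun x => F (x, y)) p μ := by
  by_cases hp' : p = ⊤
  · subst hp'
    simp only [eLpNorm_ennreal_top]
    refine measurable_of_Ioi fun a => ?_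
    -- The essential supremum exceeds `a` exactly when the superlevel set has positive measure, and
    -- measures of sections are measurable.
    have h : (fun y => essSup (fun x => F (x, y)) μ) ⁻¹' Set.Ioi a =
        {y | μ ((fun x => (x, y)) ⁻¹' {z | a < F z}) = 0}ᶜ := by
      ext y
      simp only [Set.mem_preimage, Set.mem_Ioi, Set.mem_compl_iff, Set.mem_ofPred_eq]
      rw [← not_iff_not, not_not, not_lt]
      constructor
      · intro h
        have := ENNReal.ae_le_essSup (μ := μ) (fun x => F (x, y))
        rw [ae_iff] at this
        refine measure_mono_null (fun x hx => ?_) this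
        exact not_le.2 (lt_of_le_of_lt h hx)
      · intro h
        refine essSup_le_of_ae_le a ?_
        rw [Filter.EventuallyLE, ae_iff]
        simpa using h
    rw [h]
    exact (measurable_measure_prodMk_right (measurableSet_lt measurable_const hF)
      (measurableSet_singleton 0)).compl
  · simp only [eLpNorm_ennreal_eq hp hp']
    exact (Measurable.lintegral_prod_left' (hF.pow_const _)).pow_const _

/-- Minkowski's integral inequality. -/
theorem eLpNorm_lintegral_le [SigmaFinite μ] [SFinite ν] {p : ℝ≥0∞} (hp : 1 ≤ p)
    {F : α × β → ℝ≥0∞} (hF : Measurable F) :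
    eLpNorm (fun x => ∫⁻ y, F (x, y) ∂ν) p μ ≤ ∫⁻ y, eLpNorm (fun x => F (x, y)) p μ ∂ν := by
  have hm := measurable_eLpNorm_prod (μ := μ) hp hF
  by_cases hp' : p = ⊤
  · subst hp'
    have h1 : ∀ y, ∀ᵐ x ∂μ, F (x, y) ≤ eLpNorm (fun x => F (x, y)) ⊤ μ := fun y => by
      rw [eLpNorm_ennreal_top]
      exact ENNReal.ae_le_essSup (fun x => F (x, y))
    have h2 : ∀ᵐ x ∂μ, ∀ᵐ y ∂ν, F (x, y) ≤ eLpNorm (fun x => F (x, y)) ⊤ μ := by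
      refine (Measure.ae_ae_comm
        (p := fun x y => F (x, y) ≤ eLpNorm (fun x => F (x, y)) ⊤ μ) ?_).2
        (Eventually.of_forall h1)
      exact measurableSet_le (f := F)
        (g := fun z : α × β => eLpNorm (fun x => F (x, z.2)) ⊤ μ) hF (hm.comp measurable_snd)
    rw [eLpNorm_ennreal_top]
    exact essSup_le_of_ae_le _ (h2.mono fun x hx => lintegral_mono_ae hx)
  have hH : Measurable fun x => ∫⁻ y, F (x, y) ∂ν := hF.lintegral_prod_right'
  rcases hp.eq_or_lt with rfl | hp1
  · simp only [eLpNorm_one_eq_lintegral_enorm, enorm_eq_self]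
    exact (lintegral_lintegral_swap (f := fun x y => F (x, y)) hF.aemeasurable).le
  set r := p.toReal with hr_def
  have hr : 1 < r := by
    rw [hr_def, ← ENNReal.toReal_one]
    exact (ENNReal.toReal_lt_toReal ENNReal.one_ne_top hp').2 hp1
  have hconj := (Real.HolderConjugate.conjExponent hr).symm
  set r' := Real.conjExponent r
  set R := ∫⁻ y, eLpNorm (fun x => F (x, y)) p μ ∂ν
  set H : α → ℝ≥0∞ := fun x => ∫⁻ y, F (x, y) ∂ν with hH_def
  -- Truncation in height and support makes the `L^r` norm finite, so that a power of it may be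
  -- cancelled below; monotone convergence removes the truncation.
  let Hk : ℕ → α → ℝ≥0∞ := fun k => (spanningSets μ k).indicator fun x => min (H x) k
  have hHk : ∀ k, Measurable (Hk k) := fun k =>
    (hH.min measurable_const).indicator (measurableSet_spanningSets μ k)
  have hHkle : ∀ k x, Hk k x ≤ H x := fun k x =>
    (Set.indicator_le_self' (fun _ _ => zero_le) x).trans (min_le_left _ _)
  have hfin : ∀ k, ∫⁻ x, Hk k x ^ r ∂μ ≠ ⊤ := fun k => by
    have h1 : ∀ x, Hk k x ^ r ≤ (spanningSets μ k).indicator (fun _ => (k : ℝ≥0∞) ^ r) x := by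
      intro x
      by_cases hx : x ∈ spanningSets μ k
      · simp only [Hk, Set.indicator_of_mem hx]
        exact ENNReal.rpow_le_rpow (min_le_right _ _) (by linarith)
      · simp only [Hk, Set.indicator_of_notMem hx]
        rw [ENNReal.zero_rpow_of_pos (by linarith)]
    refine ((lintegral_mono h1).trans_lt ?_).ne
    rw [lintegral_indicator_const (measurableSet_spanningSets μ k)]
    exact ENNReal.mul_lt_top (ENNReal.rpow_lt_top_of_nonneg (by linarith) (by simp))
      (measure_spanningSets_lt_top μ k)
  -- Write `Hk ^ r ≤ Hk ^ (r - 1) * H`, exchange the integrals and apply Hölder in `x`; here `(r -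
  -- 1) r' = r`.
  have hkey : ∀ k, ∫⁻ x, Hk k x ^ r ∂μ ≤ (∫⁻ x, Hk k x ^ r ∂μ) ^ (1 / r') * R := fun k => by
    calc ∫⁻ x, Hk k x ^ r ∂μ ≤ ∫⁻ x, ∫⁻ y, Hk k x ^ (r - 1) * F (x, y) ∂ν ∂μ := by
          refine lintegral_mono fun x => ?_
          rw [lintegral_const_mul _
            (show Measurable fun y => F (x, y) from hF.comp measurable_prodMk_left)]
          calc Hk k x ^ r = Hk k x ^ (r - 1) * Hk k x := by
                nth_rewrite 3 [← ENNReal.rpow_one (Hk k x)]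
                rw [← ENNReal.rpow_add_of_nonneg _ _ (by linarith) zero_le_one, sub_add_cancel]
            _ ≤ _ := by gcongr; exact hHkle k x
      _ = ∫⁻ y, ∫⁻ x, Hk k x ^ (r - 1) * F (x, y) ∂μ ∂ν :=
          lintegral_lintegral_swap (f := fun x y => Hk k x ^ (r - 1) * F (x, y))
            ((((hHk k).comp measurable_fst).pow_const _).mul hF).aemeasurable
      _ ≤ ∫⁻ y, (∫⁻ x, Hk k x ^ r ∂μ) ^ (1 / r') * eLpNorm (fun x => F (x, y)) p μ ∂ν := by
          refine lintegral_mono fun y => ?_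
          have h := ENNReal.lintegral_mul_le_Lp_mul_Lq μ hconj
            ((hHk k).pow_const (r - 1)).aemeasurable
            ((hF.comp measurable_prodMk_right : Measurable fun x => F (x, y))).aemeasurable
          rw [eLpNorm_ennreal_eq hp hp']
          refine h.trans_eq ?_
          congr 2
          refine lintegral_congr fun x => ?_
          rw [← ENNReal.rpow_mul]
          congr 1
          exact hconj.symm.sub_one_mul_conj
      _ = _ := lintegral_const_mul _ hm
  have hle : ∀ k, ∫⁻ x, Hk k x ^ r ∂μ ≤ R ^ r := fun k => by
    set D := ∫⁻ x, Hk k x ^ r ∂μ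
    by_cases hD : D = 0
    · rw [hD]; exact zero_le
    have h1 : D ^ (1 / r) * D ^ (1 / r') ≤ R * D ^ (1 / r') := by
      rw [← ENNReal.rpow_add _ _ hD (hfin k), one_div, one_div, hconj.symm.inv_add_inv_eq_one,
        ENNReal.rpow_one, mul_comm]
      simpa [one_div] using hkey k
    have hD1 : D ^ (1 / r') ≠ 0 := by
      exact (ENNReal.rpow_pos (pos_iff_ne_zero.2 hD) (hfin k)).ne'
    have hD2 : D ^ (1 / r') ≠ ⊤ :=
      ENNReal.rpow_ne_top_of_nonneg (one_div_nonneg.2 hconj.nonneg) (hfin k)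
    have h2 := (ENNReal.mul_le_mul_iff_left hD1 hD2).1 h1
    calc D = (D ^ (1 / r)) ^ r := by
          rw [← ENNReal.rpow_mul, one_div_mul_cancel (by linarith), ENNReal.rpow_one]
      _ ≤ R ^ r := ENNReal.rpow_le_rpow h2 (by linarith)
  have hmono : Monotone Hk := fun k l hkl x => by
    by_cases hx : x ∈ spanningSets μ k
    · simp only [Hk, Set.indicator_of_mem hx,
        Set.indicator_of_mem (monotone_spanningSets μ hkl hx)]
      exact min_le_min_left _ (by exact_mod_cast hkl)
    · simp only [Hk, Set.indicator_of_notMem hx]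
      exact zero_le
  have hsup : ∀ x, ⨆ k, Hk k x ^ r = H x ^ r := fun x => by
    refine le_antisymm (iSup_le fun k => ENNReal.rpow_le_rpow (hHkle k x) (by linarith)) ?_
    obtain ⟨k₀, hk₀⟩ := Set.mem_iUnion.1 ((iUnion_spanningSets μ).symm ▸ Set.mem_univ x)
    have h1 : Tendsto (fun k : ℕ => min (H x) (k : ℝ≥0∞) ^ r) atTop (𝓝 (H x ^ r)) := by
      have h2 := (tendsto_const_nhds (x := H x)).min ENNReal.tendsto_nat_nhds_top
      rw [min_eq_left le_top] at h2
      exact (ENNReal.continuous_rpow_const.tendsto _).comp h2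
    refine le_of_tendsto h1 ((eventually_ge_atTop k₀).mono fun k hk => ?_)
    have h3 : Hk k x = min (H x) k := Set.indicator_of_mem (monotone_spanningSets μ hk hk₀) _
    rw [← h3]
    exact le_iSup (fun k => Hk k x ^ r) k
  have hint : ∫⁻ x, H x ^ r ∂μ ≤ R ^ r := by
    simp only [← hsup]
    rw [lintegral_iSup (fun k => (hHk k).pow_const r)
      (fun k l hkl x => ENNReal.rpow_le_rpow (hmono hkl x) (by linarith))]
    exact iSup_le hle
  rw [eLpNorm_ennreal_eq hp hp']
  calc _ ≤ (R ^ r) ^ (1 / r) := ENNReal.rpow_le_rpow hint (by positivity)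
    _ = R := by rw [← ENNReal.rpow_mul, mul_one_div_cancel (by linarith), ENNReal.rpow_one]

theorem eLpNorm_ennreal_mul_le {p p₁ p₂ : ℝ≥0∞} (hp : 1 ≤ p) (h : p⁻¹ = p₁⁻¹ + p₂⁻¹)
    {f g : α → ℝ≥0∞} (hf : Measurable f) (hg : Measurable g) :
    eLpNorm (fun x => f x * g x) p μ ≤ eLpNorm f p₁ μ * eLpNorm g p₂ μ := by
  by_cases h1 : p₁ = ⊤
  · subst h1
    obtain rfl : p = p₂ := by simpa using h
    rw [← eLpNorm_ennreal_const_mul hp _ hg, eLpNorm_ennreal_top]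
    refine eLpNorm_ennreal_mono_ae ?_
    filter_upwards [ENNReal.ae_le_essSup (μ := μ) f] with x hx
    gcongr
  by_cases h2 : p₂ = ⊤
  · subst h2
    obtain rfl : p = p₁ := by simpa using h
    rw [mul_comm, ← eLpNorm_ennreal_const_mul hp _ hf, eLpNorm_ennreal_top]
    refine eLpNorm_ennreal_mono_ae ?_
    filter_upwards [ENNReal.ae_le_essSup (μ := μ) g] with x hx
    rw [mul_comm]
    gcongr
  have hp1 : p ≤ p₁ := by rw [← ENNReal.inv_le_inv, h]; exact le_self_add
  have hp2 : p ≤ p₂ := by rw [← ENNReal.inv_le_inv, h]; exact le_add_self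
  have hpt : p ≠ ⊤ := ne_top_of_le_ne_top h1 hp1
  have hr : 0 < p.toReal := ENNReal.toReal_pos (one_pos.trans_le hp).ne' hpt
  have hr1 : 0 < p₁.toReal := ENNReal.toReal_pos (one_pos.trans_le (hp.trans hp1)).ne' h1
  have hr2 : 0 < p₂.toReal := ENNReal.toReal_pos (one_pos.trans_le (hp.trans hp2)).ne' h2
  have hrr : 1 / p.toReal = 1 / p₁.toReal + 1 / p₂.toReal := by
    have h3 := congrArg ENNReal.toReal h
    rw [ENNReal.toReal_add (by simp [(one_pos.trans_le (hp.trans hp1)).ne'])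
      (by simp [(one_pos.trans_le (hp.trans hp2)).ne'])] at h3
    simpa using h3
  have hlt : p.toReal < p₁.toReal := by
    have : 1 / p₁.toReal < 1 / p.toReal := by rw [hrr]; simpa using hr2
    exact (one_div_lt_one_div hr1 hr).1 this
  rw [eLpNorm_ennreal_eq hp hpt, eLpNorm_ennreal_eq (hp.trans hp1) h1,
    eLpNorm_ennreal_eq (hp.trans hp2) h2]
  exact ENNReal.lintegral_Lp_mul_le_Lq_mul_Lr hr hlt hrr μ hf.aemeasurable hg.aemeasurable

/-- Log-convexity in its crudest form: an intermediate norm is at most the larger outer norm. -/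
theorem eLpNorm_ennreal_le_max {p p' : ℝ≥0∞} (hp : 1 ≤ p) (hpp : p ≤ p') (f : α → ℝ≥0∞) :
    eLpNorm f p' μ ≤ max (eLpNorm f p μ) (eLpNorm f ⊤ μ) := by
  by_cases hp' : p' = ⊤
  · subst hp'; exact le_max_right _ _
  have hpt : p ≠ ⊤ := ne_top_of_le_ne_top hp' hpp
  have hr : 0 < p.toReal := ENNReal.toReal_pos (one_pos.trans_le hp).ne' hpt
  have hr' : 0 < p'.toReal := ENNReal.toReal_pos (one_pos.trans_le (hp.trans hpp)).ne' hp'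
  have hle : p.toReal ≤ p'.toReal := (ENNReal.toReal_le_toReal hpt hp').2 hpp
  set M := max (eLpNorm f p μ) (eLpNorm f ⊤ μ) with hM
  by_cases hMt : M = ⊤
  · rw [hMt]; exact le_top
  have h1 : ∫⁻ x, f x ^ p'.toReal ∂μ ≤ M ^ p'.toReal := by
    calc _ ≤ ∫⁻ x, M ^ (p'.toReal - p.toReal) * f x ^ p.toReal ∂μ := by
          refine lintegral_mono_ae ?_
          filter_upwards [ENNReal.ae_le_essSup (μ := μ) f] with x hx
          rw [← eLpNorm_ennreal_top] at hx
          have hx' : f x ≤ M := hx.trans (le_max_right _ _)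
          calc f x ^ p'.toReal = f x ^ (p'.toReal - p.toReal) * f x ^ p.toReal := by
                rw [← ENNReal.rpow_add_of_nonneg _ _ (by linarith) hr.le, sub_add_cancel]
            _ ≤ _ := by
                gcongr
      _ = M ^ (p'.toReal - p.toReal) * ∫⁻ x, f x ^ p.toReal ∂μ :=
          lintegral_const_mul' _ _ (ENNReal.rpow_ne_top_of_nonneg (by linarith) hMt)
      _ ≤ M ^ (p'.toReal - p.toReal) * M ^ p.toReal := by
          rw [← eLpNorm_ennreal_rpow hp hpt]
          gcongr
          exact le_max_left _ _
      _ = _ := by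
          rw [← ENNReal.rpow_add_of_nonneg _ _ (by linarith) hr.le, sub_add_cancel]
  rw [eLpNorm_ennreal_eq (hp.trans hpp) hp']
  calc _ ≤ (M ^ p'.toReal) ^ (1 / p'.toReal) := ENNReal.rpow_le_rpow h1 (by positivity)
    _ = M := by rw [← ENNReal.rpow_mul, mul_one_div_cancel hr'.ne', ENNReal.rpow_one]

end LebesgueNorms

/-! ### Weighted mixed norms on phase space and convolution inequalities. -/

noncomputable section

variable {n : ℕ}

local notation "E" => EuclideanSpace ℝ (Fin n)

theorem ae_lt_top_of_eLpNorm_ne_top {α : Type*} [MeasurableSpace α] {μ : Measure α} {p : ℝ≥0∞}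
    (hp : 1 ≤ p) {f : α → ℝ≥0∞} (hf : Measurable f) (h : eLpNorm f p μ ≠ ⊤) :
    ∀ᵐ x ∂μ, f x < ⊤ := by
  by_cases hp' : p = ⊤
  · subst hp'
    rw [eLpNorm_ennreal_top] at h
    filter_upwards [ENNReal.ae_le_essSup (μ := μ) f] with x hx
    exact hx.trans_lt h.lt_top
  · have hr : 0 < p.toReal := ENNReal.toReal_pos (one_pos.trans_le hp).ne' hp'
    have h1 : ∫⁻ x, f x ^ p.toReal ∂μ ≠ ⊤ := by
      rw [← eLpNorm_ennreal_rpow hp hp']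
      exact ENNReal.rpow_ne_top_of_nonneg hr.le h
    filter_upwards [ae_lt_top (hf.pow_const _) h1] with x hx
    exact (ENNReal.rpow_lt_top_iff_of_pos hr).1 hx

theorem eLpNorm_comp_sub_right (f : E → ℝ≥0∞) (hf : Measurable f) (p : ℝ≥0∞) (y : E) :
    eLpNorm (fun x => f (x - y)) p volume = eLpNorm f p volume :=
  eLpNorm_comp_measurePreserving hf.aestronglyMeasurable (measurePreserving_sub_right volume y)

theorem eLpNorm_comp_sub_left (f : E → ℝ≥0∞) (hf : Measurable f) (p : ℝ≥0∞) (y : E) :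
    eLpNorm (fun x => f (y - x)) p volume = eLpNorm f p volume :=
  eLpNorm_comp_measurePreserving hf.aestronglyMeasurable (Measure.measurePreserving_sub_left volume y)

/-- Young's inequality with an integrable kernel. -/
theorem eLpNorm_convolution_le {p : ℝ≥0∞} (hp : 1 ≤ p) {k g : E → ℝ≥0∞} (hk : Measurable k)
    (hg : Measurable g) :
    eLpNorm (fun x => ∫⁻ y, k (x - y) * g y) p volume ≤
      (∫⁻ y, k y) * eLpNorm g p volume := by
  have h1 : ∀ x, ∫⁻ y, k (x - y) * g y = ∫⁻ y, k y * g (x - y) := fun x => by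
    rw [← lintegral_sub_left_eq_self (fun y => k y * g (x - y)) x]
    simp only [sub_sub_cancel]
  simp only [h1]
  refine (eLpNorm_lintegral_le (F := fun z : E × E => k z.2 * g (z.1 - z.2)) hp
    ((hk.comp measurable_snd).mul (hg.comp (measurable_fst.sub measurable_snd)))).trans_eq ?_
  rw [← lintegral_mul_const _ hk]
  refine lintegral_congr fun y => ?_
  dsimp only
  rw [eLpNorm_ennreal_const_mul hp _ (f := fun x => g (x - y)) (by fun_prop),
    eLpNorm_comp_sub_right g hg p y]

/-- The output exponent `p` is Young's inequality and the output exponent `∞` is Hölder's; any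
exponent between them is covered by the larger of the two bounds. -/
theorem eLpNorm_convolution_le_of_le {p p' : ℝ≥0∞} (hp : 1 ≤ p) (hpp : p ≤ p')
    {k g : E → ℝ≥0∞} (hk : Measurable k) (hg : Measurable g) :
    eLpNorm (fun x => ∫⁻ y, k (x - y) * g y) p' volume ≤
      max (eLpNorm k 1 volume) (eLpNorm k ⊤ volume) * eLpNorm g p volume := by
  set M := max (eLpNorm k 1 volume) (eLpNorm k ⊤ volume)
  refine (eLpNorm_ennreal_le_max hp hpp _).trans (max_le ?_ ?_)
  · refine (eLpNorm_convolution_le hp hk hg).trans ?_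
    gcongr
    refine le_trans (le_of_eq ?_) (le_max_left _ _)
    rw [eLpNorm_one_eq_lintegral_enorm]
    simp
  · rw [eLpNorm_ennreal_top]
    refine essSup_le_of_ae_le _ (Eventually.of_forall fun x => ?_)
    -- The conjugate exponent in this form includes both endpoints: it is `⊤` for `p = 1` and `1`
    -- for `p = ⊤`.
    have h1 : (1 : ℝ≥0∞)⁻¹ = ((1 - p⁻¹)⁻¹)⁻¹ + p⁻¹ := by
      rw [inv_inv, inv_one, tsub_add_cancel_of_le (ENNReal.inv_le_one.2 hp)]
    have h2 : 1 ≤ (1 - p⁻¹)⁻¹ := ENNReal.one_le_inv.2 tsub_le_self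
    have h3 := eLpNorm_ennreal_mul_le (μ := (volume : Measure E)) le_rfl h1
      (hk.comp (measurable_const.sub measurable_id : Measurable fun y => x - y)) hg
    rw [eLpNorm_one_eq_lintegral_enorm] at h3
    simp only [enorm_eq_self, Function.comp_apply] at h3
    refine h3.trans ?_
    refine mul_le_mul_left ?_ _
    exact (eLpNorm_comp_sub_left k hk _ x).trans_le (eLpNorm_ennreal_le_max le_rfl h2 k)

/-- The weight `(1 + |ξ|)^s`. -/
def weight (s : ℝ) (ξ : E) : ℝ≥0∞ := ENNReal.ofReal ((1 + ‖ξ‖) ^ s)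

theorem measurable_weight (s : ℝ) : Measurable (weight s : E → ℝ≥0∞) := by
  unfold weight
  exact ((measurable_norm.const_add 1).pow_const s).ennreal_ofReal

theorem weight_pos (s : ℝ) (ξ : E) : 0 < weight s ξ :=
  ENNReal.ofReal_pos.2 (Real.rpow_pos_of_pos (by positivity) _)

theorem weight_le_mul {s : ℝ} (hs : 0 ≤ s) (ξ η : E) :
    weight s ξ ≤ weight s (ξ - η) * weight s η := by
  unfold weight
  rw [← ENNReal.ofReal_mul (by positivity), ← Real.mul_rpow (by positivity) (by positivity)]
  refine ENNReal.ofReal_le_ofReal (Real.rpow_le_rpow (by positivity) ?_ hs)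
  have h1 : ‖ξ‖ ≤ ‖ξ - η‖ + ‖η‖ := by simpa using norm_add_le (ξ - η) η
  nlinarith [norm_nonneg (ξ - η), norm_nonneg η, mul_nonneg (norm_nonneg (ξ - η)) (norm_nonneg η)]

/-- The norm of `L^q_ξ L^p_x` with weight `(1 + |ξ|)^s`. -/
def mixedNorm (p q : ℝ≥0∞) (s : ℝ) (a : E × E → ℝ≥0∞) : ℝ≥0∞ :=
  eLpNorm (fun ξ => weight s ξ * eLpNorm (fun x => a (x, ξ)) p volume) q volume

theorem mixedNorm_mono {p q : ℝ≥0∞} {s : ℝ} {a b : E × E → ℝ≥0∞} (h : ∀ z, a z ≤ b z) :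
    mixedNorm p q s a ≤ mixedNorm p q s b :=
  eLpNorm_ennreal_mono fun ξ => by
    gcongr
    exact eLpNorm_ennreal_mono fun x => h _

theorem mixedNorm_const_mul {p q : ℝ≥0∞} (hp : 1 ≤ p) (hq : 1 ≤ q) {s : ℝ} (c : ℝ≥0∞)
    {a : E × E → ℝ≥0∞} (ha : Measurable a) :
    mixedNorm p q s (fun z => c * a z) = c * mixedNorm p q s a := by
  unfold mixedNorm
  rw [← eLpNorm_ennreal_const_mul hq c
    (f := fun ξ => weight s ξ * eLpNorm (fun x => a (x, ξ)) p volume)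
    ((measurable_weight s).mul (measurable_eLpNorm_prod hp ha))]
  congr 1
  ext ξ
  dsimp only
  rw [eLpNorm_ennreal_const_mul hp c (f := fun x => a (x, ξ)) (ha.comp measurable_prodMk_right)]
  ring

/-- One finite value is enough later: for a function smeared with `decayKernel`, finiteness spreads
from one point to all of phase space. -/
theorem exists_lt_top_of_mixedNorm_ne_top {p q : ℝ≥0∞} (hp : 1 ≤ p) (hq : 1 ≤ q) {s : ℝ}
    {a : E × E → ℝ≥0∞} (ha : Measurable a) (h : mixedNorm p q s a ≠ ⊤) : ∃ z, a z < ⊤ := by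
  have h1 := ae_lt_top_of_eLpNorm_ne_top hq
    ((measurable_weight s).mul (measurable_eLpNorm_prod hp ha)) h
  obtain ⟨ξ, hξ⟩ := h1.exists
  have h2 : eLpNorm (fun x => a (x, ξ)) p volume ≠ ⊤ := fun h => by
    rw [Pi.mul_apply, h, ENNReal.mul_top (weight_pos s ξ).ne'] at hξ
    exact lt_irrefl _ hξ
  have h3 := ae_lt_top_of_eLpNorm_ne_top hp
    (ha.comp measurable_prodMk_right : Measurable fun x => a (x, ξ)) h2
  obtain ⟨x, hx⟩ := h3.exists
  exact ⟨(x, ξ), hx⟩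

/-- Convolution of a function on phase space with the kernel `κ ⊗ κ`. -/
def smear (κ : E → ℝ≥0∞) (a : E × E → ℝ≥0∞) (z₀ : E × E) : ℝ≥0∞ :=
  ∫⁻ z : E × E, a z * (κ (z₀.1 - z.1) * κ (z₀.2 - z.2))

theorem measurable_smear {κ : E → ℝ≥0∞} (hκ : Measurable κ) {a : E × E → ℝ≥0∞}
    (ha : Measurable a) : Measurable (smear κ a) := by
  unfold smear
  refine Measurable.lintegral_prod_right'
    (f := fun w : (E × E) × (E × E) => a w.2 * (κ (w.1.1 - w.2.1) * κ (w.1.2 - w.2.2))) ?_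
  fun_prop

/-- In frequency, submultiplicativity of the weight for `s ≥ 0` reduces to Young's inequality with
kernel `κ * weight s`. In `x`, a kernel that is integrable and bounded may raise the exponent from
`p` to `p'`; this is the embedding of modulation spaces in the first index. -/
theorem mixedNorm_smear_le {p p' q : ℝ≥0∞} (hp : 1 ≤ p) (hpp : p ≤ p') (hq : 1 ≤ q) {s : ℝ}
    (hs : 0 ≤ s) {κ : E → ℝ≥0∞} (hκ : Measurable κ) {a : E × E → ℝ≥0∞} (ha : Measurable a) :
    mixedNorm p' q s (smear κ a) ≤
      (max (eLpNorm κ 1 volume) (eLpNorm κ ⊤ volume) * ∫⁻ y, κ y * weight s y) *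
        mixedNorm p q s a := by
  set M := max (eLpNorm κ 1 volume) (eLpNorm κ ⊤ volume)
  have hκ' : Measurable fun z : E × E => κ (z.1 - z.2) := by fun_prop
  have ha' := measurable_eLpNorm_prod (μ := (volume : Measure E)) hp ha
  have hw := measurable_weight (n := n) s
  have h1 : ∀ ξ, eLpNorm (fun x => smear κ a (x, ξ)) p' volume ≤
      ∫⁻ η, κ (ξ - η) * (M * eLpNorm (fun x => a (x, η)) p volume) := fun ξ => by
    have h2 : ∀ x, smear κ a (x, ξ) =
        ∫⁻ η, κ (ξ - η) * ∫⁻ y, κ (x - y) * a (y, η) := fun x => by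
      unfold smear
      rw [Measure.volume_eq_prod, lintegral_prod_symm]
      · refine lintegral_congr fun η => ?_
        rw [← lintegral_const_mul]
        · refine lintegral_congr fun y => ?_
          ring
        · fun_prop
      · fun_prop
    simp only [h2]
    have hF : Measurable fun z : E × E => ∫⁻ y, κ (z.1 - y) * a (y, z.2) := by
      refine Measurable.lintegral_prod_right'
        (f := fun w : (E × E) × E => κ (w.1.1 - w.2) * a (w.2, w.1.2)) ?_
      fun_prop
    refine (eLpNorm_lintegral_le
      (F := fun z : E × E => κ (ξ - z.2) * ∫⁻ y, κ (z.1 - y) * a (y, z.2)) (hp.trans hpp)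
      (by fun_prop)).trans (lintegral_mono fun η => ?_)
    dsimp only
    rw [eLpNorm_ennreal_const_mul (hp.trans hpp)]
    · gcongr
      exact eLpNorm_convolution_le_of_le hp hpp hκ
        (ha.comp measurable_prodMk_right : Measurable fun x => a (x, η))
    · exact hF.comp measurable_prodMk_right
  calc mixedNorm p' q s (smear κ a)
      ≤ eLpNorm (fun ξ => ∫⁻ η, (κ (ξ - η) * weight s (ξ - η)) *
          (M * (weight s η * eLpNorm (fun x => a (x, η)) p volume))) q volume := by
        refine eLpNorm_ennreal_mono fun ξ => ?_
        calc _ ≤ weight s ξ * ∫⁻ η, κ (ξ - η) * (M * eLpNorm (fun x => a (x, η)) p volume) := by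
              gcongr
              exact h1 ξ
          _ = ∫⁻ η, weight s ξ * (κ (ξ - η) * (M * eLpNorm (fun x => a (x, η)) p volume)) := by
              rw [lintegral_const_mul]
              fun_prop
          _ ≤ _ := by
              refine lintegral_mono fun η => ?_
              calc _ ≤ (weight s (ξ - η) * weight s η) *
                    (κ (ξ - η) * (M * eLpNorm (fun x => a (x, η)) p volume)) := by
                    gcongr
                    exact weight_le_mul hs ξ η
                _ = _ := by ring
    _ ≤ (∫⁻ y, κ y * weight s y) *
          eLpNorm (fun η => M * (weight s η * eLpNorm (fun x => a (x, η)) p volume)) q volume :=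
        eLpNorm_convolution_le hq (k := fun y => κ y * weight s y) (by fun_prop) (by fun_prop)
    _ = _ := by
        rw [eLpNorm_ennreal_const_mul hq M
          (f := fun η => weight s η * eLpNorm (fun x => a (x, η)) p volume) (hw.mul ha')]
        unfold mixedNorm
        ring

/-- The weighted Young-type inequality for convolutions in `L^q` when `s₁ + s₂ - s₀ > n / q'`. -/
theorem eLpNorm_weight_mul_convolution_le {q q' : ℝ≥0∞} (hq : 1 ≤ q) (hqq' : q⁻¹ + q'⁻¹ = 1)
    {s₀ s₁ s₂ : ℝ} (hs₀ : 0 ≤ s₀) (hs₁ : s₀ ≤ s₁) (hs₂ : s₀ ≤ s₂) {α β : E → ℝ≥0∞}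
    (hα : Measurable α) (hβ : Measurable β) :
    eLpNorm (fun τ => weight s₀ τ * ∫⁻ η, α η * β (τ - η)) q volume ≤
      (ENNReal.ofReal (2 ^ s₀) * (2 * eLpNorm (weight (-(s₁ + s₂ - s₀)) : E → ℝ≥0∞) q' volume)) *
        (eLpNorm (fun η => weight s₁ η * α η) q volume *
          eLpNorm (fun η => weight s₂ η * β η) q volume) := by
  set r := s₁ + s₂ - s₀ with hr_def
  set ρ : E → ℝ≥0∞ := weight (-r)
  have hρ : Measurable ρ := measurable_weight _
  set a : E → ℝ≥0∞ := fun η => weight s₁ η * α η with ha_def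
  set b : E → ℝ≥0∞ := fun η => weight s₂ η * β η with hb_def
  have ha : Measurable a := (measurable_weight _).mul hα
  have hb : Measurable b := (measurable_weight _).mul hβ
  -- With `A = 1 + ‖η‖` and `B = 1 + ‖τ - η‖`, the larger of the two controls `1 + ‖τ‖` up to the
  -- factor `2`. If `A` is larger, its surplus power `s₁ - s₀ ≥ 0` is traded for the same power of
  -- `B`, leaving `B ^ (-r)`; the other case is symmetric. The sum over `ρ` covers both cases.
  have hwt : ∀ τ η : E, weight s₀ τ ≤ ENNReal.ofReal (2 ^ s₀) *
      ((ρ η + ρ (τ - η)) * (weight s₁ η * weight s₂ (τ - η))) := fun τ η => by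
    have key : ∀ {A B t₁ t₂ : ℝ}, 0 < B → B ≤ A → s₀ ≤ t₁ → t₁ + t₂ - s₀ = r →
        A ^ s₀ ≤ B ^ (-r) * (A ^ t₁ * B ^ t₂) := by
      intro A B t₁ t₂ hB hBA ht hr
      have hA : 0 < A := hB.trans_le hBA
      have h1 : B ^ (-r) * (A ^ t₁ * B ^ t₂) = A ^ s₀ * ((A / B) ^ (t₁ - s₀)) := by
        rw [Real.div_rpow hA.le hB.le, Real.rpow_sub hA, Real.rpow_sub hB, ← hr,
          Real.rpow_neg hB.le, Real.rpow_sub hB, Real.rpow_add hB]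
        have := (Real.rpow_pos_of_pos hA s₀).ne'
        have := (Real.rpow_pos_of_pos hB s₀).ne'
        have := (Real.rpow_pos_of_pos hB t₁).ne'
        have := (Real.rpow_pos_of_pos hB t₂).ne'
        field_simp
      rw [h1]
      exact le_mul_of_one_le_right (Real.rpow_nonneg hA.le _)
        (Real.one_le_rpow ((one_le_div hB).2 hBA) (by linarith))
    unfold ρ weight
    rw [← ENNReal.ofReal_add (by positivity) (by positivity),
      ← ENNReal.ofReal_mul (by positivity), ← ENNReal.ofReal_mul (by positivity),
      ← ENNReal.ofReal_mul (by positivity)]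
    refine ENNReal.ofReal_le_ofReal ?_
    set A := 1 + ‖η‖
    set B := 1 + ‖τ - η‖
    have hA : 0 < A := by positivity
    have hB : 0 < B := by positivity
    have hτ : 1 + ‖τ‖ ≤ A + B := by
      have : ‖τ‖ ≤ ‖τ - η‖ + ‖η‖ := by simpa using norm_add_le (τ - η) η
      simp only [A, B]; linarith
    rcases le_total B A with h | h
    · calc (1 + ‖τ‖) ^ s₀ ≤ (2 * A) ^ s₀ :=
            Real.rpow_le_rpow (by positivity) (by linarith) hs₀
        _ = 2 ^ s₀ * A ^ s₀ := Real.mul_rpow (by norm_num) hA.le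
        _ ≤ 2 ^ s₀ * (B ^ (-r) * (A ^ s₁ * B ^ s₂)) := by
            gcongr
            exact key hB h hs₁ rfl
        _ ≤ _ := by
            gcongr
            exact le_add_of_nonneg_left (by positivity)
    · calc (1 + ‖τ‖) ^ s₀ ≤ (2 * B) ^ s₀ :=
            Real.rpow_le_rpow (by positivity) (by linarith) hs₀
        _ = 2 ^ s₀ * B ^ s₀ := Real.mul_rpow (by norm_num) hB.le
        _ ≤ 2 ^ s₀ * (A ^ (-r) * (B ^ s₂ * A ^ s₁)) := by
            gcongr
            exact key hA h hs₂ (by rw [hr_def]; ring)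
        _ = 2 ^ s₀ * (A ^ (-r) * (A ^ s₁ * B ^ s₂)) := by ring
        _ ≤ _ := by
            gcongr
            exact le_add_of_nonneg_right (by positivity)
  have hq'1 : 1 ≤ q' := by
    rw [← ENNReal.inv_le_one, ← hqq']
    exact le_add_self
  have hab : ∀ τ, Measurable fun η => a η * b (τ - η) := fun τ => by fun_prop
  set P : E → ℝ≥0∞ := fun τ => eLpNorm (fun η => a η * b (τ - η)) q volume with hP_def
  have hP : Measurable P := measurable_eLpNorm_prod
    (F := fun z : E × E => a z.1 * b (z.2 - z.1)) hq (by fun_prop)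
  set c := ENNReal.ofReal (2 ^ s₀)
  have hholder : ∀ (τ : E) (σ : E → ℝ≥0∞), Measurable σ →
      ∫⁻ η, σ η * (a η * b (τ - η)) ≤ eLpNorm σ q' volume * P τ := fun τ σ hσ => by
    have h := eLpNorm_ennreal_mul_le (μ := (volume : Measure E)) (p₁ := q') (p₂ := q) le_rfl
      (by rw [inv_one, ← hqq', add_comm]) hσ (hab τ)
    rw [eLpNorm_one_eq_lintegral_enorm] at h
    simpa only [enorm_eq_self] using h
  have hpt : ∀ τ, weight s₀ τ * ∫⁻ η, α η * β (τ - η) ≤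
      (c * (2 * eLpNorm ρ q' volume)) * P τ := fun τ => by
    calc weight s₀ τ * ∫⁻ η, α η * β (τ - η) = ∫⁻ η, weight s₀ τ * (α η * β (τ - η)) := by
          rw [lintegral_const_mul]
          fun_prop
      _ ≤ ∫⁻ η, c * (ρ η * (a η * b (τ - η)) + ρ (τ - η) * (a η * b (τ - η))) := by
          refine lintegral_mono fun η => ?_
          calc _ ≤ (c * ((ρ η + ρ (τ - η)) * (weight s₁ η * weight s₂ (τ - η)))) *
                (α η * β (τ - η)) := by
                gcongr
                exact hwt τ η
            _ = _ := by simp only [ha_def, hb_def]; ring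
      _ = c * ((∫⁻ η, ρ η * (a η * b (τ - η))) + ∫⁻ η, ρ (τ - η) * (a η * b (τ - η))) := by
          rw [lintegral_const_mul, lintegral_add_left]
          · fun_prop
          · fun_prop
      _ ≤ c * (eLpNorm ρ q' volume * P τ + eLpNorm ρ q' volume * P τ) := by
          gcongr
          · exact hholder τ ρ hρ
          · refine (hholder τ (fun η => ρ (τ - η)) (by fun_prop)).trans_eq ?_
            rw [eLpNorm_comp_sub_left ρ hρ]
      _ = _ := by ring
  -- For finite `q`, the function `P ^ q` is the convolution of `a ^ q` and `b ^ q`, whose integral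
  -- factors by Tonelli.
  have hPle : eLpNorm P q volume ≤ eLpNorm a q volume * eLpNorm b q volume := by
    by_cases hqt : q = ⊤
    · rw [hqt, eLpNorm_ennreal_top (f := P)]
      refine essSup_le_of_ae_le _ (Eventually.of_forall fun τ => ?_)
      have h := eLpNorm_ennreal_mul_le (μ := (volume : Measure E)) (p := ⊤) (p₁ := ⊤) (p₂ := ⊤)
        le_top (by simp) ha (g := fun η => b (τ - η)) (by fun_prop)
      rw [eLpNorm_comp_sub_left b hb] at h
      simpa only [hP_def, hqt] using h
    · have hq0 : 0 < q.toReal := ENNReal.toReal_pos (one_pos.trans_le hq).ne' hqt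
      have h1 : ∫⁻ τ, P τ ^ q.toReal = (eLpNorm a q volume * eLpNorm b q volume) ^ q.toReal := by
        simp only [hP_def, eLpNorm_ennreal_rpow hq hqt]
        rw [lintegral_lintegral_swap (f := fun τ η => (a η * b (τ - η)) ^ q.toReal)
          (by fun_prop), ENNReal.mul_rpow_of_nonneg _ _ hq0.le, eLpNorm_ennreal_rpow hq hqt,
          ← lintegral_mul_const _ (ha.pow_const _)]
        refine lintegral_congr fun η => ?_
        simp only [ENNReal.mul_rpow_of_nonneg _ _ hq0.le]
        rw [lintegral_const_mul _ (by fun_prop), ← eLpNorm_ennreal_rpow hq hqt (fun τ => b (τ - η)),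
          eLpNorm_comp_sub_right b hb]
      rw [eLpNorm_ennreal_eq hq hqt, h1, ← ENNReal.rpow_mul, mul_one_div_cancel hq0.ne',
        ENNReal.rpow_one]
  calc _ ≤ eLpNorm (fun τ => (c * (2 * eLpNorm ρ q' volume)) * P τ) q volume :=
        eLpNorm_ennreal_mono hpt
    _ = (c * (2 * eLpNorm ρ q' volume)) * eLpNorm P q volume :=
        eLpNorm_ennreal_const_mul hq _ hP
    _ ≤ _ := by gcongr

/-- Minkowski moves the `x`-norm inside the `η`-integral and Hölder splits it there; what remains is
the weighted convolution inequality for functions of the frequency alone. -/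
theorem mixedNorm_mul_convolution_le {p p₁ p₂ q q' : ℝ≥0∞} (hp : 1 ≤ p)
    (hpp : p⁻¹ = p₁⁻¹ + p₂⁻¹) (hq : 1 ≤ q) (hqq' : q⁻¹ + q'⁻¹ = 1) {s₀ s₁ s₂ : ℝ}
    (hs₀ : 0 ≤ s₀) (hs₁ : s₀ ≤ s₁) (hs₂ : s₀ ≤ s₂) {a b : E × E → ℝ≥0∞}
    (ha : Measurable a) (hb : Measurable b) :
    mixedNorm p q s₀ (fun z => ∫⁻ η, a (z.1, η) * b (z.1, z.2 - η)) ≤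
      (ENNReal.ofReal (2 ^ s₀) * (2 * eLpNorm (weight (-(s₁ + s₂ - s₀)) : E → ℝ≥0∞) q' volume)) *
        (mixedNorm p₁ q s₁ a * mixedNorm p₂ q s₂ b) := by
  have hp1 : 1 ≤ p₁ := hp.trans (by rw [← ENNReal.inv_le_inv, hpp]; exact le_self_add)
  have hp2 : 1 ≤ p₂ := hp.trans (by rw [← ENNReal.inv_le_inv, hpp]; exact le_add_self)
  refine le_trans (eLpNorm_ennreal_mono fun τ => ?_)
    (eLpNorm_weight_mul_convolution_le hq hqq' hs₀ hs₁ hs₂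
      (measurable_eLpNorm_prod hp1 ha) (measurable_eLpNorm_prod hp2 hb))
  gcongr
  refine (eLpNorm_lintegral_le (F := fun z : E × E => a (z.1, z.2) * b (z.1, τ - z.2)) hp
    (by fun_prop)).trans (lintegral_mono fun η => ?_)
  exact eLpNorm_ennreal_mul_le hp hpp (ha.comp measurable_prodMk_right)
    (g := fun x => b (x, τ - η)) (hb.comp measurable_prodMk_right)

theorem eLpNorm_weight_neg_lt_top {r : ℝ} {q : ℝ≥0∞} (hq : 1 ≤ q) (hq' : q ≠ ⊤)
    (hr : (n : ℝ) / q.toReal < r) : eLpNorm (weight (-r) : E → ℝ≥0∞) q volume < ⊤ := by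
  have hq0 : 0 < q.toReal := ENNReal.toReal_pos (one_pos.trans_le hq).ne' hq'
  rw [eLpNorm_ennreal_eq hq hq']
  refine ENNReal.rpow_lt_top_of_nonneg (by positivity) ?_
  have h := (integrable_one_add_norm (μ := (volume : Measure E)) (r := r * q.toReal)
    (by rw [finrank_euclideanSpace_fin]; exact (div_lt_iff₀ hq0).1 hr)).lintegral_lt_top
  refine (lt_of_le_of_lt (lintegral_mono fun x => le_of_eq ?_) h).ne
  rw [weight, ENNReal.ofReal_rpow_of_nonneg (by positivity) hq0.le, ← Real.rpow_mul (by positivity),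
    neg_mul]

/-! ### The phase space formula for products and its passage to the limit. -/

theorem integral_angularFourier_mul (Φ : 𝓢(E, ℂ)) {G : E → ℂ} (hG : Integrable G) :
    ∫ ζ, angularFourier Φ ζ * ∫ t, Complex.exp (Complex.I * ((inner ℝ t ζ : ℝ) : ℂ)) * G t =
      (2 * Real.pi) ^ n * ∫ t, Φ t * G t := by
  let K : E → E → ℂ := fun ζ t =>
    Complex.exp (Complex.I * ((inner ℝ t ζ : ℝ) : ℂ)) * (angularFourier Φ ζ * G t)
  have hK : Integrable (Function.uncurry K) (volume.prod volume) := by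
    refine (((angularFourier Φ).integrable (μ := volume)).mul_prod hG).norm.mono' ?_
      (Eventually.of_forall fun z => ?_)
    · refine AEStronglyMeasurable.mul (Continuous.aestronglyMeasurable (by fun_prop)) ?_
      exact (((angularFourier Φ).integrable (μ := volume)).mul_prod hG).aestronglyMeasurable
    · simp only [K, Function.uncurry_def]
      rw [norm_mul, norm_exp_I_mul, one_mul]
  calc _ = ∫ ζ, ∫ t, K ζ t := by
        refine integral_congr_ae (Eventually.of_forall fun ζ => ?_)
        simp only [K]
        rw [← integral_const_mul]
        refine integral_congr_ae (Eventually.of_forall fun t => ?_)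
        ring
    _ = ∫ t, ∫ ζ, K ζ t := integral_integral_swap hK
    _ = ∫ t, (2 * Real.pi) ^ n * (Φ t * G t) := by
        refine integral_congr_ae (Eventually.of_forall fun t => ?_)
        simp only [K]
        rw [← mul_assoc, ← integral_exp_mul_angularFourier, ← integral_mul_const]
        refine integral_congr_ae (Eventually.of_forall fun ζ => ?_)
        ring
    _ = _ := integral_const_mul _ _

theorem integrable_angularFourier_mul_windowPairing (Φ Ψ χ θ : 𝓢(E, ℂ)) (x : E) :
    Integrable (Function.uncurry fun τ η : E =>
      angularFourier Φ η * angularFourier Ψ (τ - η) * windowPairing χ θ x τ)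
      (volume.prod volume) := by
  obtain ⟨q, -, hq⟩ := exists_seminorm_windowPairing_le χ 0
  have hW : Continuous fun τ => windowPairing χ θ x τ :=
    (continuous_windowPairing χ θ).comp (f := fun τ => (x, τ)) (by fun_prop)
  have h1 := Integrable.convolution_integrand (μ := (volume : Measure E)) (ν := volume)
    (ContinuousLinearMap.mul ℝ ℂ) ((angularFourier Φ).integrable (μ := volume))
    ((angularFourier Ψ).integrable (μ := volume))
  simp only [ContinuousLinearMap.mul_apply'] at h1
  have h2 : Continuous fun z : E × E => windowPairing χ θ x z.1 := hW.comp continuous_fst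
  exact h1.mul_bdd (c := q θ) h2.aestronglyMeasurable
    (Eventually.of_forall fun z => by simpa [decay] using hq θ x z.1)

theorem integral_angularFourier_mul_windowPairing_add (Ψ χ θ : 𝓢(E, ℂ)) (x η : E) :
    ∫ ζ, angularFourier Ψ ζ * windowPairing χ θ x (ζ + η) =
      (2 * Real.pi) ^ n * ∫ t, Complex.exp (Complex.I * ((inner ℝ t η : ℝ) : ℂ)) *
        (Ψ t * (χ (t - x) * θ t)) := by
  let G : E → ℂ := fun t => Complex.exp (Complex.I * ((inner ℝ t η : ℝ) : ℂ)) *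
    (SchwartzMap.smulLeftCLM ℂ (SchwartzMap.compSubConstCLM ℂ x χ) θ) t
  have hG : Integrable G := by
    refine ((SchwartzMap.smulLeftCLM ℂ (SchwartzMap.compSubConstCLM ℂ x χ) θ).integrable
      (μ := volume)).norm.mono' (Continuous.aestronglyMeasurable (by fun_prop))
      (Eventually.of_forall fun t => ?_)
    rw [norm_mul, norm_exp_I_mul, one_mul]
  have h : ∀ ζ, windowPairing χ θ x (ζ + η) =
      ∫ t, Complex.exp (Complex.I * ((inner ℝ t ζ : ℝ) : ℂ)) * G t := fun ζ => by
    rw [windowPairing_eq_integral]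
    refine integral_congr_ae (Eventually.of_forall fun t => ?_)
    simp only [G, smulLeft_compSubConst_apply]
    rw [inner_add_right, Complex.ofReal_add, mul_add, Complex.exp_add, mul_assoc]
  simp only [h]
  rw [integral_angularFourier_mul Ψ hG]
  congr 1
  refine integral_congr_ae (Eventually.of_forall fun t => ?_)
  simp only [G, smulLeft_compSubConst_apply]
  rw [mul_left_comm]

/-- The convolution theorem in weak form. Each of the two frequency integrals is one Fourier
inversion, contributing one factor `(2π) ^ n`. -/
theorem integral_integral_angularFourier_mul_windowPairing (Φ Ψ χ θ : 𝓢(E, ℂ)) (x : E) :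
    ∫ τ, ∫ η, angularFourier Φ η * angularFourier Ψ (τ - η) * windowPairing χ θ x τ =
      ((2 * Real.pi) ^ n * (2 * Real.pi) ^ n) * ∫ t, Φ t * (Ψ t * (χ (t - x) * θ t)) := by
  have hΨΘ : ∀ t, (SchwartzMap.smulLeftCLM ℂ Ψ (SchwartzMap.smulLeftCLM ℂ
      (SchwartzMap.compSubConstCLM ℂ x χ) θ)) t = Ψ t * (χ (t - x) * θ t) := fun t => by
    rw [SchwartzMap.smulLeftCLM_apply_apply Ψ.hasTemperateGrowth, smul_eq_mul,
      smulLeft_compSubConst_apply]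
  have h3 := integral_angularFourier_mul Φ ((SchwartzMap.smulLeftCLM ℂ Ψ (SchwartzMap.smulLeftCLM ℂ
      (SchwartzMap.compSubConstCLM ℂ x χ) θ)).integrable (μ := volume))
  simp only [hΨΘ] at h3
  rw [integral_integral_swap (integrable_angularFourier_mul_windowPairing Φ Ψ χ θ x)]
  calc _ = ∫ η, (2 * Real.pi) ^ n * (angularFourier Φ η *
        ∫ t, Complex.exp (Complex.I * ((inner ℝ t η : ℝ) : ℂ)) *
          (Ψ t * (χ (t - x) * θ t))) := by
        refine integral_congr_ae (Eventually.of_forall fun η => ?_)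
        simp only
        rw [mul_left_comm, ← integral_angularFourier_mul_windowPairing_add,
          ← integral_add_right_eq_self _ η, ← integral_const_mul]
        simp only [mul_assoc, add_sub_cancel_right]
    _ = _ := by
        rw [integral_const_mul, h3, mul_assoc]

/-- The factor `conj φ(· - x)` turns the temperate function `u` into a Schwartz function, so the
preceding identities apply for each fixed `x`. -/
theorem gabor_toTemperedDistribution (φ : 𝓢(E, ℂ)) {u : E → ℂ} (hu : u.HasTemperateGrowth)
    (x η : E) : gabor φ (hu.toTemperedDistribution volume) x η =
      angularFourier (SchwartzMap.smulLeftCLM ℂ u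
        (SchwartzMap.compSubConstCLM ℂ x (conjS φ))) η := by
  rw [angularFourier_apply]
  change ∫ t, shiftedWindow φ x η t • u t = _
  refine integral_congr_ae (Eventually.of_forall fun t => ?_)
  simp only [shiftedWindow_apply, SchwartzMap.smulLeftCLM_apply_apply hu, smul_eq_mul]
  rw [mul_assoc, mul_comm _ (u t)]
  rfl

/-- The square of the window. -/
def squareWindow (φ : 𝓢(E, ℂ)) : 𝓢(E, ℂ) := SchwartzMap.smulLeftCLM ℂ φ φ

theorem squareWindow_apply (φ : 𝓢(E, ℂ)) (t : E) : squareWindow φ t = φ t * φ t := by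
  rw [squareWindow, SchwartzMap.smulLeftCLM_apply_apply φ.hasTemperateGrowth, smul_eq_mul]

/-- The integrand in the phase space formula for a product. -/
def productIntegrand (φ : 𝓢(E, ℂ)) (f g : 𝓢'(E, ℂ)) (θ : 𝓢(E, ℂ)) (z : (E × E) × E) : ℂ :=
  gabor φ f z.1.1 z.2 * gabor φ g z.1.1 (z.1.2 - z.2) *
    windowPairing (squareWindow φ) θ z.1.1 z.1.2

theorem continuous_productIntegrand (φ : 𝓢(E, ℂ)) (f g : 𝓢'(E, ℂ)) (θ : 𝓢(E, ℂ)) :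
    Continuous (productIntegrand φ f g θ) := by
  unfold productIntegrand
  refine Continuous.mul (Continuous.mul ?_ ?_) ?_
  · exact (continuous_gabor φ f).comp (f := fun z : (E × E) × E => (z.1.1, z.2)) (by fun_prop)
  · exact (continuous_gabor φ g).comp (f := fun z : (E × E) × E => (z.1.1, z.1.2 - z.2))
      (by fun_prop)
  · exact (continuous_windowPairing _ θ).comp (f := fun z : (E × E) × E => z.1) (by fun_prop)

/-- The normalising constant in the phase space formula for a product. -/
def productConst (φ : 𝓢(E, ℂ)) : ℂ :=
  ((2 * Real.pi) ^ n * (2 * Real.pi) ^ n) * ∫ t, (φ t * (starRingEnd ℂ) (φ t)) ^ 2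

theorem productConst_ne_zero {φ : 𝓢(E, ℂ)} (hφ : φ ≠ 0) : productConst φ ≠ 0 := by
  refine mul_ne_zero ?_ (integral_mul_conj_ne_zero hφ 1)
  simp [Real.pi_ne_zero]

/-- For fixed `x` the frequency integrals give `∫ u v θ |φ(t - x)| ^ 4 dt`: one `conj φ` comes from
each transform and `φ ^ 2` from the squared window, chosen so that the total factor is nonnegative.
Translation invariance in `x` then separates the constant `∫ |φ| ^ 4`. -/
theorem integral_productIntegrand_toTemperedDistribution (φ θ : 𝓢(E, ℂ)) {u v : E → ℂ}
    (hu : u.HasTemperateGrowth) (hv : v.HasTemperateGrowth)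
    (hint : Integrable (productIntegrand φ (hu.toTemperedDistribution volume)
      (hv.toTemperedDistribution volume) θ)) :
    ∫ z, productIntegrand φ (hu.toTemperedDistribution volume)
      (hv.toTemperedDistribution volume) θ z =
      productConst φ * (hu.mul hv).toTemperedDistribution volume θ := by
  set Θ : 𝓢(E, ℂ) := SchwartzMap.smulLeftCLM ℂ (u * v) θ with hΘ_def
  have hΘ : ∀ t, Θ t = u t * v t * θ t := fun t => by
    rw [hΘ_def, SchwartzMap.smulLeftCLM_apply_apply (hu.mul hv), smul_eq_mul, Pi.mul_apply]
  set k : E → ℂ := fun t => (φ t * (starRingEnd ℂ) (φ t)) ^ 2 with hk_def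
  have hk : Integrable k := by
    have h := (SchwartzMap.smulLeftCLM ℂ (conjS φ) (SchwartzMap.smulLeftCLM ℂ (conjS φ)
      (squareWindow φ))).integrable (μ := volume)
    refine h.congr (Eventually.of_forall fun t => ?_)
    simp only [hk_def]
    rw [SchwartzMap.smulLeftCLM_apply_apply (conjS φ).hasTemperateGrowth,
      SchwartzMap.smulLeftCLM_apply_apply (conjS φ).hasTemperateGrowth, squareWindow_apply,
      conjS_apply, smul_eq_mul, smul_eq_mul]
    ring
  have hconv : Integrable (Function.uncurry fun x t : E => Θ t * k (t - x))
      (volume.prod volume) := by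
    have h := Integrable.convolution_integrand (μ := (volume : Measure E)) (ν := volume)
      (ContinuousLinearMap.mul ℝ ℂ) (Θ.integrable (μ := volume)) hk.comp_neg
    refine h.congr (Eventually.of_forall fun z => ?_)
    simp [Function.uncurry_def]
  have hinner : ∀ x, ∫ τ, ∫ η, productIntegrand φ (hu.toTemperedDistribution volume)
      (hv.toTemperedDistribution volume) θ ((x, τ), η) =
      ((2 * Real.pi) ^ n * (2 * Real.pi) ^ n) * ∫ t, Θ t * k (t - x) := fun x => by
    simp only [productIntegrand, gabor_toTemperedDistribution]
    rw [integral_integral_angularFourier_mul_windowPairing]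
    congr 1
    refine integral_congr_ae (Eventually.of_forall fun t => ?_)
    simp only [hΘ, hk_def, SchwartzMap.smulLeftCLM_apply_apply hu,
      SchwartzMap.smulLeftCLM_apply_apply hv, smul_eq_mul, squareWindow_apply]
    change u t * (starRingEnd ℂ) (φ (t - x)) * (v t * (starRingEnd ℂ) (φ (t - x)) * _) = _
    ring
  have hright : (hu.mul hv).toTemperedDistribution volume θ = ∫ t, Θ t := by
    change ∫ t, θ t • (u * v) t = _
    refine integral_congr_ae (Eventually.of_forall fun t => ?_)
    simp only [hΘ, smul_eq_mul, Pi.mul_apply]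
    ring
  have hint' : Integrable (productIntegrand φ (hu.toTemperedDistribution volume)
      (hv.toTemperedDistribution volume) θ) ((volume.prod volume).prod volume) := hint
  rw [Measure.volume_eq_prod, Measure.volume_eq_prod, integral_prod _ hint',
    integral_prod _ hint'.integral_prod_left]
  simp only [hinner]
  have hlast : ∫ t, ∫ x, Θ t * k (t - x) = (∫ t, k t) * ∫ t, Θ t := by
    rw [← integral_const_mul]
    refine integral_congr_ae (Eventually.of_forall fun t => ?_)
    simp only
    rw [integral_const_mul, integral_sub_left_eq_self k volume t, mul_comm]
  rw [integral_const_mul, integral_integral_swap hconv, hlast, hright, productConst]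
  simp only [hk_def]
  ring

/-- The modulus of the short-time Fourier transform as a function on phase space. -/
def gaborAbs (φ : 𝓢(E, ℂ)) (f : 𝓢'(E, ℂ)) (z : E × E) : ℝ≥0∞ := ‖gabor φ f z.1 z.2‖ₑ

theorem measurable_gaborAbs (φ : 𝓢(E, ℂ)) (f : 𝓢'(E, ℂ)) : Measurable (gaborAbs φ f) :=
  (continuous_gabor φ f).enorm.measurable

/-- `decay N` with values in `[0, ∞]`. -/
def decayKernel (N : ℕ) (x : E) : ℝ≥0∞ := ENNReal.ofReal (decay N x)

theorem measurable_decayKernel (N : ℕ) : Measurable (decayKernel N : E → ℝ≥0∞) :=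
  (continuous_decay N).measurable.ennreal_ofReal

theorem decayKernel_le_mul (N : ℕ) (x y : E) :
    decayKernel N x ≤ ENNReal.ofReal ((1 + ‖y‖) ^ N) * decayKernel N (x + y) := by
  unfold decayKernel
  rw [← ENNReal.ofReal_mul (by positivity)]
  exact ENNReal.ofReal_le_ofReal (decay_le_mul N x y)

/-- The polynomial kernel is moderate: moving its centre from `z` to `w` changes it by at most a
finite factor depending on `z - w`. -/
theorem smear_decayKernel_lt_top {N : ℕ} {a : E × E → ℝ≥0∞} {z : E × E}
    (h : smear (decayKernel N) a z < ⊤) (w : E × E) : smear (decayKernel N) a w < ⊤ := by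
  set c := ENNReal.ofReal ((1 + ‖z.1 - w.1‖) ^ N) * ENNReal.ofReal ((1 + ‖z.2 - w.2‖) ^ N)
  have hc : c ≠ ⊤ := ENNReal.mul_ne_top ENNReal.ofReal_ne_top ENNReal.ofReal_ne_top
  refine lt_of_le_of_lt ?_ (ENNReal.mul_lt_top hc.lt_top h)
  unfold smear
  rw [← lintegral_const_mul' _ _ hc]
  refine lintegral_mono fun y => ?_
  have h1 := decayKernel_le_mul N (w.1 - y.1) (z.1 - w.1)
  have h2 := decayKernel_le_mul N (w.2 - y.2) (z.2 - w.2)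
  rw [show w.1 - y.1 + (z.1 - w.1) = z.1 - y.1 by abel] at h1
  rw [show w.2 - y.2 + (z.2 - w.2) = z.2 - y.2 by abel] at h2
  calc _ ≤ a y * ((ENNReal.ofReal ((1 + ‖z.1 - w.1‖) ^ N) * decayKernel N (z.1 - y.1)) *
        (ENNReal.ofReal ((1 + ‖z.2 - w.2‖) ^ N) * decayKernel N (z.2 - y.2))) := by gcongr
    _ = _ := by ring

theorem eLpNorm_decayKernel_lt_top {N : ℕ} (hN : n < N) :
    max (eLpNorm (decayKernel N : E → ℝ≥0∞) 1 volume) (eLpNorm (decayKernel N : E → ℝ≥0∞) ⊤ volume) < ⊤ := by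
  refine max_lt ?_ ?_
  · rw [eLpNorm_one_eq_lintegral_enorm]
    simp only [enorm_eq_self]
    exact (integrable_decay hN).lintegral_lt_top
  · rw [eLpNorm_ennreal_top]
    refine lt_of_le_of_lt (essSup_le_of_ae_le 1 (Eventually.of_forall fun x => ?_))
      ENNReal.one_lt_top
    refine ENNReal.ofReal_le_one.2 (inv_le_one_of_one_le₀ (one_le_pow₀ ?_))
    linarith [norm_nonneg x]

theorem lintegral_decayKernel_mul_weight_lt_top {N : ℕ} {s : ℝ} (h : n + s < N) :
    ∫⁻ y : E, decayKernel N y * weight s y < ⊤ := by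
  have h1 := (integrable_one_add_norm (μ := (volume : Measure E)) (r := N - s)
    (by rw [finrank_euclideanSpace_fin]; linarith)).lintegral_lt_top
  refine lt_of_le_of_lt (lintegral_mono fun x => le_of_eq ?_) h1
  rw [decayKernel, weight, ← ENNReal.ofReal_mul (decay_pos N x).le]
  congr 1
  rw [neg_sub, Real.rpow_sub (by positivity), Real.rpow_natCast, decay, div_eq_inv_mul]

/-- Fibrewise convolution in the frequency variable. -/
def phaseProduct (a b : E × E → ℝ≥0∞) (z : E × E) : ℝ≥0∞ :=
  ∫⁻ η, a (z.1, η) * b (z.1, z.2 - η)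

theorem measurable_phaseProduct {a b : E × E → ℝ≥0∞} (ha : Measurable a) (hb : Measurable b) :
    Measurable (phaseProduct a b) :=
  Measurable.lintegral_prod_right'
    (f := fun w : (E × E) × E => a (w.1.1, w.2) * b (w.1.1, w.1.2 - w.2)) (by fun_prop)

/-- The dominating function for `productIntegrand`. -/
def productBound (N : ℕ) (a b : E × E → ℝ≥0∞) (w : E × E) (z : (E × E) × E) : ℝ≥0∞ :=
  a (z.1.1, z.2) * b (z.1.1, z.1.2 - z.2) *
    (decayKernel N (w.1 - z.1.1) * decayKernel N (w.2 - z.1.2))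

theorem measurable_productBound (N : ℕ) {a b : E × E → ℝ≥0∞} (ha : Measurable a)
    (hb : Measurable b) (w : E × E) : Measurable (productBound N a b w) := by
  have := measurable_decayKernel (n := n) N
  unfold productBound
  fun_prop

theorem lintegral_productBound (N : ℕ) {a b : E × E → ℝ≥0∞} (ha : Measurable a)
    (hb : Measurable b) (w : E × E) :
    ∫⁻ z, productBound N a b w z = smear (decayKernel N) (phaseProduct a b) w := by
  rw [Measure.volume_eq_prod, lintegral_prod _ (measurable_productBound N ha hb w).aemeasurable]
  refine lintegral_congr fun z => ?_
  unfold productBound phaseProduct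
  exact lintegral_mul_const (decayKernel N (w.1 - z.1) * decayKernel N (w.2 - z.2)) (f := fun η => a (z.1, η) * b (z.1, z.2 - η)) (by fun_prop)

theorem enorm_productIntegrand_le {φ θ : 𝓢(E, ℂ)} {f g : 𝓢'(E, ℂ)} {N : ℕ}
    {a b : E × E → ℝ≥0∞} {w : E × E} {C D : ℝ≥0}
    (hf : ∀ x η, ‖gabor φ f x η‖ₑ ≤ C * a (x, η)) (hg : ∀ x η, ‖gabor φ g x η‖ₑ ≤ C * b (x, η))
    (hθ : ∀ y η, ‖windowPairing (squareWindow φ) θ y η‖ ≤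
      D * (decay N (w.1 - y) * decay N (w.2 - η))) (z : (E × E) × E) :
    ‖productIntegrand φ f g θ z‖ₑ ≤ (C * C * D : ℝ≥0) * productBound N a b w z := by
  have h : ‖windowPairing (squareWindow φ) θ z.1.1 z.1.2‖ₑ ≤
      D * (decayKernel N (w.1 - z.1.1) * decayKernel N (w.2 - z.1.2)) := by
    rw [decayKernel, decayKernel, ← ENNReal.ofReal_mul (decay_pos _ _).le,
      ← ENNReal.ofReal_coe_nnreal, ← ENNReal.ofReal_mul (by positivity), ← ofReal_norm]
    exact ENNReal.ofReal_le_ofReal (hθ _ _)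
  rw [productIntegrand, enorm_mul, enorm_mul]
  calc _ ≤ C * a (z.1.1, z.2) * (C * b (z.1.1, z.1.2 - z.2)) *
        (D * (decayKernel N (w.1 - z.1.1) * decayKernel N (w.2 - z.1.2))) := by
        gcongr
        · exact hf _ _
        · exact hg _ _
    _ = _ := by
        push_cast
        unfold productBound
        ring

theorem exists_windowPairing_le_decay (χ : 𝓢(E, ℂ)) (N : ℕ) :
    ∃ q : Seminorm ℂ 𝓢(E, ℂ), Continuous q ∧ ∀ θ y η, ‖windowPairing χ θ y η‖ ≤
      (q θ).toNNReal * (decay N ((0 : E × E).1 - y) * decay N ((0 : E × E).2 - η)) := by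
  obtain ⟨q, hq, h⟩ := exists_seminorm_windowPairing_le χ N
  refine ⟨q, hq, fun θ y η => ?_⟩
  rw [Real.coe_toNNReal _ (apply_nonneg _ _), Prod.fst_zero, Prod.snd_zero, zero_sub, zero_sub,
    decay_neg, decay_neg, mul_comm]
  exact h θ y η

theorem integrable_productIntegrand {φ θ : 𝓢(E, ℂ)} {f g : 𝓢'(E, ℂ)} {N : ℕ}
    {a b : E × E → ℝ≥0∞} (ha : Measurable a) (hb : Measurable b) {C : ℝ≥0}
    (hf : ∀ x η, ‖gabor φ f x η‖ₑ ≤ C * a (x, η)) (hg : ∀ x η, ‖gabor φ g x η‖ₑ ≤ C * b (x, η))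
    (hab : smear (decayKernel N) (phaseProduct a b) 0 < ⊤) :
    Integrable (productIntegrand φ f g θ) := by
  obtain ⟨q, -, hq⟩ := exists_windowPairing_le_decay (squareWindow φ) N
  refine ⟨(continuous_productIntegrand φ f g θ).aestronglyMeasurable, ?_⟩
  refine lt_of_le_of_lt (lintegral_mono (enorm_productIntegrand_le hf hg (hq θ))) ?_
  rw [lintegral_const_mul' _ _ ENNReal.coe_ne_top, lintegral_productBound N ha hb]
  exact ENNReal.mul_lt_top ENNReal.coe_lt_top hab

/-- This constructs the candidate for the product before any limit is taken. Integrability and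
continuity in `θ` both come from the finite smeared phase product at the origin and the seminorm
bound on `windowPairing`. -/
theorem exists_tempered_productIntegrand {φ : 𝓢(E, ℂ)} {f g : 𝓢'(E, ℂ)} {N : ℕ}
    {a b : E × E → ℝ≥0∞} (ha : Measurable a) (hb : Measurable b) {C : ℝ≥0}
    (hf : ∀ x η, ‖gabor φ f x η‖ₑ ≤ C * a (x, η)) (hg : ∀ x η, ‖gabor φ g x η‖ₑ ≤ C * b (x, η))
    (hab : smear (decayKernel N) (phaseProduct a b) 0 < ⊤) :
    ∃ h : 𝓢'(E, ℂ), ∀ θ, h θ = (productConst φ)⁻¹ * ∫ z, productIntegrand φ f g θ z := by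
  have hint := fun θ => integrable_productIntegrand (θ := θ) ha hb hf hg hab
  let L : 𝓢(E, ℂ) →ₗ[ℂ] ℂ :=
    { toFun := fun θ => (productConst φ)⁻¹ * ∫ z, productIntegrand φ f g θ z
      map_add' := fun θ₁ θ₂ => by
        rw [← mul_add, ← integral_add (hint θ₁) (hint θ₂)]
        congr 1
        refine integral_congr_ae (Eventually.of_forall fun z => ?_)
        simp only [productIntegrand, windowPairing_add]
        ring
      map_smul' := fun c θ => by
        have h : ∀ z, productIntegrand φ f g (c • θ) z = c * productIntegrand φ f g θ z :=
          fun z => by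
            simp only [productIntegrand, windowPairing_smul]
            ring
        simp only [h, integral_const_mul, RingHom.id_apply, smul_eq_mul]
        ring }
  obtain ⟨q, hq, hqb⟩ := exists_windowPairing_le_decay (squareWindow φ) N
  set S := smear (decayKernel N) (phaseProduct a b) 0
  set K : ℝ≥0 := ‖(productConst φ)⁻¹‖₊ * (C * C * S.toNNReal)
  have hL : ∀ θ, ‖L θ‖ ≤ (K • q) θ := fun θ => by
    have h1 : ‖L θ‖ₑ ≤ ((K * (q θ).toNNReal : ℝ≥0) : ℝ≥0∞) := by
      calc ‖L θ‖ₑ = ‖(productConst φ)⁻¹‖ₑ * ‖∫ z, productIntegrand φ f g θ z‖ₑ := enorm_mul _ _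
        _ ≤ ‖(productConst φ)⁻¹‖ₑ * ((C * C * (q θ).toNNReal : ℝ≥0) * S) := by
            gcongr
            refine (enorm_integral_le_lintegral_enorm _).trans
              ((lintegral_mono (enorm_productIntegrand_le hf hg (hqb θ))).trans_eq ?_)
            rw [lintegral_const_mul' _ _ ENNReal.coe_ne_top, lintegral_productBound N ha hb]
        _ = _ := by
            rw [← ENNReal.coe_toNNReal hab.ne, enorm_eq_nnnorm]
            norm_cast
            ring
    have h2 : ‖L θ‖₊ ≤ K * (q θ).toNNReal := by exact_mod_cast h1
    have h3 : (‖L θ‖₊ : ℝ) ≤ K * (q θ).toNNReal := by exact_mod_cast h2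
    rwa [Real.coe_toNNReal _ (apply_nonneg _ _)] at h3
  exact ⟨(⟨L, continuous_of_norm_le_seminorm L (q := K • q) (hq.const_smul K) hL⟩ :
    𝓢(E, ℂ) →L[ℂ] ℂ), fun θ => rfl⟩

/-- Each truncated product is given exactly by the phase space formula. The envelopes of `f` and `g`
supply a majorant independent of `j`, and the integrands converge pointwise because `S^j f`, `S^j g`
converge on every shifted window. -/
theorem isProduct_of_dominated {φ : 𝓢(E, ℂ)} (hφ : φ ≠ 0) {ψ : E → ℂ} (hψ : IsCutoff ψ)
    {f g h : 𝓢'(E, ℂ)} {N : ℕ}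
    (hfg : smear (decayKernel N) (phaseProduct (smear (decayKernel N) (gaborAbs φ f))
      (smear (decayKernel N) (gaborAbs φ g))) 0 < ⊤)
    (hh : ∀ θ, h θ = (productConst φ)⁻¹ * ∫ z, productIntegrand φ f g θ z) :
    IsProduct ψ f g h := by
  set a := smear (decayKernel N) (gaborAbs φ f)
  set b := smear (decayKernel N) (gaborAbs φ g)
  have ha : Measurable a := measurable_smear (measurable_decayKernel N) (measurable_gaborAbs φ f)
  have hb : Measurable b := measurable_smear (measurable_decayKernel N) (measurable_gaborAbs φ g)
  obtain ⟨C, hC⟩ := hψ.exists_gabor_lowPass_le hφ N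
  choose u hu hu' using fun j => hψ.exists_hasTemperateGrowth_lowPass j f
  choose v hv hv' using fun j => hψ.exists_hasTemperateGrowth_lowPass j g
  refine ⟨u, v, hu, hv, hu', hv', ?_⟩
  rw [PointwiseConvergenceCLM.tendsto_iff_forall_tendsto]
  intro θ
  have h1 : ∀ j, ((hu j).mul (hv j)).toTemperedDistribution volume θ =
      (productConst φ)⁻¹ * ∫ z, productIntegrand φ (lowPass ψ j f) (lowPass ψ j g) θ z :=
    fun j => by
      -- `envelope φ N f` and `a` agree by unfolding, so the envelope bound is already in the
      -- required form.
      have hI := integrable_productIntegrand (θ := θ) ha hb (hC f j) (hC g j) hfg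
      rw [← hu' j, ← hv' j] at hI ⊢
      rw [integral_productIntegrand_toTemperedDistribution φ θ (hu j) (hv j) hI,
        inv_mul_cancel_left₀ (productConst_ne_zero hφ)]
  obtain ⟨q, -, hq⟩ := exists_windowPairing_le_decay (squareWindow φ) N
  set K : ℝ≥0 := C * C * (q θ).toNNReal
  have hm : Measurable fun z => (K : ℝ≥0∞) * productBound N a b 0 z :=
    (measurable_productBound N ha hb 0).const_mul _
  have hfin : ∫⁻ z, (K : ℝ≥0∞) * productBound N a b 0 z ≠ ⊤ := by
    rw [lintegral_const_mul' _ _ ENNReal.coe_ne_top, lintegral_productBound N ha hb]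
    exact (ENNReal.mul_lt_top ENNReal.coe_lt_top hfg).ne
  rw [hh θ]
  refine Tendsto.congr (fun j => (h1 j).symm) (Tendsto.const_mul _ ?_)
  refine tendsto_integral_of_dominated_convergence
    (fun z => ((K : ℝ≥0∞) * productBound N a b 0 z).toReal)
    (fun j => (continuous_productIntegrand φ _ _ θ).aestronglyMeasurable)
    (integrable_toReal_of_lintegral_ne_top hm.aemeasurable hfin) (fun j => ?_)
    (Eventually.of_forall fun z => ?_)
  · filter_upwards [ae_lt_top hm hfin] with z hz
    have := enorm_productIntegrand_le (a := a) (b := b) (hC f j) (hC g j) (hq θ) z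
    rw [← toReal_enorm]
    exact ENNReal.toReal_mono hz.ne this
  · exact ((hψ.tendsto_lowPass_apply hφ f _).mul (hψ.tendsto_lowPass_apply hφ g _)).mul_const _

/-! ### Modulation norms versus mixed norms, and the final estimates. -/

theorem modulationNorm_eq (φ : 𝓢(E, ℂ)) {p q : ℝ≥0∞} (hp : 1 ≤ p) (hq : 1 ≤ q) (s : ℝ)
    (f : 𝓢'(E, ℂ)) :
    modulationNorm φ p q s f = ENNReal.ofReal ((2 * Real.pi) ^ (-(n : ℝ) / 2)) *
      eLpNorm (fun ξ => ENNReal.ofReal ((1 + ‖ξ‖ ^ 2) ^ (s / 2)) *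
        eLpNorm (fun x => gaborAbs φ f (x, ξ)) p volume) q volume := by
  have hm := measurable_eLpNorm_prod (μ := (volume : Measure E)) hp (measurable_gaborAbs φ f)
  rw [← eLpNorm_ennreal_const_mul hq _ (f := fun ξ => ENNReal.ofReal ((1 + ‖ξ‖ ^ 2) ^ (s / 2)) *
    eLpNorm (fun x => gaborAbs φ f (x, ξ)) p volume)
    (Measurable.mul (Measurable.ennreal_ofReal (by fun_prop)) hm)]
  unfold modulationNorm
  congr 1
  ext ξ
  have hg : Measurable fun x => gaborAbs φ f (x, ξ) :=
    (measurable_gaborAbs φ f).comp measurable_prodMk_right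
  rw [← eLpNorm_enorm, ← mul_assoc, ← eLpNorm_ennreal_const_mul hp _ hg]
  congr 1
  ext x
  rw [enorm_smul, stft, enorm_mul, gaborAbs, ← mul_assoc, mul_comm (ENNReal.ofReal _)]
  congr 2
  · rw [Real.enorm_eq_ofReal (by positivity)]
  · rw [← ofReal_norm, Complex.norm_real, Real.norm_of_nonneg (by positivity)]

theorem modulationNorm_le_mixedNorm (φ : 𝓢(E, ℂ)) {p q : ℝ≥0∞} (hp : 1 ≤ p) (hq : 1 ≤ q) {s : ℝ}
    (hs : 0 ≤ s) (f : 𝓢'(E, ℂ)) :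
    modulationNorm φ p q s f ≤ ENNReal.ofReal ((2 * Real.pi) ^ (-(n : ℝ) / 2)) *
      mixedNorm p q s (gaborAbs φ f) := by
  rw [modulationNorm_eq φ hp hq]
  gcongr
  refine eLpNorm_ennreal_mono fun ξ => ?_
  gcongr
  refine ENNReal.ofReal_le_ofReal ?_
  calc (1 + ‖ξ‖ ^ 2) ^ (s / 2) ≤ ((1 + ‖ξ‖) ^ (2 : ℝ)) ^ (s / 2) := by
        refine Real.rpow_le_rpow (by positivity) ?_ (by positivity)
        rw [Real.rpow_two]
        nlinarith [norm_nonneg ξ]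
    _ = _ := by
        rw [← Real.rpow_mul (by positivity)]
        congr 1
        ring

theorem exists_mixedNorm_le_modulationNorm (φ : 𝓢(E, ℂ)) {p q : ℝ≥0∞} (hp : 1 ≤ p) (hq : 1 ≤ q)
    {s : ℝ} (hs : 0 ≤ s) : ∃ C : ℝ≥0, ∀ f : 𝓢'(E, ℂ),
    mixedNorm p q s (gaborAbs φ f) ≤ C * modulationNorm φ p q s f := by
  set c := (2 * Real.pi) ^ (-(n : ℝ) / 2)
  have hc : 0 < c := Real.rpow_pos_of_pos (by positivity) _
  -- The factor `2 ^ (s / 2)` comes from `(1 + ‖ξ‖) ^ 2 ≤ 2 * (1 + ‖ξ‖ ^ 2)`, and `c⁻¹` undoes the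
  -- normalisation of `stft`.
  refine ⟨(2 ^ (s / 2) * c⁻¹).toNNReal, fun f => ?_⟩
  have hm := measurable_eLpNorm_prod (μ := (volume : Measure E)) hp (measurable_gaborAbs φ f)
  change ENNReal.ofReal _ * _ ≥ _
  rw [modulationNorm_eq φ hp hq, ← mul_assoc, ← ENNReal.ofReal_mul (by positivity), mul_assoc,
    inv_mul_cancel₀ hc.ne', mul_one, ge_iff_le, ← eLpNorm_ennreal_const_mul hq _
      (f := fun ξ => ENNReal.ofReal ((1 + ‖ξ‖ ^ 2) ^ (s / 2)) *
      eLpNorm (fun x => gaborAbs φ f (x, ξ)) p volume)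
      (Measurable.mul (Measurable.ennreal_ofReal (by fun_prop)) hm)]
  refine eLpNorm_ennreal_mono fun ξ => ?_
  rw [← mul_assoc, ← ENNReal.ofReal_mul (by positivity)]
  gcongr
  refine ENNReal.ofReal_le_ofReal ?_
  rw [← Real.mul_rpow (by norm_num) (by positivity)]
  calc (1 + ‖ξ‖) ^ s = ((1 + ‖ξ‖) ^ (2 : ℝ)) ^ (s / 2) := by
        rw [← Real.rpow_mul (by positivity)]
        congr 1
        ring
    _ ≤ _ := by
        refine Real.rpow_le_rpow (by positivity) ?_ (by positivity)
        rw [Real.rpow_two]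
        nlinarith [sq_nonneg (1 - ‖ξ‖)]

/-- Raising `p₁` and `p₂` is free after smearing, so Hölder's relation may be assumed to be an
equality: `r₁` takes as much of `p⁻¹` as `p₁⁻¹` allows and `r₂` takes the rest. -/
theorem exists_exponents {p p₁ p₂ : ℝ≥0∞} (h : p⁻¹ ≤ p₁⁻¹ + p₂⁻¹) :
    ∃ r₁ r₂ : ℝ≥0∞, p₁ ≤ r₁ ∧ p₂ ≤ r₂ ∧ p⁻¹ = r₁⁻¹ + r₂⁻¹ := by
  refine ⟨(min p⁻¹ p₁⁻¹)⁻¹, (p⁻¹ - min p⁻¹ p₁⁻¹)⁻¹, ?_, ?_, ?_⟩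
  · rw [← ENNReal.inv_le_inv, inv_inv]
    exact min_le_right _ _
  · rw [← ENNReal.inv_le_inv, inv_inv, tsub_le_iff_right]
    rcases min_choice p⁻¹ p₁⁻¹ with h1 | h1
    · rw [h1]; exact le_add_self
    · rw [h1, add_comm]; exact h
  · rw [inv_inv, inv_inv, add_tsub_cancel_of_le (min_le_left _ _)]

theorem exists_mixedNorm_smear_gaborAbs_le (φ : 𝓢(E, ℂ)) {p r q : ℝ≥0∞} (hp : 1 ≤ p)
    (hpr : p ≤ r) (hq : 1 ≤ q) {s : ℝ} (hs : 0 ≤ s) {N : ℕ} (hN : n + s < N) :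
    ∃ C : ℝ≥0, ∀ f : 𝓢'(E, ℂ), mixedNorm r q s (smear (decayKernel N) (gaborAbs φ f)) ≤
      C * modulationNorm φ p q s f := by
  have hN' : n < N := by exact_mod_cast (show (n : ℝ) < N by linarith)
  obtain ⟨C, hC⟩ := exists_mixedNorm_le_modulationNorm φ hp hq hs
  set K := max (eLpNorm (decayKernel N : E → ℝ≥0∞) 1 volume)
    (eLpNorm (decayKernel N : E → ℝ≥0∞) ⊤ volume) * ∫⁻ y : E, decayKernel N y * weight s y
  have hK : K ≠ ⊤ := (ENNReal.mul_lt_top (eLpNorm_decayKernel_lt_top hN')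
    (lintegral_decayKernel_mul_weight_lt_top hN)).ne
  refine ⟨K.toNNReal * C, fun f => ?_⟩
  rw [ENNReal.coe_mul, ENNReal.coe_toNNReal hK, mul_assoc]
  refine (mixedNorm_smear_le hp hpr hq hs (measurable_decayKernel N)
    (measurable_gaborAbs φ f)).trans ?_
  gcongr
  exact hC f

theorem exists_mixedNorm_smear_phaseProduct_le {p r₁ r₂ q q' : ℝ≥0∞} (hp : 1 ≤ p)
    (hpp : p⁻¹ = r₁⁻¹ + r₂⁻¹) (hq : 1 < q) (hqq' : q⁻¹ + q'⁻¹ = 1) {s₀ s₁ s₂ : ℝ}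
    (hs₀ : 0 ≤ s₀) (hs₁ : s₀ ≤ s₁) (hs₂ : s₀ ≤ s₂)
    (hsum : (n : ℝ) / q'.toReal < s₁ + s₂ - s₀) {N : ℕ} (hN : n + s₀ < N) :
    ∃ C : ℝ≥0, ∀ a b : E × E → ℝ≥0∞, Measurable a → Measurable b →
      mixedNorm p q s₀ (smear (decayKernel N) (phaseProduct a b)) ≤
        C * (mixedNorm r₁ q s₁ a * mixedNorm r₂ q s₂ b) := by
  have hN' : n < N := by exact_mod_cast (show (n : ℝ) < N by linarith)
  have hq'1 : 1 ≤ q' := by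
    rw [← ENNReal.inv_le_one, ← hqq']
    exact le_add_self
  -- This is where `q > 1` is used: a finite `q'` lets the strict inequality `hsum` place the
  -- negative weight in `L^{q'}`.
  have hq'top : q' ≠ ⊤ := by
    rintro rfl
    rw [ENNReal.inv_top, add_zero, ENNReal.inv_eq_one] at hqq'
    exact hq.ne' hqq'
  set K := max (eLpNorm (decayKernel N : E → ℝ≥0∞) 1 volume)
    (eLpNorm (decayKernel N : E → ℝ≥0∞) ⊤ volume) * ∫⁻ y : E, decayKernel N y * weight s₀ y
  have hK : K ≠ ⊤ := (ENNReal.mul_lt_top (eLpNorm_decayKernel_lt_top hN')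
    (lintegral_decayKernel_mul_weight_lt_top hN)).ne
  set R := ENNReal.ofReal (2 ^ s₀) *
    (2 * eLpNorm (weight (-(s₁ + s₂ - s₀)) : E → ℝ≥0∞) q' volume)
  have hR : R ≠ ⊤ := ENNReal.mul_ne_top ENNReal.ofReal_ne_top
    (ENNReal.mul_ne_top ENNReal.ofNat_ne_top (eLpNorm_weight_neg_lt_top hq'1 hq'top hsum).ne)
  refine ⟨K.toNNReal * R.toNNReal, fun a b ha hb => ?_⟩
  rw [ENNReal.coe_mul, ENNReal.coe_toNNReal hK, ENNReal.coe_toNNReal hR, mul_assoc]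
  refine (mixedNorm_smear_le hp le_rfl hq.le hs₀ (measurable_decayKernel N)
    (measurable_phaseProduct ha hb)).trans ?_
  gcongr
  exact mixedNorm_mul_convolution_le hp hpp hq.le hqq' hs₀ hs₁ hs₂ ha hb

/-- Testing the formula for `h` on a shifted window, whose pairing with `squareWindow φ` is
concentrated at the same phase space point, bounds the transform of `h` by the smeared phase product
of the two envelopes. Only the formula enters, so no cutoff affects `C`. -/
theorem exists_modulationNorm_le {φ : 𝓢(E, ℂ)} (hφ : φ ≠ 0) {p q : ℝ≥0∞} (hp : 1 ≤ p)
    (hq : 1 ≤ q) {s : ℝ} (hs : 0 ≤ s) (N : ℕ) :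
    ∃ C : ℝ≥0, ∀ f g h : 𝓢'(E, ℂ),
      (∀ θ, h θ = (productConst φ)⁻¹ * ∫ z, productIntegrand φ f g θ z) →
      modulationNorm φ p q s h ≤ C * mixedNorm p q s (smear (decayKernel N)
        (phaseProduct (smear (decayKernel N) (gaborAbs φ f))
          (smear (decayKernel N) (gaborAbs φ g)))) := by
  obtain ⟨C, hC⟩ := exists_gabor_le_envelope hφ N
  obtain ⟨D, hD⟩ := exists_windowPairing_shiftedWindow_le (squareWindow φ) φ N
  set K : ℝ≥0 := ‖(productConst φ)⁻¹‖₊ * (C * C * D)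
  refine ⟨((2 * Real.pi) ^ (-(n : ℝ) / 2)).toNNReal * K, fun f g h hh => ?_⟩
  have hf := measurable_smear (measurable_decayKernel N) (measurable_gaborAbs φ f)
  have hg := measurable_smear (measurable_decayKernel N) (measurable_gaborAbs φ g)
  rw [ENNReal.coe_mul, mul_assoc, ← mixedNorm_const_mul hp hq _
    (measurable_smear (measurable_decayKernel N) (measurable_phaseProduct hf hg))]
  refine (modulationNorm_le_mixedNorm φ hp hq hs h).trans ?_
  refine mul_le_mul_right (mixedNorm_mono fun z => ?_) _
  rw [gaborAbs, gabor, hh, enorm_mul, ENNReal.coe_mul, mul_assoc]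
  refine mul_le_mul_right ?_ _
  refine (enorm_integral_le_lintegral_enorm _).trans ((lintegral_mono
    (enorm_productIntegrand_le (a := smear (decayKernel N) (gaborAbs φ f))
      (b := smear (decayKernel N) (gaborAbs φ g)) (hC f) (hC g) (hD z.1 z.2))).trans_eq ?_)
  rw [lintegral_const_mul' _ _ ENNReal.coe_ne_top, lintegral_productBound N hf hg]

end

end ModulationSpaces

theorem theorem3p16 {n : ℕ}
    (φ : 𝓢(EuclideanSpace ℝ (Fin n), ℂ)) (hφ : φ ≠ 0)
    (p p₁ p₂ q q' : ℝ≥0∞) (s₀ s₁ s₂ : ℝ)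
    (hp : 1 ≤ p) (hp₁ : 1 ≤ p₁) (hp₂ : 1 ≤ p₂)
    (hpp : p⁻¹ ≤ p₁⁻¹ + p₂⁻¹)
    (hq : 1 < q) (hqq' : q⁻¹ + q'⁻¹ = 1)
    (hs₀ : 0 ≤ s₀) (hs : s₀ ≤ min s₁ s₂)
    (hsum : (n : ℝ) / q'.toReal < s₁ + s₂ - s₀) :
    ∃ c : ℝ≥0, ∀ ψ : EuclideanSpace ℝ (Fin n) → ℂ, ModulationSpaces.IsCutoff ψ →
      ∀ f ∈ ModulationSpaces.modulationSpace φ p₁ q s₁,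
      ∀ g ∈ ModulationSpaces.modulationSpace φ p₂ q s₂,
        ∃ h : 𝓢'(EuclideanSpace ℝ (Fin n), ℂ),
          ModulationSpaces.IsProduct ψ f g h ∧
          h ∈ ModulationSpaces.modulationSpace φ p q s₀ ∧
          ModulationSpaces.modulationNorm φ p q s₀ h ≤
            c * ModulationSpaces.modulationNorm φ p₁ q s₁ f *
              ModulationSpaces.modulationNorm φ p₂ q s₂ g := by
  open ModulationSpaces in
  have hs₁ : s₀ ≤ s₁ := hs.trans (min_le_left _ _)
  have hs₂ : s₀ ≤ s₂ := hs.trans (min_le_right _ _)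
  obtain ⟨r₁, r₂, hr₁, hr₂, hrr⟩ := exists_exponents hpp
  -- All three weights are nonnegative, so this single `N` makes the kernel integrable against each
  -- of them.
  obtain ⟨N, hN⟩ := exists_nat_gt (n + (s₀ + s₁ + s₂))
  obtain ⟨C₁, hC₁⟩ := exists_mixedNorm_smear_gaborAbs_le φ hp₁ hr₁ hq.le (hs₀.trans hs₁)
    (N := N) (by linarith)
  obtain ⟨C₂, hC₂⟩ := exists_mixedNorm_smear_gaborAbs_le φ hp₂ hr₂ hq.le (hs₀.trans hs₂)
    (N := N) (by linarith)
  obtain ⟨C₃, hC₃⟩ := exists_mixedNorm_smear_phaseProduct_le (n := n) hp hrr hq hqq' hs₀ hs₁ hs₂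
    hsum (N := N) (by linarith)
  obtain ⟨C₄, hC₄⟩ := exists_modulationNorm_le hφ hp hq.le hs₀ N
  obtain ⟨C₅, hC₅⟩ := exists_gabor_le_envelope hφ N
  -- Every constant has been fixed before `ψ` is introduced.
  refine ⟨C₄ * (C₃ * (C₁ * C₂)), fun ψ hψ f hf g hg => ?_⟩
  have ha := measurable_smear (measurable_decayKernel N) (measurable_gaborAbs φ f)
  have hb := measurable_smear (measurable_decayKernel N) (measurable_gaborAbs φ g)
  set S := smear (decayKernel N) (phaseProduct (smear (decayKernel N) (gaborAbs φ f))
    (smear (decayKernel N) (gaborAbs φ g))) with hS_def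
  have hS : mixedNorm p q s₀ S ≤
      C₃ * ((C₁ * modulationNorm φ p₁ q s₁ f) * (C₂ * modulationNorm φ p₂ q s₂ g)) :=
    (hC₃ _ _ ha hb).trans (by gcongr; exacts [hC₁ f, hC₂ g])
  have hS' : mixedNorm p q s₀ S < ⊤ := hS.trans_lt (ENNReal.mul_lt_top ENNReal.coe_lt_top
    (ENNReal.mul_lt_top (ENNReal.mul_lt_top ENNReal.coe_lt_top hf)
      (ENNReal.mul_lt_top ENNReal.coe_lt_top hg)))
  -- A finite mixed norm gives a point where `S` is finite; moderateness of the kernel carries this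
  -- to the origin, where the absolute convergence of the product formula is measured.
  obtain ⟨z, hz⟩ := exists_lt_top_of_mixedNorm_ne_top hp hq.le
    (measurable_smear (measurable_decayKernel N) (measurable_phaseProduct ha hb)) hS'.ne
  have h0 : S 0 < ⊤ := smear_decayKernel_lt_top hz 0
  obtain ⟨h, hh⟩ := exists_tempered_productIntegrand ha hb (hC₅ f) (hC₅ g) h0
  have hle := hC₄ f g h hh
  refine ⟨h, isProduct_of_dominated hφ hψ h0 hh,
    hle.trans_lt (ENNReal.mul_lt_top ENNReal.coe_lt_top hS'), hle.trans ?_⟩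
  calc _ ≤ C₄ * (C₃ * ((C₁ * modulationNorm φ p₁ q s₁ f) *
        (C₂ * modulationNorm φ p₂ q s₂ g))) := mul_le_mul_right hS _
    _ = _ := by
        push_cast
        ring
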